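/- **Setting.** Let $m\ge 0$, $d=m+1$, $n\ge 0$, $r\in\{2,3,\dots\}\cup\{\infty\}$, and let $f:\mathbb R^n\to\mathbb R^n$ be of class $C^{r+1}$. Let $K\subset\Omega\subset\mathbb R^d\setminus\{0\}$ with $K$ compact and $\Omega$ open, let $\omega:\Omega\to\mathbb R$ and $p:\Omega\times\mathbb R\to\mathbb R^n$ be of class $C^r$, with $p(k,\theta)$ $2\pi$-periodic in $\theta$ and, for $k\in K$, nonconstant in $\theta$ and a solution of $$\omega(k)\,\partial_\theta p+f(p)=|k|^2\,\partial_\theta^2p .$$ For $\xi\in\mathbb R$, $\eta\in\mathbb R^{m}$ let $$L_{\xi,\eta}(k)=-\omega(k)(\partial_\theta+i\xi)-f'(p(k,\theta))+|k|^2(\partial_\theta+i\xi)^2-|\eta|^2$$ on $L^2(\mathbb R/2\pi\mathbb Z;\mathbb C^n)$ with domain $H^2$. Assume diffusive spectral stability for every $k\in K$: (i) $0$ is an (algebraically) simple eigenvalue of $L_{0,0}(k)$, which has no other purely imaginary eigenvalue; (ii) there is $c_0=c_0(k)>0$ with $\Re\,\sigma(L_{\xi,\eta}(k))\le -c_0(|\xi|^2+|\eta|^2)$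 for all $\xi\in[-\frac12,\frac12]$, $\eta\in\mathbb R^{m}$. Fix $c\in\mathbb R^{m}$. For $\lambda=\gamma+i\tau\in\mathbb C$ and $\eta\in\mathbb R^m$ put $$\mathcal M(k,\theta,\lambda,\eta)=\frac1{|k|}\begin{pmatrix}0& I\\ \big(\lambda+i\sum_jc_j\eta_j+|\eta|^2\big)I+f'(p(k,\theta)) & \frac{\omega(k)}{|k|}I\end{pmatrix}.$$ A *Floquet reduction* on an open set $U\subset\Omega\times\mathbb C\times\mathbb R^{m}$ is a pair of matrix functions, $\mathcal W(k,\theta,\lambda,\eta)$, of class $C^r$ on $U\times\mathbb R$, invertible and $2\pi$-periodic in $\theta$, and $\mathcal M_1(k,\lambda,\eta)$, of class $C^r$ on $U$ and independent of $\theta$, with $\partial_\theta\mathcal W+\mathcal W\mathcal M=\mathcal M_1\mathcal W$. A *symmetrizer* for $\mathcal M_1$ on $U$ is a $C^1$ matrix function $\mathcal S=\mathcal S^*$ on $U$ such that at all $(k,\lambda,\eta)\in U$ with $k\in K$, $\gamma\ge0$, writing $\Re A=\frac12(A+A^*)$, $$\Re(\mathcal S\mathcal M_1)=\Big(\gamma+\big|\tau+\textstyle\sum_jc_j\eta_j\big|^2+|\eta|^2\Big)\,\Gamma\quad\text{for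 some }\Gamma\ge I ,$$ where at the points with $(\lambda,\eta)=(0,0)$, at which the scalar factor vanishes, this is read as $\Re(\mathcal S\mathcal M_1)\ge0$. **Proposition 3.3.** Under these assumptions: 1. For every $R$ there is $C$ such that every point $(k_0,\lambda_0,\eta_0)$ with $k_0\in K$, $\Re\lambda_0\ge0$ and $|\lambda_0+i\sum_jc_j\eta_{0,j}|+|\eta_0|^2\le R$ has an open neighborhood $U$ carrying a Floquet reduction $(\mathcal W,\mathcal M_1)$ and a symmetrizer $\mathcal S$ for $\mathcal M_1$ with $|\mathcal S|\le C$ on $U$. 2. For every open $U$ and every Floquet reduction $(\mathcal W,\mathcal M_1)$ on $U$ there is a symmetrizer $\mathcal S$ for $\mathcal M_1$ on $U$, and $\mathcal S$ is bounded on every compact subset of $U$ (in particular on the set of points of frequency at most $R$ as in 1, if $U$ contains it). -/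

import Mathlib

open MeasureTheory
open scoped Matrix Matrix.Norms.L2Operator ComplexOrder

noncomputable section

namespace FloquetSymmetrizer

/-- `ℝ^d` with its Euclidean norm. -/
abbrev RVec (d : ℕ) := EuclideanSpace ℝ (Fin d)

/-- `ℂ^n` with its Hermitian norm. -/
abbrev CVec (n : ℕ) := EuclideanSpace ℂ (Fin n)

/-- Complex `2n × 2n` matrices, written in `n × n` blocks. -/
abbrev Mat2 (n : ℕ) := Matrix (Fin n ⊕ Fin n) (Fin n ⊕ Fin n) ℂ

/-- Frequency points `(k, λ, η)`; here the space dimension is `d = m + 1`, so that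
`k ∈ ℝ^{m+1}` and the transverse frequency is `η ∈ ℝ^m`. -/
abbrev Freq (m : ℕ) := RVec (m + 1) × ℂ × RVec m

/-! ### The family of periodic waves -/

/-- `p(k, ·)`, `ω(k)` is a family of `2π`-periodic profiles, for `k` in the compact set `K`, of
the reaction diffusion system with reaction term `f`: it solves
`ω(k) ∂_θ p + f(p) = |k|² ∂_θ² p`. The functions `p` and `ω` are of class `C^r` on an open
neighbourhood `Ω` of `K` that does not contain `0`. -/
structure IsWaveFamily {d n : ℕ} (r : ℕ∞) (f : RVec n → RVec n) (p : RVec d → ℝ → RVec n)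
    (ω : RVec d → ℝ) (Ω K : Set (RVec d)) : Prop where
  isOpen_dom : IsOpen Ω
  zero_notMem : (0 : RVec d) ∉ Ω
  isCompact : IsCompact K
  subset_dom : K ⊆ Ω
  reaction_smooth : ContDiff ℝ ((r + 1 : ℕ∞) : WithTop ℕ∞) f
  profile_smooth :
    ContDiffOn ℝ (r : WithTop ℕ∞) (fun q : RVec d × ℝ => p q.1 q.2) (Ω ×ˢ Set.univ)
  frequency_smooth : ContDiffOn ℝ (r : WithTop ℕ∞) ω Ω
  periodic : ∀ k ∈ Ω, Function.Periodic (p k) (2 * Real.pi)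
  nontrivial : ∀ k ∈ K, ∃ θ : ℝ, deriv (p k) θ ≠ 0
  profile_eq : ∀ k ∈ K, ∀ θ : ℝ,
    ω k • deriv (p k) θ + f (p k θ) = ‖k‖ ^ 2 • deriv (deriv (p k)) θ

/-- The Jacobian matrix `G(k, θ) = f'(p(k, θ))`, with entries regarded as complex numbers. -/
def jacobianAlong {d n : ℕ} (f : RVec n → RVec n) (p : RVec d → ℝ → RVec n)
    (k : RVec d) (θ : ℝ) : Matrix (Fin n) (Fin n) ℂ :=
  Matrix.of fun i j => ((fderiv ℝ f (p k θ) (EuclideanSpace.single j 1) i : ℝ) : ℂ)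

/-! ### Unbounded operators on `L²(ℝ / 2πℤ; ℂ^n)`

Elements of `L²(ℝ / 2πℤ; ℂ^n)` are represented by square integrable functions on `(0, 2π]`, and
an unbounded operator `T` by its graph: `T v g` means that `v` is in the domain and `T v = g`. -/

/-- Lebesgue measure on one period. -/
def periodMeasure : Measure ℝ := volume.restrict (Set.Ioc 0 (2 * Real.pi))

/-- `w` is the weak derivative of `v` on the circle `ℝ / 2πℤ`: integration by parts holds against
all smooth `2π`-periodic test functions. -/
def HasWeakDeriv {n : ℕ} (v w : ℝ → CVec n) : Prop :=
  ∀ φ : ℝ → ℝ, ContDiff ℝ ((⊤ : ℕ∞) : WithTop ℕ∞) φ → Function.Periodic φ (2 * Real.pi) →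
    ∫ θ, deriv φ θ • v θ ∂periodMeasure = -∫ θ, φ θ • w θ ∂periodMeasure

/-- The graph of the Bloch-Fourier operator
`L_{ξ,η} = -ω(k) (∂_θ + iξ) - f'(p(k, θ)) + |k|² (∂_θ + iξ)² - |η|²` on `L²(ℝ / 2πℤ; ℂ^n)` with
domain the periodic Sobolev space `H²`; `v₁`, `v₂` are the first two weak derivatives of `v`. -/
def BlochGraph {d m n : ℕ} (f : RVec n → RVec n) (p : RVec d → ℝ → RVec n) (ω : RVec d → ℝ)
    (k : RVec d) (ξ : ℝ) (η : RVec m) (v g : ℝ → CVec n) : Prop :=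
  ∃ v₁ v₂ : ℝ → CVec n,
    MemLp v 2 periodMeasure ∧ MemLp v₁ 2 periodMeasure ∧ MemLp v₂ 2 periodMeasure ∧
    HasWeakDeriv v v₁ ∧ HasWeakDeriv v₁ v₂ ∧
    g =ᵐ[periodMeasure] fun θ =>
      -((ω k : ℂ) • (v₁ θ + (Complex.I * ξ) • v θ))
        - Matrix.toEuclideanLin (jacobianAlong f p k θ) (v θ)
        + ((‖k‖ ^ 2 : ℝ) : ℂ) •
            (v₂ θ + (2 * Complex.I * ξ) • v₁ θ + (Complex.I * ξ) ^ 2 • v θ)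
        - ((‖η‖ ^ 2 : ℝ) : ℂ) • v θ

/-- `z` is in the resolvent set of `T`: `T - z` is a bijection from the domain onto `L²`, with
bounded inverse. -/
def IsResolventPoint {n : ℕ} (T : (ℝ → CVec n) → (ℝ → CVec n) → Prop) (z : ℂ) : Prop :=
  ∃ C : NNReal, ∀ h : ℝ → CVec n, MemLp h 2 periodMeasure →
    ∃ v : ℝ → CVec n, T v (fun θ => z • v θ + h θ) ∧
      eLpNorm v 2 periodMeasure ≤ C * eLpNorm h 2 periodMeasure ∧
      ∀ v' : ℝ → CVec n, T v' (fun θ => z • v' θ + h θ) → v' =ᵐ[periodMeasure] v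

/-- The spectrum of `T`. -/
def operatorSpectrum {n : ℕ} (T : (ℝ → CVec n) → (ℝ → CVec n) → Prop) : Set ℂ :=
  {z | ¬ IsResolventPoint T z}

/-- `z` is an eigenvalue of `T`. -/
def IsEigenvalue {n : ℕ} (T : (ℝ → CVec n) → (ℝ → CVec n) → Prop) (z : ℂ) : Prop :=
  ∃ v : ℝ → CVec n, ¬ v =ᵐ[periodMeasure] 0 ∧ T v (fun θ => z • v θ)

/-- `v` is in the kernel of `(T - z)^j`. -/
def InGenEigenspace {n : ℕ} (T : (ℝ → CVec n) → (ℝ → CVec n) → Prop) (z : ℂ) :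
    ℕ → (ℝ → CVec n) → Prop
  | 0, v => v =ᵐ[periodMeasure] 0
  | j + 1, v => ∃ u : ℝ → CVec n, T v (fun θ => z • v θ + u θ) ∧ InGenEigenspace T z j u

/-- `z` is a (algebraically) simple eigenvalue of `T`: the generalized eigenspace
`⋃_j ker (T - z)^j` is spanned by a single eigenfunction. -/
def IsSimpleEigenvalue {n : ℕ} (T : (ℝ → CVec n) → (ℝ → CVec n) → Prop) (z : ℂ) : Prop :=
  ∃ v₀ : ℝ → CVec n, ¬ v₀ =ᵐ[periodMeasure] 0 ∧ T v₀ (fun θ => z • v₀ θ) ∧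
    ∀ (j : ℕ) (v : ℝ → CVec n), InGenEigenspace T z j v →
      ∃ a : ℂ, v =ᵐ[periodMeasure] fun θ => a • v₀ θ

/-- Diffusive spectral stability of the wave with wave vector `k`. The Floquet number `ξ` ranges
over one period `[-1/2, 1/2]` (the spectrum of `L_{ξ,η}` is `1`-periodic in `ξ`). -/
structure DiffusivelyStable {m n : ℕ} (f : RVec n → RVec n) (p : RVec (m + 1) → ℝ → RVec n)
    (ω : RVec (m + 1) → ℝ) (k : RVec (m + 1)) : Prop where
  simple_zero : IsSimpleEigenvalue (BlochGraph f p ω k 0 (0 : RVec m)) 0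
  no_other_imaginary : ∀ τ : ℝ, τ ≠ 0 →
    ¬ IsEigenvalue (BlochGraph f p ω k 0 (0 : RVec m)) (τ * Complex.I)
  decay : ∃ c : ℝ, 0 < c ∧ ∀ ξ ∈ Set.Icc (-1 / 2 : ℝ) (1 / 2), ∀ η : RVec m,
    ∀ z ∈ operatorSpectrum (BlochGraph f p ω k ξ η), z.re ≤ -c * (ξ ^ 2 + ‖η‖ ^ 2)

/-! ### The first-order system and its Floquet reductions -/

/-- `∑_j c_j η_j`. -/
def drift {m : ℕ} (c η : RVec m) : ℝ := ∑ j, c j * η j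

/-- The matrix
`𝓜(k, θ, λ, η) = |k|⁻¹ [[0, I], [(λ + i ∑_j c_j η_j + |η|²) I + G(k, θ), |k|⁻¹ ω(k) I]]`. It is the
coefficient of the system satisfied by `(v, |k| ∂_θ v)` when
`(λ + i ∑_j c_j η_j + |η|²) v + ω(k) ∂_θ v + G(k, θ) v = |k|² ∂_θ² v`. -/
def symbolMatrix {m n : ℕ} (f : RVec n → RVec n) (p : RVec (m + 1) → ℝ → RVec n)
    (ω : RVec (m + 1) → ℝ) (c : RVec m) (x : Freq m) (θ : ℝ) : Mat2 n :=
  ((‖x.1‖⁻¹ : ℝ) : ℂ) • Matrix.fromBlocks 0 1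
    ((x.2.1 + Complex.I * (drift c x.2.2 : ℂ) + ((‖x.2.2‖ ^ 2 : ℝ) : ℂ)) •
        (1 : Matrix (Fin n) (Fin n) ℂ) + jacobianAlong f p x.1 θ)
    (((‖x.1‖⁻¹ * ω x.1 : ℝ) : ℂ) • (1 : Matrix (Fin n) (Fin n) ℂ))

/-- `(W, M₁)` is a Floquet reduction of class `C^r` on the open set `U` of frequency points: `W` is
invertible and `2π`-periodic in `θ`, the averaged matrix `M₁` is independent of `θ`, and
`∂_θ W + W 𝓜 = M₁ W`, so that `V₁ = W V` turns `∂_θ V = 𝓜 V` into `∂_θ V₁ = M₁ V₁`. -/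
structure IsFloquetReduction {m n : ℕ} (r : ℕ∞) (f : RVec n → RVec n)
    (p : RVec (m + 1) → ℝ → RVec n) (ω : RVec (m + 1) → ℝ) (Ω : Set (RVec (m + 1)))
    (c : RVec m) (U : Set (Freq m)) (W : Freq m → ℝ → Mat2 n) (M₁ : Freq m → Mat2 n) :
    Prop where
  isOpen : IsOpen U
  dom : ∀ x ∈ U, x.1 ∈ Ω
  smooth_conj :
    ContDiffOn ℝ (r : WithTop ℕ∞) (fun q : Freq m × ℝ => W q.1 q.2) (U ×ˢ Set.univ)
  smooth_avg : ContDiffOn ℝ (r : WithTop ℕ∞) M₁ U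
  invertible : ∀ x ∈ U, ∀ θ : ℝ, IsUnit (W x θ)
  periodic : ∀ x ∈ U, Function.Periodic (W x) (2 * Real.pi)
  conj_eq : ∀ x ∈ U, ∀ θ : ℝ,
    HasDerivAt (W x) (M₁ x * W x θ - W x θ * symbolMatrix f p ω c x θ) θ

/-! ### Symmetrizers -/

/-- The real part `Re A = (A + A*) / 2` of a matrix. -/
def rePart {n : ℕ} (A : Mat2 n) : Mat2 n := (1 / 2 : ℂ) • (A + Aᴴ)

/-- The weight `γ + |τ + ∑_j c_j η_j|² + |η|²`, where `λ = γ + iτ`. -/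
def weight {m : ℕ} (c : RVec m) (x : Freq m) : ℝ :=
  x.2.1.re + |x.2.1.im + drift c x.2.2| ^ 2 + ‖x.2.2‖ ^ 2

/-- Points with `k ∈ K`, `γ = Re λ ≥ 0`, and frequency bounded by `R`:
`|λ + i ∑_j c_j η_j| + |η|² ≤ R`. -/
def boundedFreq {m : ℕ} (K : Set (RVec (m + 1))) (c : RVec m) (R : ℝ) : Set (Freq m) :=
  {x | x.1 ∈ K ∧ 0 ≤ x.2.1.re ∧
    ‖x.2.1 + Complex.I * (drift c x.2.2 : ℂ)‖ + ‖x.2.2‖ ^ 2 ≤ R}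

/-- `S` is a `C¹` Hermitian symmetrizer on `U` for `M₁`: where `k ∈ K` and `γ ≥ 0`, one has
`Re (S M₁) = (γ + |τ + ∑_j c_j η_j|² + |η|²) Γ` with `Γ ≥ I`. At the points where the weight
vanishes (that is, `λ = 0`, `η = 0`), where one cannot divide by it, this is read as the
corresponding inequality `Re (S M₁) ≥ 0`. -/
structure IsSymmetrizer {m n : ℕ} (K : Set (RVec (m + 1))) (c : RVec m) (U : Set (Freq m))
    (M₁ S : Freq m → Mat2 n) : Prop where
  contDiffOn : ContDiffOn ℝ 1 S U
  isHermitian : ∀ x ∈ U, (S x).IsHermitian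
  estimate : ∀ x ∈ U, x.1 ∈ K → 0 ≤ x.2.1.re → weight c x ≠ 0 →
    ∃ Γ : Mat2 n, rePart (S x * M₁ x) = (weight c x : ℂ) • Γ ∧ (Γ - 1).PosSemidef
  nonneg : ∀ x ∈ U, x.1 ∈ K → 0 ≤ x.2.1.re → weight c x = 0 →
    (rePart (S x * M₁ x)).PosSemidef

end FloquetSymmetrizer

end

/-!
Write `μ = λ + i c·η + |η|²` for the spectral shift. The symbol of the first-order system depends on
the frequency only through `k` and `μ`, and a Floquet reduction turns an eigenvalue `i(ℓ + ξ)` of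
the averaged matrix `M₁` (`ℓ` an integer, `|ξ| ≤ 1/2`) into a Bloch wave: `μ` is then an eigenvalue
of `L_{ξ,0}(k)` (`IsFloquetReduction.isEigenvalue`). Diffusive stability therefore determines the
imaginary eigenvalues of `M₁` when `Re μ ≥ 0`, and the weight of the estimate is
`Re μ + (Im μ)²`.

* If `μ ≠ 0` and `Re μ ≥ 0`, then `M₁` has no imaginary eigenvalue, and a Lyapunov function
  (`exists_lyapunov`) is a symmetrizer nearby.
* If `μ = 0`, then `∂_θ p` gives an eigenvalue `iℓ`. As `0` is algebraically simple for
  `L_{0,0}(k)`, this is the only imaginary eigenvalue, its eigenspace is a line, and it moves with nonzero speed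
  in `λ`: otherwise the `λ`-derivative of the reduction would produce a Jordan chain of periodic
  functions (`IsFloquetReduction.transversal`). These properties, with the dissipation along Bloch
  waves, are collected in `IsCritical` (`IsFloquetReduction.isCritical`).

A critical family has a symmetrizer near its critical point (`IsCritical.hasLocalSymmetrizer`). The
implicit function theorem gives the dispersion curve `μ(k, ξ)`, along which `M₁` has the eigenvalue
`i(ℓ + ξ)` and `Re μ(k, ξ) ≤ -c ξ²`. The eigenvalue `iℓ` is geometrically simple, but it may be
defective.

* In the semisimple case the critical eigenvalue continues to `σ(k, μ)` with left eigenvector `r`.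
  Comparison of `μ` with the point `ξ = Im σ` of the dispersion curve shows that `± Re σ` is at least a multiple of the weight (`growth_of_simple`), so `± |r v|²` controls the
  critical component.
* For a Jordan block of length two the characteristic equation `σ² = β σ + α` replaces `σ`. The
  curve gives the sign of `∂_μ α` and the reality of `β` at `μ = 0` up to normalization, and an
  explicit form in the two central coordinates is coercive (`block_coercive`).
* Longer blocks contradict the dissipation (`IsCritical.not_exists_chain`).

In both cases a Lyapunov function of the hyperbolic part completes the form. At a fixed frequency
the conditions on a symmetrizer are convex, so a partition of unity glues the local symmetrizers on
the domain of any reduction (`IsFloquetReduction.exists_symmetrizer`).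

Reductions exist locally by Floquet's theorem with parameters (`exists_periodic_conjugation`). It
rests on the smoothness of the fundamental solution, obtained by inverting a Volterra operator on
continuous paths (`contDiff_fundSol`), and on a smooth logarithm near the monodromy (`exists_log`).
The uniform bound follows from the compactness of the set of points of bounded frequency.
-/


set_option linter.unusedSectionVars false

namespace FloquetSymmetrizer

open Filter Topology
open scoped InnerProductSpace

/-! ### Lyapunov functions of hyperbolic operators -/

/-- No eigenvalue of `A` lies on the imaginary axis. -/
def IsHyperbolic {E : Type*} [NormedAddCommGroup E] [InnerProductSpace ℂ E] (A : E →L[ℂ] E) :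
    Prop :=
  ∀ (t : ℝ) (v : E), A v = ((t : ℂ) * Complex.I) • v → v = 0

/-- The induction behind `exists_lyapunov`, over all spaces of dimension `d`. -/
theorem exists_lyapunov_aux (d : ℕ) :
    ∀ (E : Type) [NormedAddCommGroup E] [InnerProductSpace ℂ E] [FiniteDimensional ℂ E]
      (A : E →L[ℂ] E), Module.finrank ℂ E = d → IsHyperbolic A →
      ∃ S : E →L[ℂ] E, IsSelfAdjoint S ∧ ∀ v, ‖v‖ ^ 2 ≤ (⟪v, S (A v)⟫_ℂ).re := by
  induction d with
  | zero =>
    intro E _ _ _ A hd _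
    have : Subsingleton E := Module.finrank_zero_iff.mp hd
    exact ⟨0, IsSelfAdjoint.zero _, fun v => by simp [Subsingleton.elim v 0]⟩
  | succ d ih =>
    intro E _ _ _ A hd hA
    have : Nontrivial E := Module.nontrivial_of_finrank_pos (R := ℂ) (by omega)
    obtain ⟨s, hs⟩ := Module.End.exists_eigenvalue (A : E →ₗ[ℂ] E)
    obtain ⟨e', he'⟩ := hs.exists_hasEigenvector
    have he'0 : ‖e'‖ ≠ 0 := norm_ne_zero_iff.mpr he'.2
    obtain ⟨e, hen, hAe⟩ : ∃ e : E, ‖e‖ = 1 ∧ A e = s • e := by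
      refine ⟨((‖e'‖⁻¹ : ℝ) : ℂ) • e', ?_, ?_⟩
      · rw [norm_smul]
        simp [he'0]
      · have : A e' = s • e' := he'.apply_eq_smul
        rw [map_smul, this, smul_comm]
    have he0 : e ≠ 0 := by
      intro h; simp [h] at hen
    have hsre : s.re ≠ 0 := by
      intro h
      refine he0 (hA s.im e ?_)
      rw [hAe]
      congr 1
      apply Complex.ext <;> simp [h]
    -- In the decomposition `E = ℂ e ⊕ F`, `F = eᗮ`, the operator `A` is block triangular with
    -- diagonal entries `s` and the compression `B` of `A` to `F`.
    let F : Submodule ℂ E := (ℂ ∙ e)ᗮ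
    let P : E →L[ℂ] F := F.orthogonalProjectionOnto
    let ι : F →L[ℂ] E := F.subtypeL
    have hPv : ∀ v : E, (P v : E) = v - ⟪e, v⟫_ℂ • e := by
      intro v
      have := Submodule.starProjection_orthogonal_val (K := ℂ ∙ e) v
      rw [Submodule.starProjection_unit_singleton ℂ hen] at this
      exact this
    have hFe : ∀ y : F, ⟪e, (y : E)⟫_ℂ = 0 := fun y =>
      (Submodule.mem_orthogonal_singleton_iff_inner_right).mp y.2
    have hFe' : ∀ y : F, ⟪(y : E), e⟫_ℂ = 0 := fun y => by
      rw [← inner_conj_symm, hFe, map_zero]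
    let B : F →L[ℂ] F := P ∘L A ∘L ι
    have hBv : ∀ y : F, (B y : E) = A y - ⟪e, A y⟫_ℂ • e := fun y => hPv _
    -- an imaginary eigenvector of `B` becomes one of `A` by adding a multiple of `e`, which exists
    -- because `s` is not imaginary
    have hB : IsHyperbolic B := by
      intro t y hy
      have h1 : A y = ((t : ℂ) * Complex.I) • (y : E) + ⟪e, A y⟫_ℂ • e := by
        have := hBv y
        rw [hy] at this
        simp only [Submodule.coe_smul] at this
        rw [this]; abel
      have h2 : ((t : ℂ) * Complex.I) - s ≠ 0 := by
        intro h
        apply hsre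
        have := congrArg Complex.re h
        simpa using this
      have h3 := hA t ((y : E) + (⟪e, A y⟫_ℂ / ((t : ℂ) * Complex.I - s)) • e) (by
        rw [map_add, map_smul, hAe, h1]
        simp only [inner_add_right, inner_smul_right, hFe, inner_self_eq_norm_sq_to_K, hen]
        simp only [smul_add, smul_smul, add_assoc, ← add_smul]
        congr 2
        push_cast
        field_simp
        ring)
      have h4 := congrArg (fun z => P z) h3
      have hPe : P e = 0 := by
        apply Subtype.ext
        rw [hPv]
        simp [hen]
      have hPy : P (y : E) = y := by
        apply Subtype.ext
        rw [hPv, hFe]; simp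
      simpa [hPe, hPy] using h4
    have hdF : Module.finrank ℂ F = d := by
      have := Submodule.finrank_add_finrank_orthogonal (ℂ ∙ e)
      rw [finrank_span_singleton he0] at this
      change Module.finrank ℂ (ℂ ∙ e)ᗮ = d
      omega
    obtain ⟨T, hT, hTB⟩ := ih F B hdF hB
    have hTs : ∀ y z : F, ⟪T y, z⟫_ℂ = ⟪y, T z⟫_ℂ := fun y z => by
      have := hT.isSymmetric y z
      simpa using this
    set a := |s.re| with ha
    have hapos : 0 < a := abs_pos.mpr hsre
    -- `ε` is so small that the coupling of `e` and `F` is absorbed by completing a square (`h7`)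
    set ε := a / (‖A‖ ^ 2 + 1) with hε
    have hεpos : 0 < ε := by positivity
    obtain ⟨g, hg, hgs⟩ : ∃ g : ℝ, |g| = 1 ∧ g * s.re = a := by
      rcases lt_or_gt_of_ne hsre with h | h
      · exact ⟨-1, by simp, by rw [ha, abs_of_neg h]; ring⟩
      · exact ⟨1, by simp, by rw [ha, abs_of_pos h]; ring⟩
    let S₀ : E →L[ℂ] E :=
      (((ε * g : ℝ) : ℂ)) • (innerSL ℂ e).smulRight e + ι ∘L T ∘L P
    have hS₀v : ∀ v, S₀ v = ((ε * g : ℝ) : ℂ) • (⟪e, v⟫_ℂ • e) + (T (P v) : E) := fun v => rfl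
    have hPadj : ∀ (v : E) (y : F), ⟪v, (y : E)⟫_ℂ = ⟪P v, y⟫_ℂ := fun v y => by
      rw [Submodule.coe_inner, hPv, inner_sub_left, inner_smul_left, hFe]; simp
    have hS₀ : ∀ v w, ⟪S₀ v, w⟫_ℂ = ⟪v, S₀ w⟫_ℂ := by
      intro v w
      have e1 : ⟪((T (P v) : F) : E), w⟫_ℂ = ⟪v, ((T (P w) : F) : E)⟫_ℂ := by
        rw [hPadj, ← hTs, ← inner_conj_symm, hPadj, inner_conj_symm]
      rw [hS₀v, hS₀v, inner_add_left, inner_add_right, e1]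
      congr 1
      simp only [inner_smul_left, inner_smul_right, inner_conj_symm, Complex.conj_ofReal]
      ring
    set c := min (ε * a / 2) (1 / 2) with hc
    have hcpos : 0 < c := by positivity
    have key : ∀ v, c * ‖v‖ ^ 2 ≤ (⟪v, S₀ (A v)⟫_ℂ).re := by
      intro v
      set x := ⟪e, v⟫_ℂ with hx
      set y := P v with hy
      have hv : v = x • e + (y : E) := by rw [hy, hPv]; abel
      have hnv : ‖v‖ ^ 2 = ‖x‖ ^ 2 + ‖y‖ ^ 2 := by
        have h0 : ⟪x • e, (y : E)⟫_ℂ = 0 := by rw [inner_smul_left, hFe, mul_zero]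
        have := norm_add_sq_eq_norm_sq_add_norm_sq_of_inner_eq_zero (x • e) (y : E) h0
        rw [← hv] at this
        rw [norm_smul, hen] at this
        simp only [Submodule.coe_norm]
        nlinarith [this]
      have hAv : ⟪e, A v⟫_ℂ = x * s + ⟪e, A y⟫_ℂ := by
        conv_lhs => rw [hv]
        rw [map_add, map_smul, hAe, inner_add_right, inner_smul_right, inner_smul_right,
          inner_self_eq_norm_sq_to_K, hen]
        simp
      have hPAv : P (A v) = B y := by
        apply Subtype.ext
        rw [hPv, hBv, hAv]
        conv_lhs => rw [hv, map_add, map_smul, hAe]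
        rw [add_smul, smul_smul]; abel
      have h1 : ⟪v, S₀ (A v)⟫_ℂ =
          ((ε * g : ℝ) : ℂ) * ((starRingEnd ℂ) x * (x * s + ⟪e, A y⟫_ℂ)) + ⟪y, T (B y)⟫_ℂ := by
        rw [hS₀v, inner_add_right, hPadj, hPAv, hAv, inner_smul_right, inner_smul_right,
          ← inner_conj_symm v e, ← hx]
        ring
      have h2 : ((starRingEnd ℂ) x * (x * s + ⟪e, A y⟫_ℂ)).re * g ≥
          a * ‖x‖ ^ 2 - ‖x‖ * (‖A‖ * ‖y‖) := by
        have h21 : (starRingEnd ℂ) x * (x * s + ⟪e, A y⟫_ℂ) =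
            ((‖x‖ ^ 2 : ℝ) : ℂ) * s + (starRingEnd ℂ) x * ⟪e, A y⟫_ℂ := by
          rw [mul_add, ← mul_assoc, Complex.conj_mul']
          push_cast; ring
        have h22 : |((starRingEnd ℂ) x * ⟪e, A y⟫_ℂ).re * g| ≤ ‖x‖ * (‖A‖ * ‖y‖) := by
          rw [abs_mul, hg, mul_one]
          refine (Complex.abs_re_le_norm _).trans ?_
          rw [norm_mul, RCLike.norm_conj]
          gcongr
          refine (norm_inner_le_norm _ _).trans ?_
          rw [hen, one_mul]
          exact A.le_opNorm _
        rw [h21, Complex.add_re, Complex.re_ofReal_mul, add_mul]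
        have := neg_le_of_abs_le h22
        nlinarith
      have h3 := hTB y
      rw [h1, Complex.add_re, Complex.re_ofReal_mul, hnv]
      have h4 : ε * g * ((starRingEnd ℂ) x * (x * s + ⟪e, A y⟫_ℂ)).re ≥
          ε * (a * ‖x‖ ^ 2 - ‖x‖ * (‖A‖ * ‖y‖)) := by
        rw [mul_assoc, mul_comm g]
        exact mul_le_mul_of_nonneg_left h2 hεpos.le
      have h5 : c * (‖x‖ ^ 2 + ‖y‖ ^ 2) ≤ ε * a / 2 * ‖x‖ ^ 2 + 1 / 2 * ‖y‖ ^ 2 := by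
        rw [mul_add]
        gcongr
        · exact min_le_left _ _
        · exact min_le_right _ _
      have h6 : ε * (‖A‖ ^ 2 + 1) = a := by rw [hε]; field_simp
      have h7 : 0 ≤ ε * (a * ‖x‖ ^ 2 - 2 * (‖x‖ * (‖A‖ * ‖y‖))) + ‖y‖ ^ 2 := by
        have : ε * (a * ‖x‖ ^ 2 - 2 * (‖x‖ * (‖A‖ * ‖y‖))) + ‖y‖ ^ 2 =
            (ε * ‖A‖ * ‖x‖ - ‖y‖) ^ 2 + ε ^ 2 * ‖x‖ ^ 2 := by
          rw [← h6]; ring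
        rw [this]; positivity
      nlinarith
    refine ⟨((c⁻¹ : ℝ) : ℂ) • S₀, ?_, ?_⟩
    · rw [ContinuousLinearMap.isSelfAdjoint_iff_isSymmetric]
      intro v w
      simp only [ContinuousLinearMap.coe_coe, _root_.smul_apply, inner_smul_left,
        inner_smul_right, Complex.conj_ofReal, hS₀]
    · intro v
      rw [_root_.smul_apply, inner_smul_right, Complex.re_ofReal_mul,
        le_inv_mul_iff₀ hcpos]
      exact key v

/-- **Lyapunov's theorem.** A hyperbolic operator has an indefinite Hermitian form that increases
along its flow. By induction on the dimension: split off an eigenvector, on whose span the form is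
a small multiple of the sign of the real part of the eigenvalue. -/
theorem exists_lyapunov {E : Type} [NormedAddCommGroup E] [InnerProductSpace ℂ E]
    [FiniteDimensional ℂ E] (A : E →L[ℂ] E) (hA : IsHyperbolic A) :
    ∃ S : E →L[ℂ] E, IsSelfAdjoint S ∧ ∀ v, ‖v‖ ^ 2 ≤ (⟪v, S (A v)⟫_ℂ).re :=
  exists_lyapunov_aux _ E A rfl hA

/-! ### The implicit function theorem -/

/-- An implicit function theorem in which the partial derivative in the unknown is only tested along
lines. -/
theorem exists_implicit {X V : Type*} [NormedAddCommGroup X] [NormedSpace ℝ X] [CompleteSpace X]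
    [NormedAddCommGroup V] [NormedSpace ℝ V] [FiniteDimensional ℝ V] {F : X × V → V}
    {x₀ : X} {y₀ : V} (hF : ContDiffAt ℝ 2 F (x₀, y₀)) (h0 : F (x₀, y₀) = 0)
    (hinj : ∀ z, HasDerivAt (fun t : ℝ => F (x₀, y₀ + t • z)) 0 0 → z = 0) :
    ∃ φ : X → V, ContDiffAt ℝ 2 φ x₀ ∧ φ x₀ = y₀ ∧ ∀ᶠ x in 𝓝 x₀, F (x, φ x) = 0 := by
  have : CompleteSpace V := FiniteDimensional.complete ℝ V
  set D : V →L[ℝ] V := fderiv ℝ F (x₀, y₀) ∘L .inr ℝ X V with hD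
  have hDinj : Function.Injective D := by
    rw [injective_iff_map_eq_zero]
    intro z hz
    apply hinj
    have h1 : HasDerivAt (fun t : ℝ => (x₀, y₀ + t • z)) ((0 : X), z) 0 := by
      refine (hasDerivAt_const _ _).prodMk ?_
      simpa using ((hasDerivAt_id (0 : ℝ)).smul_const z).const_add y₀
    have h2 : HasFDerivAt F (fderiv ℝ F (x₀, y₀)) (x₀, y₀ + (0 : ℝ) • z) := by
      simpa using (hF.differentiableAt (by norm_num)).hasFDerivAt
    have h3 := h2.comp_hasDerivAt (0 : ℝ) h1
    have h4 : fderiv ℝ F (x₀, y₀) ((0 : X), z) = 0 := hz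
    rw [h4] at h3
    exact h3
  have hDinv : D.IsInvertible := by
    let e : V ≃ₗ[ℝ] V := LinearEquiv.ofInjectiveEndo (D : V →ₗ[ℝ] V) hDinj
    exact ⟨e.toContinuousLinearEquiv, by ext z; rfl⟩
  refine ⟨hF.implicitFunction (by norm_num) hDinv, hF.contDiffAt_implicitFunction _ hDinv,
    hF.implicitFunction_apply_self _ hDinv, ?_⟩
  have := hF.eventually_apply_implicitFunction (by norm_num) hDinv
  rw [h0] at this
  exact this

/-! ### Real differentiability of complex bilinear operations -/

section Bilinear

variable {X A B C : Type*} [NormedAddCommGroup X] [NormedSpace ℝ X]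
  [NormedAddCommGroup A] [NormedSpace ℂ A] [NormedAddCommGroup B] [NormedSpace ℂ B]
  [NormedAddCommGroup C] [NormedSpace ℂ C]

theorem contDiffAt_bilinear (b : A →L[ℂ] B →L[ℂ] C) {n : WithTop ℕ∞} {f : X → A} {g : X → B}
    {x : X} (hf : ContDiffAt ℝ n f x) (hg : ContDiffAt ℝ n g x) :
    ContDiffAt ℝ n (fun y => b (f y) (g y)) x :=
  ContDiffAt.comp (g := fun q : A × B => b q.1 q.2) x
    (b.bilinearRestrictScalars ℝ).isBoundedBilinearMap.contDiff.contDiffAt (hf.prodMk hg)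

theorem hasDerivAt_bilinear (b : A →L[ℂ] B →L[ℂ] C) {f : ℝ → A} {g : ℝ → B} {f' : A} {g' : B}
    {x : ℝ} (hf : HasDerivAt f f' x) (hg : HasDerivAt g g' x) :
    HasDerivAt (fun y => b (f y) (g y)) (b (f x) g' + b f' (g x)) x :=
  (b.bilinearRestrictScalars ℝ).hasDerivAt_of_bilinear (fun _ => hf) (fun _ => hg)

theorem _root_.ContDiffAt.clmApply {n : WithTop ℕ∞} {f : X → A →L[ℂ] B} {g : X → A} {x : X}
    (hf : ContDiffAt ℝ n f x) (hg : ContDiffAt ℝ n g x) :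
    ContDiffAt ℝ n (fun y => f y (g y)) x :=
  contDiffAt_bilinear (ContinuousLinearMap.id ℂ (A →L[ℂ] B)) hf hg

theorem _root_.ContDiffAt.clmComp {n : WithTop ℕ∞} {f : X → B →L[ℂ] C} {g : X → A →L[ℂ] B} {x : X}
    (hf : ContDiffAt ℝ n f x) (hg : ContDiffAt ℝ n g x) :
    ContDiffAt ℝ n (fun y => f y ∘L g y) x :=
  contDiffAt_bilinear (ContinuousLinearMap.compL ℂ A B C) hf hg

theorem _root_.ContDiffAt.complexSMul {n : WithTop ℕ∞} {f : X → ℂ} {g : X → A} {x : X}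
    (hf : ContDiffAt ℝ n f x) (hg : ContDiffAt ℝ n g x) :
    ContDiffAt ℝ n (fun y => f y • g y) x :=
  contDiffAt_bilinear (ContinuousLinearMap.lsmul ℂ ℂ) hf hg

theorem _root_.HasDerivAt.clmApply {f : ℝ → A →L[ℂ] B} {g : ℝ → A} {f' : A →L[ℂ] B} {g' : A} {x : ℝ}
    (hf : HasDerivAt f f' x) (hg : HasDerivAt g g' x) :
    HasDerivAt (fun y => f y (g y)) (f x g' + f' (g x)) x :=
  hasDerivAt_bilinear (ContinuousLinearMap.id ℂ (A →L[ℂ] B)) hf hg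

theorem _root_.HasDerivAt.clmComp {f : ℝ → B →L[ℂ] C} {g : ℝ → A →L[ℂ] B} {f' : B →L[ℂ] C}
    {g' : A →L[ℂ] B} {x : ℝ} (hf : HasDerivAt f f' x) (hg : HasDerivAt g g' x) :
    HasDerivAt (fun y => f y ∘L g y) (f x ∘L g' + f' ∘L g x) x :=
  hasDerivAt_bilinear (ContinuousLinearMap.compL ℂ A B C) hf hg

theorem _root_.HasDerivAt.complexSMul {f : ℝ → ℂ} {g : ℝ → A} {f' : ℂ} {g' : A} {x : ℝ}
    (hf : HasDerivAt f f' x) (hg : HasDerivAt g g' x) :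
    HasDerivAt (fun y => f y • g y) (f x • g' + f' • g x) x :=
  hasDerivAt_bilinear (ContinuousLinearMap.lsmul ℂ ℂ) hf hg

end Bilinear

/-! ### Perturbation of lower bounds -/

section Perturbation

variable {X E G : Type} [TopologicalSpace X] [NormedAddCommGroup E] [InnerProductSpace ℂ E]
  [FiniteDimensional ℂ E] [NormedAddCommGroup G] [NormedSpace ℂ G]

theorem eventually_lower_bound {T : X → E →L[ℂ] G} {x₀ : X} (hT : ContinuousAt T x₀)
    (hinj : ∀ v, T x₀ v = 0 → v = 0) :
    ∃ c > 0, ∀ᶠ x in 𝓝 x₀, ∀ v, c * ‖v‖ ≤ ‖T x v‖ := by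
  obtain ⟨K, hK, hTK⟩ := LinearMap.exists_antilipschitzWith (T x₀ : E →ₗ[ℂ] G)
    (LinearMap.ker_eq_bot'.mpr hinj)
  have hKpos : (0 : ℝ) < K := hK
  refine ⟨(K : ℝ)⁻¹ / 2, by positivity, ?_⟩
  have h1 : ∀ᶠ x in 𝓝 x₀, ‖T x - T x₀‖ < (K : ℝ)⁻¹ / 2 := by
    have := Metric.tendsto_nhds.mp hT.tendsto ((K : ℝ)⁻¹ / 2) (by positivity)
    simpa [dist_eq_norm] using this
  filter_upwards [h1] with x hx v
  have h2 : ‖v‖ ≤ K * ‖T x₀ v‖ := by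
    have := hTK.le_mul_dist v 0
    simpa using this
  have h3 : ‖T x₀ v‖ ≤ ‖T x v‖ + (K : ℝ)⁻¹ / 2 * ‖v‖ := by
    have h4 : T x₀ v = T x v - (T x - T x₀) v := by simp
    rw [h4]
    refine (norm_sub_le _ _).trans ?_
    gcongr
    exact ((T x - T x₀).le_opNorm v).trans (by gcongr)
  have h5 : (K : ℝ)⁻¹ * ‖v‖ ≤ ‖T x₀ v‖ := by
    rw [inv_mul_le_iff₀ hKpos]; exact h2
  linarith

/-- A Lyapunov function of a hyperbolic operator is one of all operators close to it. -/
theorem eventually_lyapunov {A : X → E →L[ℂ] E} {x₀ : X} (hA : ContinuousAt A x₀)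
    (hyp : IsHyperbolic (A x₀)) :
    ∃ S : E →L[ℂ] E, IsSelfAdjoint S ∧
      ∀ᶠ x in 𝓝 x₀, ∀ v, ‖v‖ ^ 2 / 2 ≤ (⟪v, S (A x v)⟫_ℂ).re := by
  obtain ⟨S, hS, hSA⟩ := exists_lyapunov (A x₀) hyp
  refine ⟨S, hS, ?_⟩
  have h1 : ∀ᶠ x in 𝓝 x₀, ‖A x - A x₀‖ < 1 / (2 * (‖S‖ + 1)) := by
    have := Metric.tendsto_nhds.mp hA.tendsto (1 / (2 * (‖S‖ + 1))) (by positivity)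
    simpa [dist_eq_norm] using this
  filter_upwards [h1] with x hx v
  have h2 : S (A x v) = S (A x₀ v) + S ((A x - A x₀) v) := by
    rw [← map_add]; simp
  have h3 : |(⟪v, S ((A x - A x₀) v)⟫_ℂ).re| ≤ ‖v‖ ^ 2 / 2 := by
    refine (Complex.abs_re_le_norm _).trans ((norm_inner_le_norm _ _).trans ?_)
    have h4 : ‖S ((A x - A x₀) v)‖ ≤ ‖S‖ * (1 / (2 * (‖S‖ + 1)) * ‖v‖) :=
      (S.le_opNorm _).trans (by
        gcongr
        exact ((A x - A x₀).le_opNorm v).trans (by gcongr))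
    have h5 : ‖S‖ * (1 / (2 * (‖S‖ + 1)) * ‖v‖) ≤ ‖v‖ / 2 := by
      have : ‖S‖ / (‖S‖ + 1) ≤ 1 := by
        rw [div_le_one (by positivity)]; linarith
      calc ‖S‖ * (1 / (2 * (‖S‖ + 1)) * ‖v‖) = (‖S‖ / (‖S‖ + 1)) * (‖v‖ / 2) := by field_simp
        _ ≤ 1 * (‖v‖ / 2) := by gcongr
        _ = ‖v‖ / 2 := one_mul _
    nlinarith [norm_nonneg v]
  rw [h2, inner_add_right, Complex.add_re]
  have := neg_le_of_abs_le h3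
  linarith [hSA v]

end Perturbation

/-! ### Operators with a one-dimensional kernel -/

section SimpleKernel

variable {E : Type} [NormedAddCommGroup E] [InnerProductSpace ℂ E] [FiniteDimensional ℂ E]

/-- If the kernel of an operator is a line, then so is its cokernel. -/
theorem exists_left_null {A : E →L[ℂ] E} {e : E} (he : e ≠ 0) (hAe : A e = 0)
    (hker : ∀ v, A v = 0 → ∃ z : ℂ, v = z • e) :
    ∃ ρ : E →L[ℂ] ℂ, ρ ≠ 0 ∧ (∀ v, ρ (A v) = 0) ∧ (∀ v, ρ v = 0 → ∃ u, A u = v) ∧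
      ∀ ρ' : E →L[ℂ] ℂ, (∀ v, ρ' (A v) = 0) → ∃ z : ℂ, ρ' = z • ρ := by
  set R := LinearMap.range (A : E →ₗ[ℂ] E) with hR
  have hk : LinearMap.ker (A : E →ₗ[ℂ] E) = ℂ ∙ e := by
    ext v
    rw [LinearMap.mem_ker, Submodule.mem_span_singleton]
    constructor
    · intro h
      obtain ⟨z, hz⟩ := hker v h
      exact ⟨z, hz.symm⟩
    · rintro ⟨z, rfl⟩
      simp [hAe]
  -- the range has codimension one, hence is the kernel of a functional
  have hdim := LinearMap.finrank_range_add_finrank_ker (A : E →ₗ[ℂ] E)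
  rw [hk, finrank_span_singleton he, ← hR] at hdim
  have hlt : R < ⊤ := by
    rw [lt_top_iff_ne_top]
    intro h
    rw [h, finrank_top] at hdim
    omega
  obtain ⟨g, hg, hRg⟩ := Submodule.exists_le_ker_of_lt_top R hlt
  have hkg : LinearMap.ker g = R := by
    symm
    apply Submodule.eq_of_le_of_finrank_le hRg
    have h1 : LinearMap.ker g < ⊤ := by
      rw [lt_top_iff_ne_top]
      exact fun h => hg (LinearMap.ker_eq_top.mp h)
    have := Submodule.finrank_lt h1.ne
    omega
  refine ⟨LinearMap.toContinuousLinearMap g, ?_, fun v => hRg ⟨v, rfl⟩, ?_, ?_⟩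
  · intro h
    apply hg
    ext v
    exact DFunLike.congr_fun h v
  · intro v hv
    have : v ∈ R := by rw [← hkg]; exact hv
    exact this
  · intro ρ' hρ'
    obtain ⟨w, hw⟩ : ∃ w, g w ≠ 0 := by
      by_contra! h
      exact hg (LinearMap.ext h)
    refine ⟨ρ' w / g w, ?_⟩
    ext v
    have h1 : v - (g v / g w) • w ∈ LinearMap.ker g := by
      simp [hw]
    rw [hkg] at h1
    obtain ⟨u, hu⟩ := h1
    have h2 := hρ' u
    have h3 : A u = v - (g v / g w) • w := hu
    rw [h3, map_sub, map_smul, sub_eq_zero] at h2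
    rw [h2]
    change g v / g w * ρ' w = ρ' w / g w * g v
    ring

/-- A functional that vanishes on the kernel of an operator factors through it. -/
theorem exists_factor {A : E →L[ℂ] E} {ρ : E →L[ℂ] ℂ} (h : ∀ v, A v = 0 → ρ v = 0) :
    ∃ r : E →L[ℂ] ℂ, ∀ v, r (A v) = ρ v := by
  have h1 : (ρ : E →ₗ[ℂ] ℂ) ∈ (LinearMap.ker (A : E →ₗ[ℂ] E)).dualAnnihilator := by
    rw [Submodule.mem_dualAnnihilator]
    exact fun v hv => h v hv
  rw [← LinearMap.range_dualMap_eq_dualAnnihilator_ker] at h1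
  obtain ⟨g, hg⟩ := h1
  exact ⟨LinearMap.toContinuousLinearMap g, fun v => DFunLike.congr_fun hg v⟩

end SimpleKernel

/-! ### The critical frequency: dispersion curve and order of contact -/

section Center

variable {P E : Type} [NormedAddCommGroup P] [NormedSpace ℝ P] [FiniteDimensional ℝ P]
  [NormedAddCommGroup E] [InnerProductSpace ℂ E] [FiniteDimensional ℂ E]

/-- A family of operators `N (κ, μ)` near a point `(κ₀, 0)` where it has an eigenvalue on the
imaginary axis, normalized to be `0`, with the spectral properties that diffusive stability gives
to an averaged Floquet matrix. Here `κ` collects the parameters and `μ` is the spectral parameter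
of the Bloch operators; the parameters `κ ∈ Q` are those at which stability is known. The
dissipation rate `c κ` need not be bounded below on `Q`. -/
structure IsCritical (N : P × ℂ → E →L[ℂ] E) (Q : Set P) (κ₀ : P) (e : E) : Prop where
  mem : κ₀ ∈ Q
  smooth : ContDiffAt ℝ 2 N (κ₀, 0)
  ne_zero : e ≠ 0
  null : N (κ₀, 0) e = 0
  kernel : ∀ v, N (κ₀, 0) v = 0 → ∃ z : ℂ, v = z • e
  no_other : ∀ (t : ℝ) (v : E), N (κ₀, 0) v = ((t : ℂ) * Complex.I) • v → t = 0 ∨ v = 0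
  transversal : ∀ ρ : E →L[ℂ] ℂ, ρ ≠ 0 → (∀ v, ρ (N (κ₀, 0) v) = 0) →
    ∃ a : ℂ, a ≠ 0 ∧ ∀ δ : ℂ, HasDerivAt (fun t : ℝ => ρ (N (κ₀, t • δ) e)) (δ * a) 0
  singular : ∀ᶠ κ in 𝓝 κ₀, κ ∈ Q → ∃ v, v ≠ 0 ∧ N (κ, 0) v = 0
  dissipation : ∃ c : P → ℝ, (∀ κ ∈ Q, 0 < c κ) ∧ ∀ᶠ x in 𝓝 (κ₀, (0 : ℂ)), x.1 ∈ Q →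
    ∀ ξ : ℝ, |ξ| ≤ 1 / 2 → ∀ v, v ≠ 0 → N x v = ((ξ : ℂ) * Complex.I) • v →
      x.2.re ≤ -c x.1 * ξ ^ 2

variable {N : P × ℂ → E →L[ℂ] E} {Q : Set P} {κ₀ : P} {e : E}

theorem IsCritical.hasDerivAt_line (h : IsCritical N Q κ₀ e) (δ : ℂ) :
    ∃ N' : E →L[ℂ] E, HasDerivAt (fun t : ℝ => N (κ₀, t • δ)) N' 0 := by
  have h1 : HasDerivAt (fun t : ℝ => (κ₀, t • δ)) ((0 : P), δ) 0 := by
    refine (hasDerivAt_const _ _).prodMk ?_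
    simpa using ((hasDerivAt_id (0 : ℝ)).smul_const δ)
  have h2 : HasFDerivAt N (fderiv ℝ N (κ₀, 0)) (κ₀, (0 : ℝ) • δ) := by
    simpa using (h.smooth.differentiableAt (by norm_num)).hasFDerivAt
  exact ⟨_, h2.comp_hasDerivAt (0 : ℝ) h1⟩

/-- The dispersion curve: `μ(κ, ξ)` is a `C²` function for which `N (κ, μ(κ, ξ))` has the
eigenvalue `iξ`. -/
theorem IsCritical.exists_curve (h : IsCritical N Q κ₀ e) :
    ∃ (V : P × ℝ → E) (μ : P × ℝ → ℂ), ContDiffAt ℝ 2 V (κ₀, 0) ∧ ContDiffAt ℝ 2 μ (κ₀, 0) ∧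
      V (κ₀, 0) = e ∧ μ (κ₀, 0) = 0 ∧
      ∀ᶠ q in 𝓝 (κ₀, (0 : ℝ)), N (q.1, μ q) (V q) = ((q.2 : ℂ) * Complex.I) • V q := by
  have : CompleteSpace P := FiniteDimensional.complete ℝ P
  obtain ⟨ρ, hρ0, hρN, -, -⟩ := exists_left_null h.ne_zero h.null h.kernel
  obtain ⟨a, ha, hda⟩ := h.transversal ρ hρ0 hρN
  -- the eigenvalue equation for `(v, μ)`, with the normalization `⟪e, v - e⟫ = 0`
  let F : (P × ℝ) × (E × ℂ) → E × ℂ := fun z =>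
    (N (z.1.1, z.2.2) z.2.1 - ((z.1.2 : ℂ) * Complex.I) • z.2.1, innerSL ℂ e (z.2.1 - e))
  have hF : ContDiffAt ℝ 2 F ((κ₀, 0), (e, 0)) := by
    have c1 : ContDiffAt ℝ 2 (fun z : (P × ℝ) × (E × ℂ) => (z.1.1, z.2.2)) ((κ₀, 0), (e, 0)) := by
      fun_prop
    have c2 : ContDiffAt ℝ 2 (fun z : (P × ℝ) × (E × ℂ) => N (z.1.1, z.2.2)) ((κ₀, 0), (e, 0)) :=
      ContDiffAt.comp (g := N) _ h.smooth c1
    have c3 : ContDiffAt ℝ 2 (fun z : (P × ℝ) × (E × ℂ) => z.2.1) ((κ₀, 0), (e, 0)) := by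
      fun_prop
    have c4 : ContDiffAt ℝ 2 (fun z : (P × ℝ) × (E × ℂ) => ((z.1.2 : ℂ) * Complex.I))
        ((κ₀, 0), (e, 0)) := by
      refine ContDiffAt.mul ?_ contDiffAt_const
      exact Complex.ofRealCLM.contDiff.contDiffAt.comp _ (by fun_prop)
    have c5 : ContDiffAt ℝ 2 (fun z : (P × ℝ) × (E × ℂ) => innerSL ℂ e (z.2.1 - e))
        ((κ₀, 0), (e, 0)) :=
      ContDiffAt.clmApply contDiffAt_const (c3.sub contDiffAt_const)
    exact ((c2.clmApply c3).sub (c4.complexSMul c3)).prodMk c5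
  obtain ⟨φ, hφ, hφ0, hφF⟩ := exists_implicit hF (by simp [F, h.null]) (by
    rintro ⟨v, δ⟩ hd
    obtain ⟨N', hN'⟩ := h.hasDerivAt_line δ
    have d1 : HasDerivAt (fun t : ℝ => e + t • v) v 0 := by
      simpa using ((hasDerivAt_id (0 : ℝ)).smul_const v).const_add e
    have d2 := hN'.clmApply d1
    have d3 : HasDerivAt (fun t : ℝ => N (κ₀, t • δ) (e + t • v)) 0 0 := by
      have d : HasDerivAt (fun t : ℝ => (F ((κ₀, 0), (e, 0) + t • (v, δ))).1) 0 0 :=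
        (ContinuousLinearMap.fst ℝ E ℂ).hasFDerivAt.comp_hasDerivAt (0 : ℝ) hd
      exact d.congr_of_eventuallyEq (.of_forall fun t => by simp [F])
    have d4 : HasDerivAt (fun t : ℝ => innerSL ℂ e (t • v)) 0 0 := by
      have d : HasDerivAt (fun t : ℝ => (F ((κ₀, 0), (e, 0) + t • (v, δ))).2) 0 0 :=
        (ContinuousLinearMap.snd ℝ E ℂ).hasFDerivAt.comp_hasDerivAt (0 : ℝ) hd
      exact d.congr_of_eventuallyEq (.of_forall fun t => by simp [F])
    have e1 : N (κ₀, 0) v + N' e = 0 := by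
      simpa using d2.unique d3
    -- pairing `N (κ₀, 0) v + N' e = 0` with the left null vector `ρ` gives `δ a = 0`
    have e2 : δ * a = ρ (N' e) := by
      have d5 := (hasDerivAt_const (0 : ℝ) ρ).clmApply
        (hN'.clmApply (hasDerivAt_const (0 : ℝ) e))
      simpa using (hda δ).unique d5
    have e3 : δ = 0 := by
      have : ρ (N (κ₀, 0) v + N' e) = 0 := by rw [e1, map_zero]
      rw [map_add, hρN, zero_add, ← e2] at this
      exact (mul_eq_zero.mp this).resolve_right ha
    have e4 : N' = 0 := by
      subst e3
      have : HasDerivAt (fun t : ℝ => N (κ₀, t • (0 : ℂ))) 0 0 := by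
        simpa using hasDerivAt_const (0 : ℝ) (N (κ₀, 0))
      exact hN'.unique this
    rw [e4] at e1
    obtain ⟨z, rfl⟩ := h.kernel v (by simpa using e1)
    have e5 : innerSL ℂ e (z • e) = 0 := by
      have d6 : HasDerivAt (fun t : ℝ => innerSL ℂ e (t • (z • e))) (innerSL ℂ e (z • e)) 0 := by
        have := (hasDerivAt_const (0 : ℝ) (innerSL ℂ e)).clmApply
          ((hasDerivAt_id (0 : ℝ)).smul_const (z • e))
        simpa using this
      exact d6.unique d4
    have e6 : z = 0 := by
      simpa [h.ne_zero] using e5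
    simp [e3, e6])
  refine ⟨fun q => (φ q).1, fun q => (φ q).2, hφ.fst, hφ.snd, by simp [hφ0], by simp [hφ0], ?_⟩
  filter_upwards [hφF] with q hq
  exact sub_eq_zero.mp (congrArg Prod.fst hq)

/-- The dispersion curve of a critical family, together with what stability says about it. -/
theorem IsCritical.exists_dispersion (h : IsCritical N Q κ₀ e) :
    ∃ (V : P × ℝ → E) (μ : P × ℝ → ℂ) (c : P → ℝ),
      ContDiffAt ℝ 2 V (κ₀, 0) ∧ ContDiffAt ℝ 2 μ (κ₀, 0) ∧
      V (κ₀, 0) = e ∧ μ (κ₀, 0) = 0 ∧ (∀ κ ∈ Q, 0 < c κ) ∧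
      (∀ᶠ q in 𝓝 (κ₀, (0 : ℝ)), N (q.1, μ q) (V q) = ((q.2 : ℂ) * Complex.I) • V q) ∧
      ∀ᶠ q in 𝓝 (κ₀, (0 : ℝ)), q.1 ∈ Q → (μ q).re ≤ -c q.1 * q.2 ^ 2 := by
  obtain ⟨V, μ, hV, hμ, hV0, hμ0, hN⟩ := h.exists_curve
  obtain ⟨c, hc, hdis⟩ := h.dissipation
  refine ⟨V, μ, c, hV, hμ, hV0, hμ0, hc, hN, ?_⟩
  have h1 : ∀ᶠ q in 𝓝 (κ₀, (0 : ℝ)), V q ≠ 0 := by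
    refine hV.continuousAt.eventually_ne ?_
    rw [hV0]; exact h.ne_zero
  have h2 : Tendsto (fun q : P × ℝ => (q.1, μ q)) (𝓝 (κ₀, 0)) (𝓝 (κ₀, 0)) := by
    have : ContinuousAt (fun q : P × ℝ => (q.1, μ q)) (κ₀, 0) :=
      continuousAt_fst.prodMk hμ.continuousAt
    simpa [ContinuousAt, hμ0] using this
  have h3 : ∀ᶠ q in 𝓝 (κ₀, (0 : ℝ)), |q.2| ≤ 1 / 2 := by
    have : ContinuousAt (fun q : P × ℝ => |q.2|) (κ₀, 0) := by fun_prop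
    exact (this.eventually_lt continuousAt_const (by simp)).mono fun q hq => hq.le
  filter_upwards [hN, h1, h2.eventually hdis, h3] with q hq1 hq2 hq3 hq4 hqQ
  exact hq3 hqQ q.2 hq4 (V q) hq2 hq1

end Center

section Center

variable {P E : Type} [NormedAddCommGroup P] [NormedSpace ℝ P] [FiniteDimensional ℝ P]
  [NormedAddCommGroup E] [InnerProductSpace ℂ E] [FiniteDimensional ℂ E]
  {N : P × ℂ → E →L[ℂ] E} {Q : Set P} {κ₀ : P} {e : E}

/-- The sign of the quadratic coefficient of the dispersion curve at a critical point that is not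
a semisimple eigenvalue. If `ρ₁ N₀ = ρ`, then `μ(ξ) a = - ξ² ρ₁ e + o(ξ²)`, while dissipation
bounds `Re μ(ξ)` by `-c ξ²`. -/
theorem IsCritical.re_pos (h : IsCritical N Q κ₀ e) {ρ ρ₁ : E →L[ℂ] ℂ} {a : ℂ} (ha : a ≠ 0)
    (hρN : ∀ v, ρ (N (κ₀, 0) v) = 0) (hρ₁ : ∀ v, ρ₁ (N (κ₀, 0) v) = ρ v)
    (hda : ∀ δ : ℂ, HasDerivAt (fun t : ℝ => ρ (N (κ₀, t • δ) e)) (δ * a) 0) :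
    0 < (ρ₁ e / a).re := by
  obtain ⟨V', μ', c, hV', hμ', hV0, hμ0, hc, hN', hre'⟩ := h.exists_dispersion
  have hline : Tendsto (fun ξ : ℝ => (κ₀, ξ)) (𝓝 0) (𝓝 (κ₀, 0)) := by
    have : ContinuousAt (fun ξ : ℝ => (κ₀, ξ)) 0 := by fun_prop
    exact this
  set V : ℝ → E := fun ξ => V' (κ₀, ξ) with hV
  set μ : ℝ → ℂ := fun ξ => μ' (κ₀, ξ) with hμ
  have hVlim : Tendsto V (𝓝 0) (𝓝 e) := by
    have := hV'.continuousAt.tendsto.comp hline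
    rwa [hV0] at this
  have hμlim : Tendsto μ (𝓝 0) (𝓝 0) := by
    have := hμ'.continuousAt.tendsto.comp hline
    rwa [hμ0] at this
  have hNV : ∀ᶠ ξ in 𝓝 (0 : ℝ), N (κ₀, μ ξ) (V ξ) = ((ξ : ℂ) * Complex.I) • V ξ :=
    hline.eventually hN'
  have hre : ∀ᶠ ξ in 𝓝 (0 : ℝ), (μ ξ).re ≤ -c κ₀ * ξ ^ 2 :=
    (hline.eventually hre').mono fun ξ hξ => hξ h.mem
  have hd0 : HasFDerivAt (fun δ : ℂ => N (κ₀, δ)) (fderiv ℝ N (κ₀, 0) ∘L .inr ℝ P ℂ) 0 := by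
    have h1 : HasFDerivAt (fun δ : ℂ => (κ₀, δ)) (ContinuousLinearMap.inr ℝ P ℂ) 0 :=
      hasFDerivAt_prodMk_right κ₀ 0
    exact (h.smooth.differentiableAt (by norm_num)).hasFDerivAt.comp (0 : ℂ) h1
  set L := fderiv ℝ N (κ₀, 0) ∘L .inr ℝ P ℂ with hL
  have hLe : ∀ δ : ℂ, ρ (L δ e) = δ * a := by
    intro δ
    have h1 : HasDerivAt (fun t : ℝ => t • δ) δ 0 := by
      simpa using (hasDerivAt_id (0 : ℝ)).smul_const δ
    have h2 : HasDerivAt (fun t : ℝ => N (κ₀, t • δ)) (L δ) 0 := by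
      have h3 : HasFDerivAt (fun δ : ℂ => N (κ₀, δ)) L ((0 : ℝ) • δ) := by simpa using hd0
      have h4 := h3.comp_hasDerivAt (0 : ℝ) h1
      exact h4
    have h4 := (hasDerivAt_const (0 : ℝ) ρ).clmApply (h2.clmApply (hasDerivAt_const (0 : ℝ) e))
    simpa using h4.unique (hda δ)
  -- `ρ (D V) = μ a + o(μ)` and `ρ₁ (D V) = O(μ)` for the increment `D` of `N`
  set D : ℝ → E →L[ℂ] E := fun ξ => N (κ₀, μ ξ) - N (κ₀, 0) with hD
  have hDo : (fun ξ => D ξ - L (μ ξ)) =o[𝓝 0] μ := by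
    have := hd0.isLittleO.comp_tendsto hμlim
    simpa [Function.comp_def] using this
  have hLO : (fun ξ => L (μ ξ)) =O[𝓝 0] μ := L.isBigO_comp _ _
  have hDO : D =O[𝓝 0] μ := by
    have := hDo.isBigO.add hLO
    simpa using this
  have hVO : V =O[𝓝 0] (fun _ => (1 : ℝ)) := hVlim.isBigO_one ℝ
  have hVe : (fun ξ => V ξ - e) =o[𝓝 0] (fun _ => (1 : ℝ)) := by
    rw [Asymptotics.isLittleO_one_iff]
    simpa using hVlim.sub_const e
  have happ : ∀ {T : ℝ → E →L[ℂ] E} {w : ℝ → E} (ψ : E →L[ℂ] ℂ),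
      (fun ξ => ψ (T ξ (w ξ))) =O[𝓝 0] fun ξ => ‖T ξ‖ * ‖w ξ‖ := by
    intro T w ψ
    refine Asymptotics.IsBigO.of_bound ‖ψ‖ (.of_forall fun ξ => ?_)
    rw [Real.norm_of_nonneg (by positivity)]
    exact (ψ.le_opNorm _).trans (by gcongr; exact (T ξ).le_opNorm _)
  have h1 : (fun ξ => ρ (D ξ (V ξ)) - μ ξ * a) =o[𝓝 0] μ := by
    have e1 : (fun ξ => ρ (D ξ (V ξ)) - μ ξ * a) =
        fun ξ => ρ ((D ξ - L (μ ξ)) (V ξ)) + ρ (L (μ ξ) (V ξ - e)) := by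
      funext ξ
      rw [← hLe]
      simp only [sub_apply, map_sub]
      ring
    rw [e1]
    refine Asymptotics.IsLittleO.add ?_ ?_
    · refine (happ ρ).trans_isLittleO ?_
      simpa using (hDo.norm_norm.mul_isBigO hVO.norm_norm)
    · refine (happ ρ).trans_isLittleO ?_
      simpa using (hLO.norm_norm.mul_isLittleO hVe.norm_norm)
  have h2 : (fun ξ => ρ₁ (D ξ (V ξ))) =O[𝓝 0] μ := by
    refine (happ ρ₁).trans ?_
    simpa using hDO.norm_norm.mul hVO.norm_norm
  have hid : (fun ξ : ℝ => (ξ : ℂ) * Complex.I) =o[𝓝 0] (fun _ => (1 : ℝ)) := by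
    rw [Asymptotics.isLittleO_one_iff]
    have : ContinuousAt (fun ξ : ℝ => (ξ : ℂ) * Complex.I) 0 := by fun_prop
    simpa [ContinuousAt] using this
  have h3 : (fun ξ : ℝ => (ξ : ℂ) * Complex.I * ρ₁ (D ξ (V ξ))) =o[𝓝 0] μ := by
    simpa using (hid.mul_isBigO h2.norm_right).norm_right
  have hsq : (fun ξ : ℝ => (ξ : ℂ) ^ 2) =O[𝓝 0] fun ξ : ℝ => ξ ^ 2 := by
    refine Asymptotics.IsBigO.of_bound 1 (.of_forall fun ξ => ?_)
    simp
  have h4 : (fun ξ : ℝ => (ξ : ℂ) ^ 2 * ρ₁ (V ξ - e)) =o[𝓝 0] fun ξ : ℝ => ξ ^ 2 := by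
    have h5 : (fun ξ => ρ₁ (V ξ - e)) =o[𝓝 0] fun _ => (1 : ℝ) :=
      (ρ₁.isBigO_comp _ _).trans_isLittleO hVe
    simpa using hsq.mul_isLittleO h5
  -- pairing the eigenvalue equation with `ρ` and `ρ₁`
  have hkey : (fun ξ : ℝ => μ ξ * a + (ξ : ℂ) ^ 2 * ρ₁ e) =ᶠ[𝓝 0]
      fun ξ => (-(ρ (D ξ (V ξ)) - μ ξ * a) - (ξ : ℂ) * Complex.I * ρ₁ (D ξ (V ξ))) -
        (ξ : ℂ) ^ 2 * ρ₁ (V ξ - e) := by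
    filter_upwards [hNV] with ξ hξ
    have e1 : D ξ (V ξ) = ((ξ : ℂ) * Complex.I) • V ξ - N (κ₀, 0) (V ξ) := by
      rw [hD, ← hξ]; rfl
    have e2 : ρ (D ξ (V ξ)) = (ξ : ℂ) * Complex.I * ρ (V ξ) := by
      rw [e1, map_sub, hρN, sub_zero, map_smul, smul_eq_mul]
    have e3 : ρ₁ (D ξ (V ξ)) = (ξ : ℂ) * Complex.I * ρ₁ (V ξ) - ρ (V ξ) := by
      rw [e1, map_sub, hρ₁, map_smul, smul_eq_mul]
    rw [e2, e3, map_sub]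
    linear_combination ((ξ : ℂ) ^ 2 * ρ₁ (V ξ)) * Complex.I_sq
  have h6 : (fun ξ : ℝ => -(ρ (D ξ (V ξ)) - μ ξ * a) - (ξ : ℂ) * Complex.I * ρ₁ (D ξ (V ξ)))
      =o[𝓝 0] μ := h1.neg_left.sub h3
  -- the terms `o(μ)` in `hkey` are absorbed, which leaves `μ = O(ξ²)`
  have hμO : μ =O[𝓝 0] fun ξ : ℝ => ξ ^ 2 := by
    have h7 : μ =O[𝓝 0] fun ξ => μ ξ * a := by
      refine Asymptotics.IsBigO.of_bound ‖a‖⁻¹ (.of_forall fun ξ => ?_)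
      rw [norm_mul]
      field_simp
      rfl
    have h8 := (h6.neg_left.trans_isBigO h7).right_isBigO_add
    refine h7.trans (h8.trans ?_)
    have h9 : (fun ξ : ℝ => -((ξ : ℂ) ^ 2 * ρ₁ e) - (ξ : ℂ) ^ 2 * ρ₁ (V ξ - e)) =O[𝓝 0]
        fun ξ : ℝ => ξ ^ 2 := by
      refine Asymptotics.IsBigO.sub ?_ h4.isBigO
      refine Asymptotics.IsBigO.neg_left ?_
      simpa using hsq.mul (Asymptotics.isBigO_const_const (ρ₁ e) (one_ne_zero (α := ℝ)) (𝓝 0))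
    refine h9.congr' ?_ .rfl
    filter_upwards [hkey] with ξ hξ
    linear_combination -hξ
  have h10 : (fun ξ : ℝ => μ ξ * a + (ξ : ℂ) ^ 2 * ρ₁ e) =o[𝓝 0] fun ξ : ℝ => ξ ^ 2 :=
    ((h6.trans_isBigO hμO).sub h4).congr' hkey.symm .rfl
  have h11 : ∀ᶠ ξ in 𝓝 (0 : ℝ), ‖μ ξ * a + (ξ : ℂ) ^ 2 * ρ₁ e‖ ≤ c κ₀ / 2 * ‖a‖ * ‖ξ ^ 2‖ :=
    h10.def (by have := hc κ₀ h.mem; positivity)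
  have hex : ∃ᶠ ξ in 𝓝 (0 : ℝ), ξ ≠ 0 := by
    have : (𝓝[≠] (0 : ℝ)).NeBot := inferInstance
    exact frequently_mem_iff_neBot.mpr this
  obtain ⟨ξ, hξ0, hξ1, hξ2⟩ := (hex.and_eventually (hre.and h11)).exists
  have hξpos : 0 < ξ ^ 2 := by positivity
  have hcpos := hc κ₀ h.mem
  have h12 : ‖μ ξ + (ξ : ℂ) ^ 2 * (ρ₁ e / a)‖ ≤ c κ₀ / 2 * ξ ^ 2 := by
    have e1 : μ ξ + (ξ : ℂ) ^ 2 * (ρ₁ e / a) = (μ ξ * a + (ξ : ℂ) ^ 2 * ρ₁ e) / a := by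
      field_simp
    rw [e1, norm_div, div_le_iff₀ (norm_pos_iff.mpr ha)]
    rw [Real.norm_of_nonneg hξpos.le] at hξ2
    linarith
  have h13 : (μ ξ + (ξ : ℂ) ^ 2 * (ρ₁ e / a)).re = (μ ξ).re + ξ ^ 2 * (ρ₁ e / a).re := by
    rw [Complex.add_re, ← Complex.ofReal_pow, Complex.re_ofReal_mul]
  have h14 := neg_le_of_abs_le ((Complex.abs_re_le_norm _).trans h12)
  rw [h13] at h14
  have h15 : 0 < ξ ^ 2 * (ρ₁ e / a).re := by nlinarith
  exact (pos_iff_pos_of_mul_pos h15).mp hξpos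

end Center

/-! ### Quadratic forms near a critical frequency -/

section Forms

variable {E : Type} [NormedAddCommGroup E] [InnerProductSpace ℂ E] [FiniteDimensional ℂ E]

/-- The operator of the sesquilinear form `(v, w) ↦ conj (r v) * s w`. -/
noncomputable def outer (r s : E →L[ℂ] ℂ) : E →L[ℂ] E := ContinuousLinearMap.adjoint r ∘L s

theorem inner_outer (r s : E →L[ℂ] ℂ) (v w : E) :
    ⟪v, outer r s w⟫_ℂ = starRingEnd ℂ (r v) * s w := by
  rw [outer, ContinuousLinearMap.comp_apply, ContinuousLinearMap.adjoint_inner_right]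
  simp [mul_comm]

theorem star_outer (r s : E →L[ℂ] ℂ) : star (outer r s) = outer s r := by
  rw [ContinuousLinearMap.star_eq_adjoint, outer, ContinuousLinearMap.adjoint_comp,
    ContinuousLinearMap.adjoint_adjoint, outer]

/-- The adjoint of a functional, as a real linear map. -/
noncomputable def adjointReal (E : Type) [NormedAddCommGroup E] [InnerProductSpace ℂ E]
    [FiniteDimensional ℂ E] : (E →L[ℂ] ℂ) →ₗ[ℝ] (ℂ →L[ℂ] E) where
  toFun r := ContinuousLinearMap.adjoint r
  map_add' := map_add _
  map_smul' t r := by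
    have : t • r = (t : ℂ) • r := by ext v; simp
    rw [this, map_smulₛₗ]
    ext
    simp

variable {X : Type} [NormedAddCommGroup X] [NormedSpace ℝ X]

theorem _root_.ContDiffAt.outer {n : WithTop ℕ∞} {r s : X → E →L[ℂ] ℂ} {x : X}
    (hr : ContDiffAt ℝ n r x) (hs : ContDiffAt ℝ n s x) :
    ContDiffAt ℝ n (fun y => outer (r y) (s y)) x := by
  have h1 : ContDiffAt ℝ n (fun y => ContinuousLinearMap.adjoint (r y)) x :=
    ContDiffAt.comp (g := adjointReal E) x
      (LinearMap.toContinuousLinearMap (adjointReal E)).contDiff.contDiffAt hr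
  exact h1.clmComp hs

theorem _root_.ContDiffAt.starOp {n : WithTop ℕ∞} {g : X → E →L[ℂ] E} {x : X}
    (hg : ContDiffAt ℝ n g x) : ContDiffAt ℝ n (fun y => star (g y)) x :=
  ((starL' ℝ : (E →L[ℂ] E) ≃L[ℝ] (E →L[ℂ] E)).contDiff.contDiffAt).comp x hg

end Forms

section Center

variable {P E : Type} [NormedAddCommGroup P] [NormedSpace ℝ P] [FiniteDimensional ℝ P]
  [NormedAddCommGroup E] [InnerProductSpace ℂ E] [FiniteDimensional ℂ E]

/-- A `C¹` symmetrizer for the family `N` near `(κ₀, 0)`, with the weight `Re μ + (Im μ)²`. -/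
def HasLocalSymmetrizer (N : P × ℂ → E →L[ℂ] E) (Q : Set P) (κ₀ : P) : Prop :=
  ∃ S : P × ℂ → E →L[ℂ] E, ContDiffAt ℝ 1 S (κ₀, 0) ∧ (∀ x, IsSelfAdjoint (S x)) ∧
    ∀ᶠ x in 𝓝 (κ₀, (0 : ℂ)), x.1 ∈ Q → 0 ≤ x.2.re →
      ∀ v, (x.2.re + x.2.im ^ 2) * ‖v‖ ^ 2 ≤ (⟪v, S x (N x v)⟫_ℂ).re

/-- A form `C` that controls the central coordinates `T v` is completed to a symmetrizer by a
Lyapunov function of the hyperbolic part. The latter is evaluated at `g v`, where `g` commutes with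
`N` and kills the central directions; on the range of `g`, `N` agrees with the hyperbolic operator
`A`. -/
theorem hasLocalSymmetrizer_of_center {G : Type} [NormedAddCommGroup G] [NormedSpace ℂ G]
    {N : P × ℂ → E →L[ℂ] E} {Q : Set P} {κ₀ : P}
    {C g A : P × ℂ → E →L[ℂ] E} {T : P × ℂ → E →L[ℂ] G}
    (hC : ContDiffAt ℝ 1 C (κ₀, 0)) (hCs : ∀ x, IsSelfAdjoint (C x))
    (hg : ContDiffAt ℝ 1 g (κ₀, 0)) (hgN : ∀ x v, g x (N x v) = N x (g x v))
    (hA : ContinuousAt A (κ₀, 0)) (hAh : IsHyperbolic (A (κ₀, 0)))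
    (hAg : ∀ᶠ x in 𝓝 (κ₀, (0 : ℂ)), ∀ v, A x (g x v) = N x (g x v))
    (hT : ContinuousAt T (κ₀, 0))
    (hinj : ∀ v, T (κ₀, 0) v = 0 → g (κ₀, 0) v = 0 → v = 0)
    {c : ℝ} (hc : 0 < c)
    (hCN : ∀ᶠ x in 𝓝 (κ₀, (0 : ℂ)), x.1 ∈ Q → 0 ≤ x.2.re →
      ∀ v, c * (x.2.re + x.2.im ^ 2) * ‖T x v‖ ^ 2 ≤ (⟪v, C x (N x v)⟫_ℂ).re) :
    HasLocalSymmetrizer N Q κ₀ := by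
  obtain ⟨H, hH, hHA⟩ := eventually_lyapunov hA hAh
  have hTg : ContinuousAt (fun x => (T x).prod (g x)) (κ₀, 0) := by
    have h1 : (fun x => (T x).prod (g x)) = fun x =>
        ContinuousLinearMap.inl ℂ G E ∘L T x + ContinuousLinearMap.inr ℂ G E ∘L g x := by
      funext x; ext v <;> simp
    rw [h1]
    exact (continuousAt_const.clm_comp hT).add (continuousAt_const.clm_comp hg.continuousAt)
  obtain ⟨c₁, hc₁, hlow⟩ := eventually_lower_bound hTg (by
    intro v hv
    exact hinj v (congrArg Prod.fst hv) (congrArg Prod.snd hv))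
  set b := min c (1 / 2) * c₁ ^ 2 with hb
  have hbpos : 0 < b := by positivity
  -- the form `C (v, v) + H (g v, g v)`, normalized by a constant
  refine ⟨fun x => ((b⁻¹ : ℝ) : ℂ) • (C x + star (g x) ∘L H ∘L g x), ?_, ?_, ?_⟩
  · refine contDiffAt_const.complexSMul (hC.add ?_)
    exact hg.starOp.clmComp (contDiffAt_const.clmComp hg)
  · intro x
    refine IsSelfAdjoint.smul (by simp [IsSelfAdjoint, Complex.conj_ofReal]) ((hCs x).add ?_)
    have : star (g x) ∘L H ∘L g x = star (g x) * H * g x := rfl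
    rw [this]
    exact hH.conjugate' (g x)
  have hw : ∀ᶠ x in 𝓝 (κ₀, (0 : ℂ)), x.2.re + x.2.im ^ 2 < 1 := by
    have : ContinuousAt (fun x : P × ℂ => x.2.re + x.2.im ^ 2) (κ₀, 0) := by fun_prop
    exact this.eventually_lt continuousAt_const (by simp)
  filter_upwards [hHA, hAg, hlow, hCN, hw] with x h1 h2 h3 h4 h5 hxQ hx v
  have e1 : ⟪v, star (g x) (H (g x (N x v)))⟫_ℂ = ⟪g x v, H (A x (g x v))⟫_ℂ := by
    rw [ContinuousLinearMap.star_eq_adjoint, ContinuousLinearMap.adjoint_inner_right, hgN, h2]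
  have e2 : (⟪v, (((b⁻¹ : ℝ) : ℂ) • (C x + star (g x) ∘L H ∘L g x)) (N x v)⟫_ℂ).re =
      b⁻¹ * ((⟪v, C x (N x v)⟫_ℂ).re + (⟪g x v, H (A x (g x v))⟫_ℂ).re) := by
    rw [_root_.smul_apply, inner_smul_right, Complex.re_ofReal_mul, add_apply, inner_add_right,
      Complex.add_re, ← e1]
    rfl
  rw [e2, le_inv_mul_iff₀ hbpos]
  have h6 := h4 hxQ hx v
  have h7 := h1 (g x v)
  have h8 : c₁ ^ 2 * ‖v‖ ^ 2 ≤ ‖T x v‖ ^ 2 + ‖g x v‖ ^ 2 := by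
    have h9 := h3 v
    have h10 : ‖((T x).prod (g x)) v‖ = max ‖T x v‖ ‖g x v‖ := rfl
    rw [h10] at h9
    rw [← mul_pow]
    rcases le_max_iff.mp h9 with h | h
    · have := pow_le_pow_left₀ (by positivity) h 2
      nlinarith [sq_nonneg ‖g x v‖]
    · have := pow_le_pow_left₀ (by positivity) h 2
      nlinarith [sq_nonneg ‖T x v‖]
  set w := x.2.re + x.2.im ^ 2 with hw'
  have hw0 : 0 ≤ w := by positivity
  have h11 : min c (1 / 2) * w * ‖T x v‖ ^ 2 ≤ c * w * ‖T x v‖ ^ 2 := by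
    gcongr; exact min_le_left _ _
  have h12 : min c (1 / 2) * w * ‖g x v‖ ^ 2 ≤ 1 / 2 * 1 * ‖g x v‖ ^ 2 := by
    gcongr; exact min_le_right _ _
  have h13 : min c (1 / 2) * w * (c₁ ^ 2 * ‖v‖ ^ 2) ≤
      min c (1 / 2) * w * (‖T x v‖ ^ 2 + ‖g x v‖ ^ 2) := by
    gcongr
  calc b * (w * ‖v‖ ^ 2) = min c (1 / 2) * w * (c₁ ^ 2 * ‖v‖ ^ 2) := by rw [hb]; ring
    _ ≤ _ := by linarith

end Center

/-! ### Second-order growth with parameters -/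

/-- Integrating a lower bound of the second derivative twice. -/
theorem sq_le_of_second_deriv {f f₁ f₂ : ℝ → ℝ} {δ m : ℝ}
    (h1 : ∀ ξ, |ξ| < δ → HasDerivAt f (f₁ ξ) ξ) (h2 : ∀ ξ, |ξ| < δ → HasDerivAt f₁ (f₂ ξ) ξ)
    (h3 : ∀ ξ, |ξ| < δ → m ≤ f₂ ξ) (hf0 : f 0 = 0) (hf1 : f₁ 0 = 0) {ξ : ℝ} (hξ : |ξ| < δ) :
    m / 2 * ξ ^ 2 ≤ f ξ := by
  have hm1 : ∀ ξ, |ξ| < δ → HasDerivAt (fun ξ => f₁ ξ - m * ξ) (f₂ ξ - m) ξ := fun ξ hξ => by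
    exact ((h2 ξ hξ).sub ((hasDerivAt_id ξ).const_mul m)).congr_deriv (by ring)
  have hmono : MonotoneOn (fun ξ => f₁ ξ - m * ξ) (Set.Ioo (-δ) δ) := by
    refine monotoneOn_of_deriv_nonneg (convex_Ioo _ _) ?_ ?_ ?_
    · exact fun z hz => (hm1 z (abs_lt.mpr hz)).continuousAt.continuousWithinAt
    · rw [interior_Ioo]
      exact fun z hz => (hm1 z (abs_lt.mpr hz)).differentiableAt.differentiableWithinAt
    · rw [interior_Ioo]
      intro z hz
      rw [(hm1 z (abs_lt.mpr hz)).deriv]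
      linarith [h3 z (abs_lt.mpr hz)]
  have hδ : 0 < δ := (abs_nonneg ξ).trans_lt hξ
  have hm2 : ∀ ξ, |ξ| < δ → HasDerivAt (fun ξ => f ξ - m / 2 * ξ ^ 2) (f₁ ξ - m * ξ) ξ :=
    fun ξ hξ => by
      have := (h1 ξ hξ).sub ((hasDerivAt_pow 2 ξ).const_mul (m / 2))
      refine this.congr_deriv ?_
      norm_num
      ring
  have h00 : (0 : ℝ) ∈ Set.Ioo (-δ) δ := ⟨by linarith, hδ⟩
  have hcont : ∀ s ⊆ Set.Ioo (-δ) δ, ContinuousOn (fun ξ => f ξ - m / 2 * ξ ^ 2) s :=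
    fun s hs z hz => (hm2 z (abs_lt.mpr (hs hz))).continuousAt.continuousWithinAt
  have hξ' := abs_lt.mp hξ
  rcases le_total 0 ξ with h | h
  · have hs : Set.Icc 0 ξ ⊆ Set.Ioo (-δ) δ := fun z hz =>
      ⟨by linarith [hz.1], by linarith [hz.2, hξ'.2]⟩
    have : MonotoneOn (fun ξ => f ξ - m / 2 * ξ ^ 2) (Set.Icc 0 ξ) := by
      refine monotoneOn_of_deriv_nonneg (convex_Icc _ _) (hcont _ hs) ?_ ?_
      · exact fun z hz => (hm2 z (abs_lt.mpr (hs (interior_subset hz)))).differentiableAt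
          |>.differentiableWithinAt
      · intro z hz
        have hz' := interior_subset hz
        rw [(hm2 z (abs_lt.mpr (hs hz'))).deriv]
        have := hmono h00 (hs hz') hz'.1
        simpa [hf1] using this
    have := this ⟨le_rfl, h⟩ ⟨h, le_rfl⟩ h
    simp only [hf0] at this
    linarith
  · have hs : Set.Icc ξ 0 ⊆ Set.Ioo (-δ) δ := fun z hz =>
      ⟨by linarith [hz.1, hξ'.1], by linarith [hz.2]⟩
    have : AntitoneOn (fun ξ => f ξ - m / 2 * ξ ^ 2) (Set.Icc ξ 0) := by
      refine antitoneOn_of_deriv_nonpos (convex_Icc _ _) (hcont _ hs) ?_ ?_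
      · exact fun z hz => (hm2 z (abs_lt.mpr (hs (interior_subset hz)))).differentiableAt
          |>.differentiableWithinAt
      · intro z hz
        have hz' := interior_subset hz
        rw [(hm2 z (abs_lt.mpr (hs hz'))).deriv]
        have := hmono (hs hz') h00 hz'.2
        simpa [hf1] using this
    have := this ⟨le_rfl, h⟩ ⟨h, le_rfl⟩ h
    simp only [hf0] at this
    linarith

/-- A nonnegative `C²` function of `(κ, ξ)` that vanishes at `ξ = 0` and grows quadratically in `ξ`
at one parameter `κ₀` does so uniformly at the parameters close to `κ₀`. -/
theorem eventually_sq_le {P : Type} [NormedAddCommGroup P] [NormedSpace ℝ P] {Q : Set P} {κ₀ : P}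
    (hκ₀ : κ₀ ∈ Q) {d : P × ℝ → ℝ} (hd : ContDiffAt ℝ 2 d (κ₀, 0))
    (hpos : ∀ᶠ q in 𝓝 (κ₀, (0 : ℝ)), q.1 ∈ Q → 0 ≤ d q)
    (hzero : ∀ᶠ κ in 𝓝 κ₀, κ ∈ Q → d (κ, 0) = 0) {c₀ : ℝ} (hc₀ : 0 < c₀)
    (hgrow : ∀ᶠ ξ in 𝓝 (0 : ℝ), c₀ * ξ ^ 2 ≤ d (κ₀, ξ)) :
    ∃ c > 0, ∀ᶠ q in 𝓝 (κ₀, (0 : ℝ)), q.1 ∈ Q → c * q.2 ^ 2 ≤ d q := by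
  set d₁ : P × ℝ → ℝ := fun q => fderiv ℝ d q (0, 1) with hd₁
  set d₂ : P × ℝ → ℝ := fun q => fderiv ℝ d₁ q (0, 1) with hd₂
  have hd1C : ContDiffAt ℝ 1 d₁ (κ₀, 0) :=
    (hd.fderiv_right (m := 1) (by norm_num)).clm_apply contDiffAt_const
  have hd2C : ContinuousAt d₂ (κ₀, 0) :=
    ((hd1C.fderiv_right (m := 0) (by norm_num)).clm_apply contDiffAt_const).continuousAt
  have hder : ∀ {F : P × ℝ → ℝ} {q : P × ℝ}, DifferentiableAt ℝ F q →
      HasDerivAt (fun ξ => F (q.1, ξ)) (fderiv ℝ F q (0, 1)) q.2 := by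
    intro F q hF
    have h1 : HasDerivAt (fun ξ : ℝ => (q.1, ξ)) ((0 : P), (1 : ℝ)) q.2 :=
      (hasDerivAt_const _ _).prodMk (hasDerivAt_id _)
    have h2 : HasFDerivAt F (fderiv ℝ F q) (q.1, q.2) := hF.hasFDerivAt
    exact h2.comp_hasDerivAt q.2 h1
  have hdiff : ∀ᶠ q in 𝓝 (κ₀, (0 : ℝ)), DifferentiableAt ℝ d q :=
    (hd.eventually (by simp)).mono fun q hq => hq.differentiableAt (by norm_num)
  have hdiff1 : ∀ᶠ q in 𝓝 (κ₀, (0 : ℝ)), DifferentiableAt ℝ d₁ q :=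
    (hd1C.eventually (by simp)).mono fun q hq => hq.differentiableAt (by norm_num)
  have hzero' : ∀ᶠ q in 𝓝 (κ₀, (0 : ℝ)), q.1 ∈ Q → d (q.1, 0) = 0 :=
    (continuousAt_fst (p := (κ₀, (0 : ℝ)))).tendsto.eventually hzero
  obtain ⟨δ, hδ, hball⟩ := Metric.eventually_nhds_iff_ball.mp
    (hdiff.and (hdiff1.and (hpos.and hzero')))
  have hmem : ∀ {κ : P} {ξ : ℝ}, dist κ κ₀ < δ → |ξ| < δ →
      (κ, ξ) ∈ Metric.ball (κ₀, (0 : ℝ)) δ := by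
    intro κ ξ h1 h2
    rw [Metric.mem_ball, Prod.dist_eq]
    simpa using ⟨h1, h2⟩
  -- `ξ = 0` is a minimum of `d (κ, ·)`
  have hcrit : ∀ κ ∈ Q, dist κ κ₀ < δ → d₁ (κ, 0) = 0 := by
    intro κ hκ hdist
    have h1 := hder (hball (κ, 0) (hmem hdist (by simpa using hδ))).1
    refine IsLocalMin.hasDerivAt_eq_zero ?_ h1
    have h2 : ∀ᶠ ξ in 𝓝 (0 : ℝ), |ξ| < δ := by
      have : ContinuousAt (fun ξ : ℝ => |ξ|) 0 := by fun_prop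
      exact this.eventually_lt continuousAt_const (by simpa using hδ)
    filter_upwards [h2] with ξ hξ
    have h3 := (hball (κ, 0) (hmem hdist (by simpa using hδ))).2.2.2 hκ
    simp only at h3 ⊢
    rw [h3]
    exact (hball (κ, ξ) (hmem hdist hξ)).2.2.1 hκ
  -- with a smaller second derivative, `d (κ₀, ·)` would grow slower than `c₀ ξ²`
  have hd20 : c₀ ≤ d₂ (κ₀, 0) := by
    by_contra! hlt
    have h1 : ∀ᶠ ξ in 𝓝 (0 : ℝ), d₂ (κ₀, ξ) < c₀ := by
      have h2 : ContinuousAt (fun ξ : ℝ => d₂ (κ₀, ξ)) 0 :=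
        ContinuousAt.comp (g := d₂) (f := fun ξ : ℝ => (κ₀, ξ)) hd2C (by fun_prop)
      exact h2.eventually_lt continuousAt_const hlt
    obtain ⟨ε, hε, hball'⟩ := Metric.eventually_nhds_iff_ball.mp (h1.and hgrow)
    set ρ := min ε δ with hρ
    have hρpos : 0 < ρ := lt_min hε hδ
    have hup : ∀ ξ, |ξ| < ρ → -c₀ / 2 * ξ ^ 2 ≤ -d (κ₀, ξ) := fun ξ hξ => by
      refine sq_le_of_second_deriv (f := fun ξ => -d (κ₀, ξ)) (f₁ := fun ξ => -d₁ (κ₀, ξ))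
        (f₂ := fun ξ => -d₂ (κ₀, ξ)) (δ := ρ) ?_ ?_ ?_ ?_ ?_ hξ
      · intro ξ hξ
        exact (hder (hball (κ₀, ξ) (hmem (by simpa using hδ)
          (hξ.trans_le (min_le_right _ _)))).1).neg
      · intro ξ hξ
        exact (hder (hball (κ₀, ξ) (hmem (by simpa using hδ)
          (hξ.trans_le (min_le_right _ _)))).2.1).neg
      · intro ξ hξ
        have := (hball' ξ (by simpa using hξ.trans_le (min_le_left _ _))).1
        linarith
      · have := (hball (κ₀, 0) (hmem (by simpa using hδ) (by simpa using hδ))).2.2.2 hκ₀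
        simpa using this
      · simpa using hcrit κ₀ hκ₀ (by simpa using hδ)
    have h3 : |ρ / 2| < ρ := by rw [abs_of_pos (by positivity)]; linarith
    have h4 := hup (ρ / 2) h3
    have h5 := (hball' (ρ / 2) (by
      rw [mem_ball_zero_iff, Real.norm_eq_abs]; exact h3.trans_le (min_le_left _ _))).2
    have h6 : 0 < c₀ * (ρ / 2) ^ 2 := by positivity
    linarith
  have h1 : ∀ᶠ q in 𝓝 (κ₀, (0 : ℝ)), c₀ / 2 < d₂ q :=
    continuousAt_const.eventually_lt hd2C (by linarith)
  obtain ⟨ε, hε, hball'⟩ := Metric.eventually_nhds_iff_ball.mp h1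
  set ρ := min ε δ with hρ
  have hρpos : 0 < ρ := lt_min hε hδ
  refine ⟨c₀ / 2 / 2, by positivity, ?_⟩
  filter_upwards [Metric.ball_mem_nhds _ hρpos] with q hq hqQ
  rw [Metric.mem_ball, Prod.dist_eq] at hq
  have hq1 : dist q.1 κ₀ < ρ := (le_max_left _ _).trans_lt hq
  have hq2 : |q.2| < ρ := by
    have := (le_max_right _ _).trans_lt hq
    simpa using this
  have hq1' := hq1.trans_le (min_le_right ε δ)
  refine sq_le_of_second_deriv (f := fun ξ => d (q.1, ξ)) (f₁ := fun ξ => d₁ (q.1, ξ))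
    (f₂ := fun ξ => d₂ (q.1, ξ)) (δ := ρ) ?_ ?_ ?_ ?_ ?_ hq2
  · intro ξ hξ
    exact hder (hball (q.1, ξ) (hmem hq1' (hξ.trans_le (min_le_right _ _)))).1
  · intro ξ hξ
    exact hder (hball (q.1, ξ) (hmem hq1' (hξ.trans_le (min_le_right _ _)))).2.1
  · intro ξ hξ
    refine (hball' (q.1, ξ) ?_).le
    rw [Metric.mem_ball, Prod.dist_eq]
    simpa using ⟨hq1.trans_le (min_le_left _ _), hξ.trans_le (min_le_left _ _)⟩
  · exact (hball (q.1, 0) (hmem hq1' (by simpa using hδ))).2.2.2 hqQ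
  · exact hcrit q.1 hqQ hq1'

/-! ### The critical eigenvalue is semisimple -/

section Simple

variable {P : Type} [NormedAddCommGroup P] [NormedSpace ℝ P] {Q : Set P} {κ₀ : P}

theorem fderiv_inr_eq {F : Type*} [NormedAddCommGroup F] [NormedSpace ℝ F] {σ : P × ℂ → F}
    {x : P × ℂ} (hσ : DifferentiableAt ℝ σ x) {δ : ℂ} {y : F}
    (h : HasDerivAt (fun t : ℝ => σ (x.1, x.2 + t • δ)) y 0) : fderiv ℝ σ x (0, δ) = y := by
  have h1 : HasDerivAt (fun t : ℝ => (x.1, x.2 + t • δ)) ((0 : P), δ) 0 := by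
    refine (hasDerivAt_const _ _).prodMk ?_
    simpa using ((hasDerivAt_id (0 : ℝ)).smul_const δ).const_add x.2
  have h2 : HasFDerivAt σ (fderiv ℝ σ x) (x.1, x.2 + (0 : ℝ) • δ) := by
    simpa using hσ.hasFDerivAt
  have h3 := h2.comp_hasDerivAt (0 : ℝ) h1
  exact h3.unique h

/-- Uniform differentiability in the spectral parameter. -/
theorem eventually_sub_le {σ : P × ℂ → ℂ} (hσ : ContDiffAt ℝ 1 σ (κ₀, 0)) {a : ℂ}
    (hda : ∀ δ : ℂ, HasDerivAt (fun t : ℝ => σ (κ₀, t • δ)) (δ * a) 0)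
    {Y : Type*} {l : Filter Y} {κ : Y → P} {μ ν : Y → ℂ} (hκ : Tendsto κ l (𝓝 κ₀))
    (hμ : Tendsto μ l (𝓝 0)) (hν : Tendsto ν l (𝓝 0)) {ε : ℝ} (hε : 0 < ε) :
    ∀ᶠ y in l, ‖σ (κ y, μ y) - σ (κ y, ν y) - (μ y - ν y) * a‖ ≤ ε * ‖μ y - ν y‖ := by
  have h1 := (hσ.hasStrictFDerivAt (by norm_num)).isLittleO.def hε
  have h2 : Tendsto (fun y => ((κ y, μ y), (κ y, ν y))) l (𝓝 ((κ₀, 0), (κ₀, 0))) :=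
    (hκ.prodMk_nhds hμ).prodMk_nhds (hκ.prodMk_nhds hν)
  filter_upwards [h2.eventually h1] with y hy
  have h3 : fderiv ℝ σ (κ₀, 0) ((0 : P), μ y - ν y) = (μ y - ν y) * a := by
    refine fderiv_inr_eq (hσ.differentiableAt (by norm_num)) ?_
    simpa using hda (μ y - ν y)
  simpa [h3] using hy

/-- The estimate behind `growth_of_simple`: `z` is compared with the point `ν` of the dispersion
curve, at which the eigenvalue is `iξ`, while it is `ρ + iξ` at `z`. -/
theorem le_of_compare {a z ν : ℂ} {ρ ξ s c' K : ℝ} (ha : a ≠ 0) (hareal : a.im = 0)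
    (hs1 : |s| = 1) (hsa : s * a.re = ‖a‖) (hc' : 0 < c') (h2 : |ρ| ≤ 1)
    (hx : 0 ≤ z.re) (e2 : ‖(ρ : ℂ) - (z - ν) * a‖ ≤ ‖a‖ / 4 * ‖z - ν‖)
    (e0 : c' * ξ ^ 2 ≤ -ν.re) (e11 : ‖ν‖ ≤ K * |ξ|) :
    (3 / (2 * ‖a‖) * (1 + 2 * K ^ 2 / c') + 8 / ‖a‖ ^ 2)⁻¹ * (z.re + z.im ^ 2) ≤ s * ρ := by
  have hapos : 0 < ‖a‖ := norm_pos_iff.mpr ha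
  set B := 3 / (2 * ‖a‖) * (1 + 2 * K ^ 2 / c') + 8 / ‖a‖ ^ 2 with hB
  have hBpos : 0 < B := by positivity
  rw [inv_mul_le_iff₀ hBpos]
  -- `|z - ν|` is controlled by `|ρ|`
  have e3 : ‖z - ν‖ ≤ 2 * |ρ| / ‖a‖ := by
    have h9 : ‖(z - ν) * a‖ ≤ ‖(ρ : ℂ)‖ + ‖(ρ : ℂ) - (z - ν) * a‖ := by
      have := norm_sub_le (ρ : ℂ) ((ρ : ℂ) - (z - ν) * a)
      rwa [sub_sub_cancel] at this
    rw [norm_mul, Complex.norm_real, Real.norm_eq_abs] at h9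
    rw [le_div_iff₀ hapos]
    linarith [abs_nonneg ρ]
  have e4 : |ρ - (z - ν).re * a.re| ≤ |ρ| / 2 := by
    have h9 := (Complex.abs_re_le_norm _).trans e2
    have h10 : ((ρ : ℂ) - (z - ν) * a).re = ρ - (z - ν).re * a.re := by
      simp [Complex.mul_re, hareal]
    rw [h10] at h9
    refine h9.trans ?_
    rw [le_div_iff₀ hapos] at e3
    linarith
  have e5 : z.re + c' * ξ ^ 2 ≤ (z - ν).re := by
    have : c' * ξ ^ 2 ≤ -ν.re := e0
    rw [Complex.sub_re]; linarith
  have e6 : |s * ρ - (z - ν).re * ‖a‖| ≤ |ρ| / 2 := by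
    have : s * ρ - (z - ν).re * ‖a‖ = s * (ρ - (z - ν).re * a.re) := by
      rw [← hsa]; ring
    rw [this, abs_mul, hs1, one_mul]
    exact e4
  have hsρ : |s * ρ| = |ρ| := by rw [abs_mul, hs1, one_mul]
  have e7 : 0 ≤ (z - ν).re := le_trans (by positivity) e5
  -- `Re (z - ν) ≥ 0` determines the sign of `ρ`
  have e8 : 0 ≤ s * ρ := by
    by_contra! h
    rw [← hsρ, abs_of_neg h] at e6
    have := neg_le_of_abs_le e6
    have := mul_nonneg e7 hapos.le
    linarith
  have e9 : |ρ| = s * ρ := by rw [← hsρ, abs_of_nonneg e8]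
  have e10 : ‖a‖ * (z.re + c' * ξ ^ 2) ≤ 3 / 2 * (s * ρ) := by
    rw [e9] at e6
    have := neg_le_of_abs_le e6
    have := mul_le_mul_of_nonneg_left e5 hapos.le
    linarith
  -- `Im z` is at most `|ν| + |z - ν|`, and `|ν| = O(|ξ|)`
  have e12 : z.im ^ 2 ≤ 2 * K ^ 2 * ξ ^ 2 + 8 / ‖a‖ ^ 2 * (s * ρ) := by
    have h9 : |z.im| ≤ K * |ξ| + 2 * |ρ| / ‖a‖ := by
      refine (Complex.abs_im_le_norm _).trans ?_
      have : z = ν + (z - ν) := by ring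
      calc ‖z‖ = ‖ν + (z - ν)‖ := by rw [← this]
        _ ≤ ‖ν‖ + ‖z - ν‖ := norm_add_le _ _
        _ ≤ _ := add_le_add e11 e3
    have h10 : z.im ^ 2 ≤ (K * |ξ| + 2 * |ρ| / ‖a‖) ^ 2 := by
      rw [← sq_abs z.im]; gcongr
    have h11 : (K * |ξ| + 2 * |ρ| / ‖a‖) ^ 2 ≤
        2 * (K * |ξ|) ^ 2 + 2 * (2 * |ρ| / ‖a‖) ^ 2 := by
      have key : ∀ u v : ℝ, (u + v) ^ 2 ≤ 2 * u ^ 2 + 2 * v ^ 2 := fun u v => by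
        linarith [sq_nonneg (u - v), add_sq u v, sub_sq u v]
      exact key _ _
    have h12 : 2 * (2 * |ρ| / ‖a‖) ^ 2 ≤ 8 / ‖a‖ ^ 2 * (s * ρ) := by
      have : 2 * (2 * |ρ| / ‖a‖) ^ 2 = 8 / ‖a‖ ^ 2 * (|ρ| * |ρ|) := by ring
      rw [this, ← e9]
      gcongr
      exact mul_le_of_le_one_left (abs_nonneg ρ) h2
    have h13 : (K * |ξ|) ^ 2 = K ^ 2 * ξ ^ 2 := by
      rw [mul_pow, sq_abs]
    linarith
  have e13 : z.re + c' * ξ ^ 2 ≤ 3 / (2 * ‖a‖) * (s * ρ) := by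
    rw [div_mul_eq_mul_div, le_div_iff₀ (by positivity)]
    linarith
  have e14 : z.re ≤ 3 / (2 * ‖a‖) * (s * ρ) :=
    le_trans (le_add_of_nonneg_right (by positivity)) e13
  have e15 : ξ ^ 2 ≤ 3 / (2 * ‖a‖) * (s * ρ) / c' := by
    rw [le_div_iff₀ hc']; linarith
  have e16 : 2 * K ^ 2 * ξ ^ 2 ≤ 2 * K ^ 2 * (3 / (2 * ‖a‖) * (s * ρ) / c') := by
    gcongr
  calc z.re + z.im ^ 2 ≤ 3 / (2 * ‖a‖) * (s * ρ) +
        (2 * K ^ 2 * (3 / (2 * ‖a‖) * (s * ρ) / c') + 8 / ‖a‖ ^ 2 * (s * ρ)) := by linarith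
    _ = B * (s * ρ) := by rw [hB]; ring

/-- The critical eigenvalue `σ(κ, μ)` moves to the side of the imaginary axis given by the sign of
the group velocity, at a rate bounded below by `Re μ + (Im μ)²`: the point `μ` is compared with the
point of the dispersion curve with the same `ξ = Im σ`, which has `Re ≤ - c ξ²`. -/
theorem growth_of_simple {σ : P × ℂ → ℂ} {μ : P × ℝ → ℂ} {c : P → ℝ} {a : ℂ} (ha : a ≠ 0)
    (hκ₀ : κ₀ ∈ Q) (hσ : ContDiffAt ℝ 2 σ (κ₀, 0)) (hμ : ContDiffAt ℝ 2 μ (κ₀, 0))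
    (hσ0 : σ (κ₀, 0) = 0) (hμ0 : μ (κ₀, 0) = 0)
    (hda : ∀ δ : ℂ, HasDerivAt (fun t : ℝ => σ (κ₀, t • δ)) (δ * a) 0)
    (hz : ∀ᶠ κ in 𝓝 κ₀, κ ∈ Q → σ (κ, 0) = 0) (hc : ∀ κ ∈ Q, 0 < c κ)
    (hre : ∀ᶠ q in 𝓝 (κ₀, (0 : ℝ)), q.1 ∈ Q → (μ q).re ≤ -c q.1 * q.2 ^ 2)
    (hcurve : ∀ᶠ q in 𝓝 (κ₀, (0 : ℝ)), σ (q.1, μ q) = (q.2 : ℂ) * Complex.I) :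
    ∃ s : ℝ, ∃ b > 0, ∀ᶠ x in 𝓝 (κ₀, (0 : ℂ)), x.1 ∈ Q → 0 ≤ x.2.re →
      b * (x.2.re + x.2.im ^ 2) ≤ s * (σ x).re := by
  have hσ1 : ContDiffAt ℝ 1 σ (κ₀, 0) := hσ.of_le (by norm_num)
  have hapos : 0 < ‖a‖ := norm_pos_iff.mpr ha
  have hκ0 : Tendsto (fun κ : P => (κ, (0 : ℝ))) (𝓝 κ₀) (𝓝 (κ₀, 0)) := by
    have : ContinuousAt (fun κ : P => (κ, (0 : ℝ))) κ₀ := by fun_prop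
    exact this
  have hμlim : Tendsto μ (𝓝 (κ₀, 0)) (𝓝 0) := by
    have := hμ.continuousAt.tendsto
    rwa [hμ0] at this
  -- the curve starts at `0`
  have hμz : ∀ᶠ κ in 𝓝 κ₀, κ ∈ Q → μ (κ, 0) = 0 := by
    have h1 := eventually_sub_le hσ1 hda (tendsto_id (x := 𝓝 κ₀)) (hμlim.comp hκ0)
      (tendsto_const_nhds (x := (0 : ℂ))) (half_pos hapos)
    filter_upwards [h1, hz, hκ0.eventually hcurve] with κ h1 h2 h3 hκ
    have h3' : σ (κ, μ (κ, 0)) = 0 := by simpa using h3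
    simp only [id, Function.comp_apply, h3', h2 hκ, sub_zero, zero_sub, norm_neg, norm_mul] at h1
    by_contra h4
    have : 0 < ‖μ (κ, 0)‖ := norm_pos_iff.mpr h4
    nlinarith
  -- the group velocity `a` is real
  have hareal : a.im = 0 := by
    have hl : HasDerivAt (fun ξ : ℝ => (κ₀, ξ)) ((0 : P), (1 : ℝ)) 0 :=
      (hasDerivAt_const _ _).prodMk (hasDerivAt_id _)
    have h1 : HasDerivAt (fun ξ : ℝ => μ (κ₀, ξ)) (fderiv ℝ μ (κ₀, 0) (0, 1)) 0 := by
      have h2 := (hμ.differentiableAt (by norm_num)).hasFDerivAt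
      exact h2.comp_hasDerivAt (0 : ℝ) hl
    set μ₁ := fderiv ℝ μ (κ₀, 0) (0, 1)
    have hlim : Tendsto (fun ξ : ℝ => (κ₀, ξ)) (𝓝 0) (𝓝 (κ₀, 0)) := hl.continuousAt.tendsto
    have h3 : μ₁.re = 0 := by
      have h4 : HasDerivAt (fun ξ : ℝ => (μ (κ₀, ξ)).re) μ₁.re 0 :=
        Complex.reCLM.hasFDerivAt.comp_hasDerivAt (0 : ℝ) h1
      refine IsLocalMax.hasDerivAt_eq_zero ?_ h4
      filter_upwards [hlim.eventually hre] with ξ hξ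
      have := hξ hκ₀
      have h5 := hc κ₀ hκ₀
      rw [hμ0, Complex.zero_re]
      nlinarith [sq_nonneg ξ]
    have h6 : μ₁ * a = Complex.I := by
      have h7 : HasDerivAt (fun ξ : ℝ => (κ₀, μ (κ₀, ξ))) ((0 : P), μ₁) 0 :=
        (hasDerivAt_const _ _).prodMk h1
      have h8 : HasFDerivAt σ (fderiv ℝ σ (κ₀, 0)) (κ₀, μ (κ₀, 0)) := by
        rw [hμ0]; exact (hσ.differentiableAt (by norm_num)).hasFDerivAt
      have h9 := h8.comp_hasDerivAt (0 : ℝ) h7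
      rw [fderiv_inr_eq (hσ.differentiableAt (by norm_num)) (by simpa using hda μ₁)] at h9
      have h10 : HasDerivAt (fun ξ : ℝ => (ξ : ℂ) * Complex.I) (1 * Complex.I) 0 :=
        (Complex.ofRealCLM.hasDerivAt).mul_const _
      rw [one_mul] at h10
      refine h9.unique (h10.congr_of_eventuallyEq ?_)
      filter_upwards [hlim.eventually hcurve] with ξ hξ using hξ
    have h11 := congrArg Complex.re h6
    have h12 := congrArg Complex.im h6
    simp only [Complex.mul_re, Complex.mul_im, h3, Complex.I_re, Complex.I_im] at h11 h12
    have h13 : μ₁.im ≠ 0 := by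
      intro h; simp [h] at h12
    have : μ₁.im * a.im = 0 := by linarith
    exact (mul_eq_zero.mp this).resolve_left h13
  have ha' : a = (a.re : ℂ) := Complex.ext rfl (by simp [hareal])
  have hanorm : ‖a‖ = |a.re| := by rw [ha']; simp
  obtain ⟨s, hs1, hsa⟩ : ∃ s : ℝ, |s| = 1 ∧ s * a.re = ‖a‖ := by
    have : a.re ≠ 0 := fun h => ha (by rw [ha', h]; simp)
    rcases lt_or_gt_of_ne this with h | h
    · exact ⟨-1, by simp, by rw [hanorm, abs_of_neg h]; ring⟩
    · exact ⟨1, by simp, by rw [hanorm, abs_of_pos h]; ring⟩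
  -- the rate `c κ` may degenerate as `κ → κ₀`, but smoothness of `μ` makes the rate at `κ₀`
  -- uniform nearby
  obtain ⟨c', hc', hdis⟩ : ∃ c' > 0, ∀ᶠ q in 𝓝 (κ₀, (0 : ℝ)), q.1 ∈ Q →
      c' * q.2 ^ 2 ≤ -(μ q).re := by
    have hlim : Tendsto (fun ξ : ℝ => (κ₀, ξ)) (𝓝 0) (𝓝 (κ₀, 0)) := by
      have : ContinuousAt (fun ξ : ℝ => (κ₀, ξ)) 0 := by fun_prop
      exact this
    refine eventually_sq_le hκ₀ (d := fun q => -(μ q).re) ?_ ?_ ?_ (hc κ₀ hκ₀) ?_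
    · exact (Complex.reCLM.contDiff.contDiffAt.comp _ hμ).neg
    · filter_upwards [hre] with q hq hqQ
      have := hq hqQ
      have h1 := hc _ hqQ
      nlinarith [sq_nonneg q.2]
    · filter_upwards [hμz] with κ h hκ
      simp [h hκ]
    · filter_upwards [hlim.eventually hre] with ξ hξ
      have := hξ hκ₀
      linarith
  obtain ⟨K, t, ht, hK⟩ := (hμ.of_le (m := 1) (by norm_num)).exists_lipschitzOnWith
  set q : P × ℂ → P × ℝ := fun x => (x.1, (σ x).im) with hq
  have hqlim : Tendsto q (𝓝 (κ₀, 0)) (𝓝 (κ₀, 0)) := by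
    have : ContinuousAt q (κ₀, 0) :=
      continuousAt_fst.prodMk (Complex.continuous_im.continuousAt.comp hσ.continuousAt)
    simpa [ContinuousAt, hq, hσ0] using this
  have hfst : Tendsto (fun x : P × ℂ => x.1) (𝓝 (κ₀, 0)) (𝓝 κ₀) :=
    (continuousAt_fst (p := (κ₀, (0 : ℂ)))).tendsto
  have hsnd : Tendsto (fun x : P × ℂ => x.2) (𝓝 (κ₀, 0)) (𝓝 0) :=
    (continuousAt_snd (p := (κ₀, (0 : ℂ)))).tendsto
  have hcmp := eventually_sub_le hσ1 hda hfst hsnd (hμlim.comp hqlim)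
    (ε := ‖a‖ / 4) (by positivity)
  have hsmall : ∀ᶠ x in 𝓝 (κ₀, (0 : ℂ)), |(σ x).re| < 1 := by
    have : ContinuousAt (fun x => |(σ x).re|) (κ₀, 0) :=
      (Complex.continuous_re.continuousAt.comp hσ.continuousAt).abs
    exact this.eventually_lt continuousAt_const (by simp [hσ0])
  set B := 3 / (2 * ‖a‖) * (1 + 2 * (K : ℝ) ^ 2 / c') + 8 / ‖a‖ ^ 2 with hB
  have hBpos : 0 < B := by positivity
  refine ⟨s, B⁻¹, by positivity, ?_⟩
  filter_upwards [hcmp, hsmall, hqlim.eventually hcurve, hqlim.eventually hdis,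
    hfst.eventually hμz, hqlim ht, (hκ0.comp hfst) ht] with x h1 h2 h3 h4 h5 h6 h8 hxQ hx
  set ν := μ (q x) with hν
  refine le_of_compare (ν := ν) (ξ := (σ x).im) ha hareal hs1 hsa hc' h2.le hx ?_ ?_ ?_
  · have e1 : σ (x.1, x.2) - σ (x.1, ν) = ((σ x).re : ℂ) := by
      have : σ (x.1, ν) = ((σ x).im : ℂ) * Complex.I := h3
      rw [this]
      change σ x - _ = _
      apply Complex.ext <;> simp
    rw [← e1]; exact h1
  · exact h4 hxQ
  · have h9 := hK.dist_le_mul (q x) h6 (x.1, 0) h8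
    rw [h5 hxQ] at h9
    have h10 : dist (q x) (x.1, 0) = |(σ x).im| := by
      simp [hq, Prod.dist_eq]
    rw [h10] at h9
    simpa using h9

end Simple

section Center

variable {P E : Type} [NormedAddCommGroup P] [NormedSpace ℝ P] [FiniteDimensional ℝ P]
  [NormedAddCommGroup E] [InnerProductSpace ℂ E] [FiniteDimensional ℂ E]
  {N : P × ℂ → E →L[ℂ] E} {Q : Set P} {κ₀ : P} {e : E}

/-- The symmetrizer at a critical point with a semisimple eigenvalue. The left eigenvector `r` is
continued to nearby parameters, with `r N = σ r`. -/
theorem IsCritical.hasLocalSymmetrizer_of_simple (h : IsCritical N Q κ₀ e)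
    (he : ¬ ∃ u, N (κ₀, 0) u = e) : HasLocalSymmetrizer N Q κ₀ := by
  have : CompleteSpace P := FiniteDimensional.complete ℝ P
  obtain ⟨ρ', hρ'0, hρ'N, hρ'r, hρ'l⟩ := exists_left_null h.ne_zero h.null h.kernel
  have hρ'e : ρ' e ≠ 0 := fun h0 => he (hρ'r e h0)
  obtain ⟨ρ, hρe, hρN, hρl⟩ : ∃ ρ : E →L[ℂ] ℂ, ρ e = 1 ∧ (∀ v, ρ (N (κ₀, 0) v) = 0) ∧
      ∀ g : E →L[ℂ] ℂ, (∀ v, g (N (κ₀, 0) v) = 0) → g e = 0 → g = 0 := by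
    refine ⟨(ρ' e)⁻¹ • ρ', by simp [hρ'e], fun v => by simp [hρ'N], fun g hg hge => ?_⟩
    obtain ⟨z, rfl⟩ := hρ'l g hg
    have : z = 0 := by simpa [hρ'e] using hge
    rw [this]; ext v; simp
  have hρ0 : ρ ≠ 0 := fun h0 => by simp [h0] at hρe
  obtain ⟨a, ha, hda⟩ := h.transversal ρ hρ0 hρN
  -- the left eigenvalue equation `r N = σ r`, normalized by `r e = 1`
  let F : (P × ℂ) × ((E →L[ℂ] ℂ) × ℂ) → (E →L[ℂ] ℂ) × ℂ := fun z =>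
    (z.2.1 ∘L N z.1 - z.2.2 • z.2.1, z.2.1 e - 1)
  have hF : ContDiffAt ℝ 2 F ((κ₀, 0), (ρ, 0)) := by
    have c1 : ContDiffAt ℝ 2 (fun z : (P × ℂ) × ((E →L[ℂ] ℂ) × ℂ) => N z.1) ((κ₀, 0), (ρ, 0)) :=
      ContDiffAt.comp (g := N) _ h.smooth contDiffAt_fst
    have c2 : ContDiffAt ℝ 2 (fun z : (P × ℂ) × ((E →L[ℂ] ℂ) × ℂ) => z.2.1)
        ((κ₀, 0), (ρ, 0)) := by fun_prop
    have c3 : ContDiffAt ℝ 2 (fun z : (P × ℂ) × ((E →L[ℂ] ℂ) × ℂ) => z.2.2)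
        ((κ₀, 0), (ρ, 0)) := by fun_prop
    exact ((c2.clmComp c1).sub (c3.complexSMul c2)).prodMk
      ((c2.clmApply contDiffAt_const).sub contDiffAt_const)
  obtain ⟨φ, hφ, hφ0, hφF⟩ := exists_implicit hF
    (by
      have : ρ ∘L N (κ₀, 0) = 0 := by ext v; exact hρN v
      have h2 : (0 : ℂ) • ρ = 0 := by ext v; simp
      simp [F, hρe, this, h2]) (by
    rintro ⟨g, b⟩ hd
    have d1 : HasDerivAt (fun t : ℝ => ρ + t • g) g 0 := by
      simpa using ((hasDerivAt_id (0 : ℝ)).smul_const g).const_add ρ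
    have d2 : HasDerivAt (fun t : ℝ => t • b) b 0 := by
      simpa using ((hasDerivAt_id (0 : ℝ)).smul_const b)
    have d3 := (d1.clmComp (hasDerivAt_const (0 : ℝ) (N (κ₀, 0)))).sub (d2.complexSMul d1)
    have d4 : HasDerivAt (fun t : ℝ => (F ((κ₀, 0), (ρ, 0) + t • (g, b))).1) 0 0 :=
      (ContinuousLinearMap.fst ℝ (E →L[ℂ] ℂ) ℂ).hasFDerivAt.comp_hasDerivAt (0 : ℝ) hd
    have d5 : HasDerivAt (fun t : ℝ => (F ((κ₀, 0), (ρ, 0) + t • (g, b))).2) 0 0 :=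
      (ContinuousLinearMap.snd ℝ (E →L[ℂ] ℂ) ℂ).hasFDerivAt.comp_hasDerivAt (0 : ℝ) hd
    have e1 := d3.unique (d4.congr_of_eventuallyEq (.of_forall fun t => by simp [F]))
    have d6 := (d1.clmApply (hasDerivAt_const (0 : ℝ) e)).sub_const 1
    have e2 : g e = 0 := by
      have := d6.unique (d5.congr_of_eventuallyEq (.of_forall fun t => by simp [F]))
      simpa using this
    have e3 : ∀ v, g (N (κ₀, 0) v) = b * ρ v := by
      intro v
      have := DFunLike.congr_fun e1 v
      simp at this
      linear_combination this
    have e4 : b = 0 := by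
      have := e3 e
      rw [h.null, map_zero, hρe, mul_one] at this
      exact this.symm
    have e5 : g = 0 := hρl g (fun v => by rw [e3, e4, zero_mul]) e2
    simp [e4, e5])
  set r : P × ℂ → E →L[ℂ] ℂ := fun x => (φ x).1 with hr
  set σ : P × ℂ → ℂ := fun x => (φ x).2 with hσ
  have hrC : ContDiffAt ℝ 2 r (κ₀, 0) := hφ.fst
  have hσC : ContDiffAt ℝ 2 σ (κ₀, 0) := hφ.snd
  have hr0 : r (κ₀, 0) = ρ := by rw [hr]; simp [hφ0]
  have hσ0 : σ (κ₀, 0) = 0 := by rw [hσ]; simp [hφ0]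
  have hrN : ∀ᶠ x in 𝓝 (κ₀, (0 : ℂ)), ∀ v, r x (N x v) = σ x * r x v := by
    filter_upwards [hφF] with x hx v
    have := DFunLike.congr_fun (congrArg Prod.fst hx) v
    simpa [F, sub_eq_zero] using this
  have hre1 : ∀ᶠ x in 𝓝 (κ₀, (0 : ℂ)), r x e = 1 := by
    filter_upwards [hφF] with x hx
    exact sub_eq_zero.mp (congrArg Prod.snd hx)
  set g : P × ℂ → E →L[ℂ] E := fun x => N x - σ x • ContinuousLinearMap.id ℂ E with hg
  have hgC : ContDiffAt ℝ 2 g (κ₀, 0) := h.smooth.sub (hσC.complexSMul contDiffAt_const)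
  have hg0 : g (κ₀, 0) = N (κ₀, 0) := by rw [hg]; simp [hσ0]
  have hinj : ∀ v, r (κ₀, 0) v = 0 → g (κ₀, 0) v = 0 → v = 0 := by
    intro v h1 h2
    rw [hg0] at h2
    obtain ⟨z, rfl⟩ := h.kernel v h2
    rw [hr0, map_smul, hρe] at h1
    have : z = 0 := by simpa using h1
    rw [this, zero_smul]
  have hTg : ContinuousAt (fun x => (r x).prod (g x)) (κ₀, 0) := by
    have h1 : (fun x => (r x).prod (g x)) = fun x =>
        ContinuousLinearMap.inl ℂ ℂ E ∘L r x + ContinuousLinearMap.inr ℂ ℂ E ∘L g x := by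
      funext x; ext v <;> simp
    rw [h1]
    exact (continuousAt_const.clm_comp hrC.continuousAt).add
      (continuousAt_const.clm_comp hgC.continuousAt)
  obtain ⟨c₁, hc₁, hlow⟩ := eventually_lower_bound hTg
    (fun v hv => hinj v (congrArg Prod.fst hv) (congrArg Prod.snd hv))
  have hκ0 : Tendsto (fun κ : P => (κ, (0 : ℂ))) (𝓝 κ₀) (𝓝 (κ₀, 0)) := by
    have : ContinuousAt (fun κ : P => (κ, (0 : ℂ))) κ₀ := by fun_prop
    exact this
  -- A null vector `v` of `N (κ, 0)` has `σ r v = 0`. If `σ ≠ 0`, then `r v = 0` and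
  -- `g v = -σ v` is small compared with `v`, which contradicts the lower bound of `(r, g)`.
  have hσz : ∀ᶠ κ in 𝓝 κ₀, κ ∈ Q → σ (κ, 0) = 0 := by
    have hsm : ∀ᶠ x in 𝓝 (κ₀, (0 : ℂ)), ‖σ x‖ < c₁ :=
      hσC.continuousAt.norm.eventually_lt continuousAt_const (by simpa [hσ0] using hc₁)
    filter_upwards [h.singular, hκ0.eventually hlow, hκ0.eventually hsm, hκ0.eventually hrN]
      with κ h1 h2 h3 h4 hκ
    obtain ⟨v, hv0, hv⟩ := h1 hκ
    by_contra h5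
    have h6 : r (κ, 0) v = 0 := by
      have := h4 v
      rw [hv, map_zero] at this
      exact (mul_eq_zero.mp this.symm).resolve_left h5
    have h7 := h2 v
    have h8 : ((r (κ, 0)).prod (g (κ, 0))) v = (0, -(σ (κ, 0) • v)) := by
      simp [h6, hg, hv]
    have hvpos : 0 < ‖v‖ := norm_pos_iff.mpr hv0
    rw [h8] at h7
    simp only [Prod.norm_mk, norm_zero, norm_neg, norm_smul] at h7
    rw [max_eq_right (by positivity)] at h7
    nlinarith
  obtain ⟨V, μ, c, hV, hμ, hV0, hμ0, hc, hcurve, hre⟩ := h.exists_dispersion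
  have hx0 : Tendsto (fun q : P × ℝ => (q.1, μ q)) (𝓝 (κ₀, 0)) (𝓝 (κ₀, 0)) := by
    have : ContinuousAt (fun q : P × ℝ => (q.1, μ q)) (κ₀, 0) :=
      continuousAt_fst.prodMk hμ.continuousAt
    simpa [ContinuousAt, hμ0] using this
  -- apply `r N = σ r` to the eigenvector `V` of `N` on the dispersion curve
  have hσcurve : ∀ᶠ q in 𝓝 (κ₀, (0 : ℝ)), σ (q.1, μ q) = (q.2 : ℂ) * Complex.I := by
    have h1 : ∀ᶠ q in 𝓝 (κ₀, (0 : ℝ)), r (q.1, μ q) (V q) ≠ 0 := by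
      have h2 : ContinuousAt (fun q : P × ℝ => r (q.1, μ q)) (κ₀, 0) := by
        have := hrC.continuousAt.tendsto.comp hx0
        simpa [ContinuousAt, Function.comp_def, hμ0] using this
      have h3 : ContinuousAt (fun q : P × ℝ => r (q.1, μ q) (V q)) (κ₀, 0) :=
        h2.clm_apply hV.continuousAt
      refine h3.eventually_ne ?_
      simp [hμ0, hV0, hr0, hρe]
    filter_upwards [h1, hx0.eventually hrN, hcurve] with q h1 h2 h3
    have := h2 (V q)
    rw [h3, map_smul, smul_eq_mul] at this
    exact (mul_right_cancel₀ h1 this).symm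
  -- `σ = r (N e)` by the normalization, and `e` is a null vector of `N` at the base point
  have hdσ : ∀ δ : ℂ, HasDerivAt (fun t : ℝ => σ (κ₀, t • δ)) (δ * a) 0 := by
    intro δ
    obtain ⟨N', hN'⟩ := h.hasDerivAt_line δ
    have hl : HasDerivAt (fun t : ℝ => (κ₀, t • δ)) ((0 : P), δ) 0 := by
      refine (hasDerivAt_const _ _).prodMk ?_
      simpa using ((hasDerivAt_id (0 : ℝ)).smul_const δ)
    have h1 : HasFDerivAt r (fderiv ℝ r (κ₀, 0)) (κ₀, (0 : ℝ) • δ) := by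
      simpa using (hrC.differentiableAt (by norm_num)).hasFDerivAt
    have h2 := h1.comp_hasDerivAt (0 : ℝ) hl
    have h3 := h2.clmApply (hN'.clmApply (hasDerivAt_const (0 : ℝ) e))
    have h4 : ρ (N' e) = δ * a := by
      have := (hasDerivAt_const (0 : ℝ) ρ).clmApply
        (hN'.clmApply (hasDerivAt_const (0 : ℝ) e))
      simpa using this.unique (hda δ)
    have h5 : HasDerivAt (fun t : ℝ => r (κ₀, t • δ) (N (κ₀, t • δ) e)) (δ * a) 0 := by
      refine h3.congr_deriv ?_
      simp [hr0, h.null, h4]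
    refine h5.congr_of_eventuallyEq ?_
    have h6 : Tendsto (fun t : ℝ => (κ₀, t • δ)) (𝓝 0) (𝓝 (κ₀, 0)) := by
      have := hl.continuousAt.tendsto
      simpa using this
    filter_upwards [h6.eventually hrN, h6.eventually hre1] with t h7 h8
    rw [h7, h8, mul_one]
  obtain ⟨s, b, hb, hgrow⟩ :=
    growth_of_simple ha h.mem hσC hμ hσ0 hμ0 hdσ hσz hc hre hσcurve
  -- `N + e ⊗ r` is hyperbolic: it has the eigenvalue `1` in place of the critical one
  refine hasLocalSymmetrizer_of_center (C := fun x => (s : ℂ) • outer (r x) (r x)) (g := g)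
    (A := fun x => N x + (r x).smulRight e) (T := r) ?_ ?_ (hgC.of_le (by norm_num)) ?_ ?_ ?_ ?_
    hrC.continuousAt hinj hb ?_
  · exact contDiffAt_const.complexSMul ((hrC.outer hrC).of_le (by norm_num))
  · intro x
    refine IsSelfAdjoint.smul (by simp [IsSelfAdjoint]) ?_
    rw [IsSelfAdjoint, star_outer]
  · intro x v
    simp [hg]
  · refine h.smooth.continuousAt.add ?_
    have h1 : (fun x => (r x).smulRight e) = fun x =>
        (ContinuousLinearMap.toSpanSingleton ℂ e) ∘L r x := by
      funext x; ext v; simp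
    rw [h1]
    exact continuousAt_const.clm_comp hrC.continuousAt
  · intro t v hv
    simp only [add_apply, ContinuousLinearMap.smulRight_apply, hr0] at hv
    have h1 : ρ v = 0 := by
      have := congrArg ρ hv
      rw [map_add, hρN, map_smul, map_smul, hρe] at this
      simp only [smul_eq_mul, mul_one, zero_add] at this
      have h2 : (1 - (t : ℂ) * Complex.I) * ρ v = 0 := by linear_combination this
      refine (mul_eq_zero.mp h2).resolve_left ?_
      intro h3
      have := congrArg Complex.re h3
      simp at this
    rw [h1, zero_smul, add_zero] at hv
    rcases h.no_other t v hv with rfl | h2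
    · exact hinj v (by rw [hr0, h1]) (by rw [hg0, hv]; simp)
    · exact h2
  · filter_upwards [hrN] with x hx v
    have : r x (g x v) = 0 := by simp [hg, hx]
    simp [this]
  · filter_upwards [hgrow, hrN] with x h1 h2 hxQ hx v
    have h3 : (⟪v, ((s : ℂ) • outer (r x) (r x)) (N x v)⟫_ℂ).re =
        s * (σ x).re * ‖r x v‖ ^ 2 := by
      rw [_root_.smul_apply, inner_smul_right, inner_outer, h2]
      have : (s : ℂ) * ((starRingEnd ℂ) (r x v) * (σ x * r x v)) =
          ((s * ‖r x v‖ ^ 2 : ℝ) : ℂ) * σ x := by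
        have h4 := Complex.conj_mul' (r x v)
        push_cast
        linear_combination (s : ℂ) * σ x * h4
      rw [this, Complex.re_ofReal_mul]
      ring
    rw [h3]
    exact mul_le_mul_of_nonneg_right (h1 hxQ hx) (by positivity)

end Center

/-! ### The critical eigenvalue is a Jordan block -/

section Block

/-- The coercivity estimate for the block `X' = Y`, `Y' = α X + β Y` with
`b α = p B + i t + O(p² + t²)` and `b β = -ϑ + O(p + |t|)`, in terms of the derivative of
`Re (b (1 - iKt) Y X̄) + ϑ |X|² / 2`. The term with `ϑ` removes the main part of `β`; the one with
the large constant `K` produces `t² |X|²`, of which there is no trace in `Re (b α)`. -/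
theorem block_coercive {b α β B X Y : ℂ} {p t ϑ C₁ C₂ m K : ℝ} (hp : 0 ≤ p) (hm : 0 < m)
    (hC₁ : 0 ≤ C₁) (hC₂ : 0 ≤ C₂) (hK : K = C₁ + 2 * (C₂ + 1) ^ 2 / m + 2)
    (hα : ‖b * α - (p * B + t * Complex.I)‖ ≤ C₁ * (p ^ 2 + t ^ 2))
    (hB : 3 / 4 ≤ B.re) (hB' : ‖B‖ ≤ 2)
    (hβ : ‖b * β + ϑ‖ ≤ C₂ * (p + |t|)) (hKβ : K * ‖b * β‖ ≤ 1)
    (hb : m ≤ b.re - K * |t| * ‖b‖)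
    (s1 : C₁ * p ≤ 1 / 16) (s2 : 2 * K * |t| ≤ 1 / 16) (s3 : K * |t| * C₁ * p ≤ 1 / 16)
    (s4 : K * |t| * C₁ ≤ 1 / 2) (s5 : 2 * C₂ ^ 2 * p / m ≤ 1 / 16) :
    (p + t ^ 2) / 2 * ‖X‖ ^ 2 + m / 2 * ‖Y‖ ^ 2 ≤
      (starRingEnd ℂ X * (b * (1 - K * t * Complex.I) * (α * X + β * Y)) +
        starRingEnd ℂ (b * (1 - K * t * Complex.I) * Y) * Y + ϑ * (starRingEnd ℂ X * Y)).re := by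
  have hKpos : 0 ≤ K := by rw [hK]; positivity
  set R := b * α - (p * B + t * Complex.I) with hR
  set S := b * β + ϑ with hS
  -- the diagonal terms and the coupling of `X` and `Y`
  have e1 : (starRingEnd ℂ X * (b * (1 - K * t * Complex.I) * (α * X + β * Y)) +
        starRingEnd ℂ (b * (1 - K * t * Complex.I) * Y) * Y + ϑ * (starRingEnd ℂ X * Y)).re =
      ‖X‖ ^ 2 * ((b * α).re + K * t * (b * α).im) + ‖Y‖ ^ 2 * (b.re + K * t * b.im) +
        ((S - K * t * Complex.I * (b * β)) * (starRingEnd ℂ X * Y)).re := by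
    have hX := Complex.conj_mul' X
    have hY := Complex.conj_mul' Y
    have h1 : starRingEnd ℂ X * (b * (1 - K * t * Complex.I) * (α * X + β * Y)) +
        starRingEnd ℂ (b * (1 - K * t * Complex.I) * Y) * Y + ϑ * (starRingEnd ℂ X * Y) =
        ((‖X‖ ^ 2 : ℝ) : ℂ) * (b * α * (1 - ((K * t : ℝ) : ℂ) * Complex.I)) +
        ((‖Y‖ ^ 2 : ℝ) : ℂ) * (starRingEnd ℂ (b * (1 - ((K * t : ℝ) : ℂ) * Complex.I))) +
        (S - K * t * Complex.I * (b * β)) * (starRingEnd ℂ X * Y) := by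
      rw [hS]
      push_cast
      rw [map_mul (starRingEnd ℂ) (b * (1 - K * t * Complex.I)) Y]
      linear_combination (b * α * (1 - K * t * Complex.I)) * hX +
        (starRingEnd ℂ (b * (1 - K * t * Complex.I))) * hY
    rw [h1, Complex.add_re, Complex.add_re, Complex.re_ofReal_mul, Complex.re_ofReal_mul,
      Complex.conj_re]
    congr 3
    · simp [Complex.mul_re]; ring
    · simp [Complex.mul_re]; ring
  rw [e1]
  have e2 : b * α = p * B + t * Complex.I + R := by rw [hR]; ring
  have hRre := neg_le_of_abs_le ((Complex.abs_re_le_norm R).trans hα)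
  have hRim := (Complex.abs_im_le_norm R).trans hα
  have hαre : (b * α).re = p * B.re + R.re := by rw [e2]; simp
  have hαim : (b * α).im = p * B.im + t + R.im := by rw [e2]; simp
  have hBim := (Complex.abs_im_le_norm B).trans hB'
  have ht0 := abs_nonneg t
  have htsq : |t| * |t| = t ^ 2 := by rw [← sq, sq_abs]
  -- `Re (bα)` contributes `p |X|²`, and `K t Im (bα)` contributes `K t² |X|²`
  have f1 : p * (9 / 16) + t ^ 2 * (K - C₁ - 1 / 2) ≤ (b * α).re + K * t * (b * α).im := by
    have g1 : -(K * |t| * (p * 2)) ≤ K * t * (p * B.im) := by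
      refine neg_le_of_abs_le ?_
      rw [abs_mul, abs_mul, abs_mul, abs_of_nonneg hKpos, abs_of_nonneg hp]
      gcongr
    have g2 : -(K * |t| * (C₁ * (p ^ 2 + t ^ 2))) ≤ K * t * R.im := by
      refine neg_le_of_abs_le ?_
      rw [abs_mul, abs_mul, abs_of_nonneg hKpos]
      gcongr
    have g3 : 2 * K * |t| * p ≤ 1 / 16 * p := mul_le_mul_of_nonneg_right s2 hp
    have g4 : K * |t| * C₁ * p * p ≤ 1 / 16 * p := mul_le_mul_of_nonneg_right s3 hp
    have g5 : K * |t| * C₁ * t ^ 2 ≤ 1 / 2 * t ^ 2 :=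
      mul_le_mul_of_nonneg_right s4 (sq_nonneg t)
    have g6 : C₁ * p * p ≤ 1 / 16 * p := mul_le_mul_of_nonneg_right s1 hp
    have g7 : p * (3 / 4) ≤ p * B.re := mul_le_mul_of_nonneg_left hB hp
    rw [hαre, hαim]
    linarith
  have f2 : m ≤ b.re + K * t * b.im := by
    have g1 : -(K * |t| * ‖b‖) ≤ K * t * b.im := by
      refine neg_le_of_abs_le ?_
      rw [abs_mul, abs_mul, abs_of_nonneg hKpos]
      gcongr
      exact Complex.abs_im_le_norm b
    linarith
  -- in the coupling term, the real constant `ϑ` has cancelled the main part of `bβ`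
  have f3 : -((C₂ * p + (C₂ + 1) * |t|) * (‖X‖ * ‖Y‖)) ≤
      ((S - K * t * Complex.I * (b * β)) * (starRingEnd ℂ X * Y)).re := by
    refine neg_le_of_abs_le ((Complex.abs_re_le_norm _).trans ?_)
    rw [norm_mul, norm_mul, RCLike.norm_conj]
    gcongr
    have g1 : ‖(K : ℂ) * t * Complex.I * (b * β)‖ ≤ |t| := by
      rw [norm_mul, norm_mul, norm_mul, Complex.norm_real, Complex.norm_real, Complex.norm_I,
        Real.norm_of_nonneg hKpos, Real.norm_eq_abs]
      have := mul_le_mul_of_nonneg_left hKβ ht0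
      linarith
    have := norm_sub_le S ((K : ℂ) * t * Complex.I * (b * β))
    linarith
  set u := C₂ * p + (C₂ + 1) * |t| with hu
  have f4 : u * (‖X‖ * ‖Y‖) ≤ m / 4 * ‖Y‖ ^ 2 + u ^ 2 / m * ‖X‖ ^ 2 := by
    have : m / 4 * ‖Y‖ ^ 2 + u ^ 2 / m * ‖X‖ ^ 2 - u * (‖X‖ * ‖Y‖) =
        (m / 2 * ‖Y‖ - u * ‖X‖) ^ 2 / m := by field_simp; ring
    have h0 : 0 ≤ (m / 2 * ‖Y‖ - u * ‖X‖) ^ 2 / m := by positivity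
    linarith
  have f5 : u ^ 2 / m ≤ p / 16 + 2 * (C₂ + 1) ^ 2 / m * t ^ 2 := by
    have g1 : u ^ 2 ≤ 2 * (C₂ * p) ^ 2 + 2 * ((C₂ + 1) * |t|) ^ 2 := by
      linarith [sq_nonneg (C₂ * p - (C₂ + 1) * |t|), add_sq (C₂ * p) ((C₂ + 1) * |t|),
        sub_sq (C₂ * p) ((C₂ + 1) * |t|)]
    have g2 : u ^ 2 / m ≤ (2 * (C₂ * p) ^ 2 + 2 * ((C₂ + 1) * |t|) ^ 2) / m := by gcongr
    have g3 : (2 * (C₂ * p) ^ 2 + 2 * ((C₂ + 1) * |t|) ^ 2) / m =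
        2 * C₂ ^ 2 * p / m * p + 2 * (C₂ + 1) ^ 2 / m * t ^ 2 := by
      rw [mul_pow _ |t|, sq_abs]; ring
    have g4 : 2 * C₂ ^ 2 * p / m * p ≤ 1 / 16 * p := mul_le_mul_of_nonneg_right s5 hp
    linarith
  have f6 := mul_le_mul_of_nonneg_left f1 (sq_nonneg ‖X‖)
  have f7 := mul_le_mul_of_nonneg_left f2 (sq_nonneg ‖Y‖)
  have f8 := mul_le_mul_of_nonneg_right f5 (sq_nonneg ‖X‖)
  have f9 : K - C₁ - 1 / 2 = 2 * (C₂ + 1) ^ 2 / m + 3 / 2 := by rw [hK]; ring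
  rw [f9] at f6
  have f10 : 0 ≤ m * ‖Y‖ ^ 2 := by positivity
  have f11 : 0 ≤ t ^ 2 * ‖X‖ ^ 2 := by positivity
  linarith

end Block

section Taylor

variable {P : Type} [NormedAddCommGroup P] [NormedSpace ℝ P] {κ₀ : P}

/-- A second-order Taylor estimate in the spectral parameter, uniform in the other parameters. -/
theorem eventually_taylor {F : P × ℂ → ℂ} (hF : ContDiffAt ℝ 2 F (κ₀, 0)) :
    ∃ C : ℝ, 0 ≤ C ∧ ∀ᶠ x in 𝓝 (κ₀, (0 : ℂ)),
      ‖F x - F (x.1, 0) - fderiv ℝ F (x.1, 0) (0, x.2)‖ ≤ C * ‖x.2‖ ^ 2 := by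
  obtain ⟨C, s, hs, hC⟩ := (hF.fderiv_right (m := 1) (by norm_num)).exists_lipschitzOnWith
  have hdiff : ∀ᶠ x in 𝓝 (κ₀, (0 : ℂ)), DifferentiableAt ℝ F x :=
    (hF.eventually (by simp)).mono fun x hx => hx.differentiableAt (by norm_num)
  obtain ⟨δ, hδ, hball⟩ := Metric.eventually_nhds_iff_ball.mp (hdiff.and hs)
  refine ⟨C, C.2, ?_⟩
  filter_upwards [Metric.ball_mem_nhds _ hδ] with x hx
  have hx0 : (x.1, (0 : ℂ)) ∈ Metric.ball (κ₀, (0 : ℂ)) δ := by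
    rw [Metric.mem_ball, Prod.dist_eq] at hx ⊢
    simpa using (le_max_left _ _).trans_lt hx
  have hseg : segment ℝ (x.1, (0 : ℂ)) x ⊆ Metric.ball (κ₀, (0 : ℂ)) δ :=
    (convex_ball _ _).segment_subset hx0 hx
  have hd : x - (x.1, (0 : ℂ)) = (0, x.2) := by ext <;> simp
  have hnorm : ‖x - (x.1, (0 : ℂ))‖ = ‖x.2‖ := by rw [hd]; simp [Prod.norm_def]
  have := (convex_segment (𝕜 := ℝ) (x.1, (0 : ℂ)) x).norm_image_sub_le_of_norm_hasFDerivWithin_le'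
    (f := F) (f' := fderiv ℝ F) (φ := fderiv ℝ F (x.1, 0)) (C := C * ‖x.2‖)
    (fun z hz => (hball z (hseg hz)).1.hasFDerivAt.hasFDerivWithinAt) (fun z hz => by
      have h1 := hC.dist_le_mul z (hball z (hseg hz)).2 _ (hball _ hx0).2
      rw [dist_eq_norm, dist_eq_norm] at h1
      refine h1.trans ?_
      gcongr
      rw [← hnorm]
      obtain ⟨a, b, ha, hb, hab, rfl⟩ := hz
      have h2 : a • (x.1, (0 : ℂ)) + b • x - (x.1, (0 : ℂ)) = b • (x - (x.1, (0 : ℂ))) := by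
        rw [smul_sub, show a = 1 - b by linarith, sub_smul, one_smul]; abel
      rw [h2, norm_smul, Real.norm_of_nonneg hb]
      exact mul_le_of_le_one_left (norm_nonneg _) (by linarith))
    (left_mem_segment ℝ _ _) (right_mem_segment ℝ _ _)
  rw [hnorm, hd] at this
  linarith

/-- A Lipschitz estimate in the spectral parameter, uniform in the other parameters. -/
theorem eventually_lipschitz {F : P × ℂ → ℂ} (hF : ContDiffAt ℝ 1 F (κ₀, 0)) :
    ∃ C : ℝ, 0 ≤ C ∧ ∀ᶠ x in 𝓝 (κ₀, (0 : ℂ)), ‖F x - F (x.1, 0)‖ ≤ C * ‖x.2‖ := by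
  obtain ⟨C, s, hs, hC⟩ := hF.exists_lipschitzOnWith
  have h0 : Tendsto (fun x : P × ℂ => (x.1, (0 : ℂ))) (𝓝 (κ₀, 0)) (𝓝 (κ₀, 0)) := by
    have : ContinuousAt (fun x : P × ℂ => (x.1, (0 : ℂ))) (κ₀, 0) := by fun_prop
    exact this
  refine ⟨C, C.2, ?_⟩
  filter_upwards [hs, h0 hs] with x hx hx0
  have := hC.dist_le_mul x hx _ hx0
  have hd : x - (x.1, (0 : ℂ)) = (0, x.2) := by ext <;> simp
  rw [dist_eq_norm, dist_eq_norm, hd] at this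
  simpa [Prod.norm_def] using this

/-- At a Jordan block the linear coefficient `β(κ, 0)` of the characteristic equation
`σ² = β σ + α` is real, up to the normalizing factor `b = i / ∂_μ α(κ, 0)[i]`: the dispersion curve
is tangent to the imaginary axis. -/
theorem eventually_real_drift {Q : Set P} {α β : P × ℂ → ℂ} {μ : P × ℝ → ℂ} {c : P → ℝ} {a : ℂ}
    (ha : a ≠ 0) (hα : ContDiffAt ℝ 2 α (κ₀, 0)) (hβ : ContDiffAt ℝ 2 β (κ₀, 0))
    (hμ : ContDiffAt ℝ 2 μ (κ₀, 0)) (hμ0 : μ (κ₀, 0) = 0)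
    (hda : ∀ δ : ℂ, HasDerivAt (fun t : ℝ => α (κ₀, t • δ)) (δ * a) 0)
    (hz : ∀ᶠ κ in 𝓝 κ₀, κ ∈ Q → α (κ, 0) = 0) (hc : ∀ κ ∈ Q, 0 < c κ)
    (hre : ∀ᶠ q in 𝓝 (κ₀, (0 : ℝ)), q.1 ∈ Q → (μ q).re ≤ -c q.1 * q.2 ^ 2)
    (hcurve : ∀ᶠ q in 𝓝 (κ₀, (0 : ℝ)), α (q.1, μ q) + (q.2 : ℂ) * Complex.I * β (q.1, μ q) =
      -(q.2 : ℂ) ^ 2) :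
    ∀ᶠ κ in 𝓝 κ₀, κ ∈ Q →
      (Complex.I / fderiv ℝ α (κ, 0) (0, Complex.I) * β (κ, 0)).im = 0 := by
  have hκ0 : Tendsto (fun κ : P => (κ, (0 : ℝ))) (𝓝 κ₀) (𝓝 (κ₀, 0)) := by
    have : ContinuousAt (fun κ : P => (κ, (0 : ℝ))) κ₀ := by fun_prop
    exact this
  have hκ0' : Tendsto (fun κ : P => (κ, (0 : ℂ))) (𝓝 κ₀) (𝓝 (κ₀, 0)) := by
    have : ContinuousAt (fun κ : P => (κ, (0 : ℂ))) κ₀ := by fun_prop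
    exact this
  have hμlim : Tendsto μ (𝓝 (κ₀, 0)) (𝓝 0) := by
    have := hμ.continuousAt.tendsto
    rwa [hμ0] at this
  -- the dispersion curve starts at `0`
  have hμz : ∀ᶠ κ in 𝓝 κ₀, κ ∈ Q → μ (κ, 0) = 0 := by
    have hapos : 0 < ‖a‖ := norm_pos_iff.mpr ha
    have h1 := eventually_sub_le (hα.of_le (by norm_num)) hda (tendsto_id (x := 𝓝 κ₀))
      (hμlim.comp hκ0) (tendsto_const_nhds (x := (0 : ℂ))) (half_pos hapos)
    filter_upwards [h1, hz, hκ0.eventually hcurve] with κ h1 h2 h3 hκ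
    have h3' : α (κ, μ (κ, 0)) = 0 := by simpa using h3
    simp only [id, Function.comp_apply, h3', h2 hκ, sub_zero, zero_sub, norm_neg, norm_mul] at h1
    by_contra h4
    have : 0 < ‖μ (κ, 0)‖ := norm_pos_iff.mpr h4
    nlinarith
  have hA0 : ∀ᶠ κ in 𝓝 κ₀, fderiv ℝ α (κ, 0) (0, Complex.I) ≠ 0 := by
    have h1 : ContinuousAt (fun x => fderiv ℝ α x (0, Complex.I)) (κ₀, 0) :=
      ((hα.fderiv_right (m := 1) (by norm_num)).clm_apply contDiffAt_const).continuousAt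
    refine hκ0'.eventually (h1.eventually_ne ?_)
    rw [fderiv_inr_eq (hα.differentiableAt (by norm_num)) (by simpa using hda Complex.I)]
    simp [ha]
  have hdα : ∀ᶠ x in 𝓝 (κ₀, (0 : ℂ)), DifferentiableAt ℝ α x :=
    (hα.eventually (by simp)).mono fun x hx => hx.differentiableAt (by norm_num)
  have hdβ : ∀ᶠ x in 𝓝 (κ₀, (0 : ℂ)), DifferentiableAt ℝ β x :=
    (hβ.eventually (by simp)).mono fun x hx => hx.differentiableAt (by norm_num)
  have hdμ : ∀ᶠ x in 𝓝 (κ₀, (0 : ℝ)), DifferentiableAt ℝ μ x :=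
    (hμ.eventually (by simp)).mono fun x hx => hx.differentiableAt (by norm_num)
  filter_upwards [hμz, hA0, hκ0'.eventually hdα, hκ0'.eventually hdβ, hκ0.eventually hdμ,
    hκ0.eventually hre.eventually_nhds, hκ0.eventually hcurve.eventually_nhds]
    with κ h1 h2 h3 h4 h5 h6 h7 hκ
  have hl : HasDerivAt (fun ξ : ℝ => (κ, ξ)) ((0 : P), (1 : ℝ)) 0 :=
    (hasDerivAt_const _ _).prodMk (hasDerivAt_id _)
  have hlim : Tendsto (fun ξ : ℝ => (κ, ξ)) (𝓝 0) (𝓝 (κ, 0)) := hl.continuousAt.tendsto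
  have hμ' : HasDerivAt (fun ξ : ℝ => μ (κ, ξ)) (fderiv ℝ μ (κ, 0) (0, 1)) 0 :=
    h5.hasFDerivAt.comp_hasDerivAt (0 : ℝ) hl
  set μ₁ := fderiv ℝ μ (κ, 0) (0, 1) with hμ₁
  -- `Re μ (κ, ·)` has a maximum at `ξ = 0`
  have hμ₁re : μ₁.re = 0 := by
    have h8 : HasDerivAt (fun ξ : ℝ => (μ (κ, ξ)).re) μ₁.re 0 :=
      Complex.reCLM.hasFDerivAt.comp_hasDerivAt (0 : ℝ) hμ'
    refine IsLocalMax.hasDerivAt_eq_zero ?_ h8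
    filter_upwards [hlim.eventually h6] with ξ hξ
    have := hξ hκ
    have h9 := hc κ hκ
    rw [h1 hκ, Complex.zero_re]
    nlinarith [sq_nonneg ξ]
  have hx : HasDerivAt (fun ξ : ℝ => (κ, μ (κ, ξ))) ((0 : P), μ₁) 0 :=
    (hasDerivAt_const _ _).prodMk hμ'
  have h8 : HasFDerivAt α (fderiv ℝ α (κ, 0)) (κ, μ (κ, 0)) := by
    rw [h1 hκ]; exact h3.hasFDerivAt
  have h9 : HasFDerivAt β (fderiv ℝ β (κ, 0)) (κ, μ (κ, 0)) := by
    rw [h1 hκ]; exact h4.hasFDerivAt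
  have h10 : HasDerivAt (fun ξ : ℝ => α (κ, μ (κ, ξ))) (fderiv ℝ α (κ, 0) (0, μ₁)) 0 :=
    h8.comp_hasDerivAt (0 : ℝ) hx
  have h11 : HasDerivAt (fun ξ : ℝ => β (κ, μ (κ, ξ))) (fderiv ℝ β (κ, 0) (0, μ₁)) 0 :=
    h9.comp_hasDerivAt (0 : ℝ) hx
  have h12 : HasDerivAt (fun ξ : ℝ => (ξ : ℂ) * Complex.I) (1 * Complex.I) 0 :=
    (Complex.ofRealCLM.hasDerivAt).mul_const _
  have h13 := h10.add (h12.mul h11)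
  have h14 : HasDerivAt (fun ξ : ℝ => -(ξ : ℂ) ^ 2) 0 0 := by
    have h15 : HasDerivAt (fun ξ : ℝ => (ξ : ℂ)) 1 0 := Complex.ofRealCLM.hasDerivAt
    have := (h15.mul h15).neg
    refine (this.congr_deriv (by simp)).congr_of_eventuallyEq (.of_forall fun ξ => ?_)
    simp [sq]
  -- the `ξ`-derivative of the characteristic equation at `ξ = 0`
  have h16 : fderiv ℝ α (κ, 0) (0, μ₁) + Complex.I * β (κ, 0) = 0 := by
    have := h13.unique (h14.congr_of_eventuallyEq (by
      filter_upwards [hlim.eventually h7] with ξ hξ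
      exact hξ))
    simpa [h1 hκ] using this
  have h17 : fderiv ℝ α (κ, 0) (0, μ₁) =
      (μ₁.im : ℂ) * fderiv ℝ α (κ, 0) (0, Complex.I) := by
    have : ((0 : P), μ₁) = μ₁.im • ((0 : P), Complex.I) := by
      ext
      · simp
      · apply Complex.ext <;> simp [hμ₁re]
    rw [this, map_smul, Complex.real_smul]
  rw [h17] at h16
  have h18 : Complex.I / fderiv ℝ α (κ, 0) (0, Complex.I) * β (κ, 0) = ((-μ₁.im : ℝ) : ℂ) := by
    rw [div_mul_eq_mul_div, div_eq_iff h2]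
    push_cast
    linear_combination h16
  rw [h18, Complex.ofReal_im]

end Taylor

section Center

variable {P E : Type} [NormedAddCommGroup P] [NormedSpace ℝ P] [FiniteDimensional ℝ P]
  [NormedAddCommGroup E] [InnerProductSpace ℂ E] [FiniteDimensional ℂ E]
  {N : P × ℂ → E →L[ℂ] E} {Q : Set P} {κ₀ : P} {e : E}

/-- A Jordan block of length three is incompatible with dissipation. -/
theorem IsCritical.not_exists_chain (h : IsCritical N Q κ₀ e) {e₂ e₃ : E}
    (h₂ : N (κ₀, 0) e₂ = e) (h₃ : N (κ₀, 0) e₃ = e₂) : False := by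
  obtain ⟨ρ, hρ0, hρN, -, -⟩ := exists_left_null h.ne_zero h.null h.kernel
  obtain ⟨a, ha, hda⟩ := h.transversal ρ hρ0 hρN
  obtain ⟨r, hr⟩ := exists_factor (A := N (κ₀, 0)) (ρ := ρ) (by
    intro v hv
    obtain ⟨z, rfl⟩ := h.kernel v hv
    rw [map_smul, ← h₂, hρN, smul_zero])
  have h1 := h.re_pos ha hρN hr hda
  have h2 : r e = 0 := by rw [← h₂, hr, ← h₃, hρN]
  simp [h2] at h1

/-- Left and right Jordan chains at a critical point that is not semisimple. -/
theorem IsCritical.exists_jordan (h : IsCritical N Q κ₀ e) {e₂ : E} (h₂ : N (κ₀, 0) e₂ = e) :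
    ∃ (r : E →L[ℂ] ℂ) (a : ℂ), a ≠ 0 ∧ r e = 1 ∧ r e₂ = 0 ∧
      (∀ v, r (N (κ₀, 0) (N (κ₀, 0) v)) = 0) ∧
      (∀ g : E →L[ℂ] ℂ, (∀ v, g (N (κ₀, 0) v) = 0) → g e₂ = 0 → g = 0) ∧
      (∀ δ : ℂ, HasDerivAt (fun t : ℝ => r (N (κ₀, 0) (N (κ₀, t • δ) e))) (δ * a) 0) ∧
      0 < (1 / a).re := by
  obtain ⟨ρ', hρ'0, hρ'N, hρ'r, hρ'l⟩ := exists_left_null h.ne_zero h.null h.kernel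
  have hρ'e₂ : ρ' e₂ ≠ 0 := fun h0 => by
    obtain ⟨e₃, h₃⟩ := hρ'r e₂ h0
    exact h.not_exists_chain h₂ h₃
  set ρ := (ρ' e₂)⁻¹ • ρ' with hρ
  have hρN : ∀ v, ρ (N (κ₀, 0) v) = 0 := fun v => by simp [hρ, hρ'N]
  have hρe₂ : ρ e₂ = 1 := by simp [hρ, hρ'e₂]
  have hρe : ρ e = 0 := by rw [← h₂, hρN]
  have hρ0 : ρ ≠ 0 := fun h0 => by simp [h0] at hρe₂
  obtain ⟨a, ha, hda⟩ := h.transversal ρ hρ0 hρN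
  obtain ⟨r', hr'⟩ := exists_factor (A := N (κ₀, 0)) (ρ := ρ) (by
    intro v hv
    obtain ⟨z, rfl⟩ := h.kernel v hv
    rw [map_smul, hρe, smul_zero])
  have hr'e : r' e = 1 := by rw [← h₂, hr', hρe₂]
  have hrN : ∀ v, (r' - r' e₂ • ρ) (N (κ₀, 0) v) = ρ v := fun v => by
    simp [hr', hρN]
  refine ⟨r' - r' e₂ • ρ, a, ha, by simp [hr'e, hρe], by simp [hρe₂], fun v => by
    rw [hrN, hρN], ?_, fun δ => by simpa only [hrN] using hda δ, ?_⟩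
  · intro g hg hg2
    obtain ⟨z, rfl⟩ := hρ'l g hg
    have : z = 0 := by simpa [hρ'e₂] using hg2
    rw [this]; ext v; simp
  · have := h.re_pos ha hρN hr' hda
    rwa [hr'e] at this

/-- Continuation of a Jordan block: a functional `r` whose orbit under `N` spans an invariant plane,
`r N² = α r + β r N`. -/
theorem IsCritical.exists_companion (h : IsCritical N Q κ₀ e) {e₂ : E}
    (h₂ : N (κ₀, 0) e₂ = e) {ρ : E →L[ℂ] ℂ} (hρe : ρ e = 1) (hρe₂ : ρ e₂ = 0)
    (hρN : ∀ v, ρ (N (κ₀, 0) (N (κ₀, 0) v)) = 0)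
    (hρl : ∀ g : E →L[ℂ] ℂ, (∀ v, g (N (κ₀, 0) v) = 0) → g e₂ = 0 → g = 0) :
    ∃ (r : P × ℂ → E →L[ℂ] ℂ) (α β : P × ℂ → ℂ), ContDiffAt ℝ 2 r (κ₀, 0) ∧
      ContDiffAt ℝ 2 α (κ₀, 0) ∧ ContDiffAt ℝ 2 β (κ₀, 0) ∧ r (κ₀, 0) = ρ ∧ α (κ₀, 0) = 0 ∧
      β (κ₀, 0) = 0 ∧ (∀ᶠ x in 𝓝 (κ₀, (0 : ℂ)), r x e = 1) ∧
      ∀ᶠ x in 𝓝 (κ₀, (0 : ℂ)), ∀ v, r x (N x (N x v)) = α x * r x v + β x * r x (N x v) := by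
  have : CompleteSpace P := FiniteDimensional.complete ℝ P
  -- the equation `r N² = α r + β r N`, normalized by `r e = 1`, `r e₂ = 0`
  let F : (P × ℂ) × ((E →L[ℂ] ℂ) × (ℂ × ℂ)) → (E →L[ℂ] ℂ) × (ℂ × ℂ) := fun z =>
    ((z.2.1 ∘L N z.1) ∘L N z.1 - (z.2.2.1 • z.2.1 + z.2.2.2 • (z.2.1 ∘L N z.1)),
      (z.2.1 e - 1, z.2.1 e₂))
  have hF : ContDiffAt ℝ 2 F ((κ₀, 0), (ρ, (0, 0))) := by
    have c1 : ContDiffAt ℝ 2 (fun z : (P × ℂ) × ((E →L[ℂ] ℂ) × (ℂ × ℂ)) => N z.1)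
        ((κ₀, 0), (ρ, (0, 0))) := ContDiffAt.comp (g := N) _ h.smooth contDiffAt_fst
    have c2 : ContDiffAt ℝ 2 (fun z : (P × ℂ) × ((E →L[ℂ] ℂ) × (ℂ × ℂ)) => z.2.1)
        ((κ₀, 0), (ρ, (0, 0))) := by fun_prop
    have c3 : ContDiffAt ℝ 2 (fun z : (P × ℂ) × ((E →L[ℂ] ℂ) × (ℂ × ℂ)) => z.2.2.1)
        ((κ₀, 0), (ρ, (0, 0))) := by fun_prop
    have c4 : ContDiffAt ℝ 2 (fun z : (P × ℂ) × ((E →L[ℂ] ℂ) × (ℂ × ℂ)) => z.2.2.2)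
        ((κ₀, 0), (ρ, (0, 0))) := by fun_prop
    have c5 := c2.clmComp c1
    exact ((c5.clmComp c1).sub ((c3.complexSMul c2).add (c4.complexSMul c5))).prodMk
      (((c2.clmApply contDiffAt_const).sub contDiffAt_const).prodMk
        (c2.clmApply contDiffAt_const))
  obtain ⟨φ, hφ, hφ0, hφF⟩ := exists_implicit hF
    (by
      have h1 : (ρ ∘L N (κ₀, 0)) ∘L N (κ₀, 0) = 0 := by ext v; exact hρN v
      have h2 : ∀ g : E →L[ℂ] ℂ, (0 : ℂ) • g = 0 := fun g => by ext v; simp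
      simp [F, hρe, hρe₂, h1, h2]) (by
    rintro ⟨g, b₀, b₁⟩ hd
    have d1 : HasDerivAt (fun t : ℝ => ρ + t • g) g 0 := by
      simpa using ((hasDerivAt_id (0 : ℝ)).smul_const g).const_add ρ
    have dl : ∀ b : ℂ, HasDerivAt (fun t : ℝ => t • b) b 0 := fun b => by
      simpa using ((hasDerivAt_id (0 : ℝ)).smul_const b)
    have dN := hasDerivAt_const (0 : ℝ) (N (κ₀, 0))
    have d2 := d1.clmComp dN
    have d3 := (d2.clmComp dN).sub (((dl b₀).complexSMul d1).add ((dl b₁).complexSMul d2))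
    have d4 : HasDerivAt (fun t : ℝ => (F ((κ₀, 0), (ρ, (0, 0)) + t • (g, (b₀, b₁)))).1) 0 0 :=
      (ContinuousLinearMap.fst ℝ (E →L[ℂ] ℂ) (ℂ × ℂ)).hasFDerivAt.comp_hasDerivAt (0 : ℝ) hd
    have d5 : HasDerivAt (fun t : ℝ => (F ((κ₀, 0), (ρ, (0, 0)) + t • (g, (b₀, b₁)))).2) 0 0 :=
      (ContinuousLinearMap.snd ℝ (E →L[ℂ] ℂ) (ℂ × ℂ)).hasFDerivAt.comp_hasDerivAt (0 : ℝ) hd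
    have d51 : HasDerivAt (fun t : ℝ => (F ((κ₀, 0), (ρ, (0, 0)) + t • (g, (b₀, b₁)))).2.1) 0 0 :=
      (ContinuousLinearMap.fst ℝ ℂ ℂ).hasFDerivAt.comp_hasDerivAt (0 : ℝ) d5
    have d52 : HasDerivAt (fun t : ℝ => (F ((κ₀, 0), (ρ, (0, 0)) + t • (g, (b₀, b₁)))).2.2) 0 0 :=
      (ContinuousLinearMap.snd ℝ ℂ ℂ).hasFDerivAt.comp_hasDerivAt (0 : ℝ) d5
    have e1 := d3.unique (d4.congr_of_eventuallyEq (.of_forall fun t => by simp [F]))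
    have e2 : g e = 0 := by
      have := ((d1.clmApply (hasDerivAt_const (0 : ℝ) e)).sub_const 1).unique
        (d51.congr_of_eventuallyEq (.of_forall fun t => by simp [F]))
      simpa using this
    have e2' : g e₂ = 0 := by
      have := (d1.clmApply (hasDerivAt_const (0 : ℝ) e₂)).unique
        (d52.congr_of_eventuallyEq (.of_forall fun t => by simp [F]))
      simpa using this
    have e3 : ∀ v, g (N (κ₀, 0) (N (κ₀, 0) v)) = b₀ * ρ v + b₁ * ρ (N (κ₀, 0) v) := by
      intro v
      have := DFunLike.congr_fun e1 v
      simp at this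
      linear_combination this
    have e4 : b₀ = 0 := by
      have := e3 e
      simpa [h.null, hρe] using this.symm
    have e5 : b₁ = 0 := by
      have := e3 e₂
      simpa [h.null, hρe, h₂, hρe₂] using this.symm
    have e6 : g ∘L N (κ₀, 0) = 0 := hρl _ (fun v => by
      rw [ContinuousLinearMap.comp_apply, e3, e4, e5]; simp) (by
      rw [ContinuousLinearMap.comp_apply, h₂, e2])
    have e7 : g = 0 := hρl g (fun v => DFunLike.congr_fun e6 v) e2'
    simp [e4, e5, e7])
  refine ⟨fun x => (φ x).1, fun x => (φ x).2.1, fun x => (φ x).2.2, hφ.fst, hφ.snd.fst,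
    hφ.snd.snd, by simp [hφ0], by simp [hφ0], by simp [hφ0], ?_, ?_⟩
  · filter_upwards [hφF] with x hx
    exact sub_eq_zero.mp (congrArg (fun z => z.2.1) hx)
  · filter_upwards [hφF] with x hx v
    have := DFunLike.congr_fun (congrArg Prod.fst hx) v
    simpa [F, sub_eq_zero] using this

/-- The symmetrizer at a critical point with a Jordan block of length two. -/
theorem IsCritical.hasLocalSymmetrizer_of_jordan (h : IsCritical N Q κ₀ e) {e₂ : E}
    (h₂ : N (κ₀, 0) e₂ = e) : HasLocalSymmetrizer N Q κ₀ := by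
  obtain ⟨ρ, a, ha, hρe, hρe₂, hρN, hρl, hda, hare⟩ := h.exists_jordan h₂
  obtain ⟨r, α, β, hrC, hαC, hβC, hr0, hα0, hβ0, hre1, hrN⟩ :=
    h.exists_companion h₂ hρe hρe₂ hρN hρl
  -- the characteristic polynomial of the central block, applied to `N`
  set g : P × ℂ → E →L[ℂ] E := fun x =>
    N x ∘L N x - (α x • ContinuousLinearMap.id ℂ E + β x • N x) with hg
  have hgv : ∀ x v, g x v = N x (N x v) - (α x • v + β x • N x v) := fun x v => by simp [hg]
  have hgC : ContDiffAt ℝ 2 g (κ₀, 0) :=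
    (h.smooth.clmComp h.smooth).sub ((hαC.complexSMul contDiffAt_const).add
      (hβC.complexSMul h.smooth))
  have hg0 : ∀ v, g (κ₀, 0) v = N (κ₀, 0) (N (κ₀, 0) v) := fun v => by
    rw [hgv, hα0, hβ0]; simp
  set r₂ : P × ℂ → E →L[ℂ] ℂ := fun x => r x ∘L N x with hr₂
  have hr₂C : ContDiffAt ℝ 2 r₂ (κ₀, 0) := hrC.clmComp h.smooth
  set T : P × ℂ → E →L[ℂ] ℂ × ℂ := fun x => (r x).prod (r₂ x) with hT
  have hTC : ContinuousAt T (κ₀, 0) := by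
    have h1 : T = fun x =>
        ContinuousLinearMap.inl ℂ ℂ ℂ ∘L r x + ContinuousLinearMap.inr ℂ ℂ ℂ ∘L r₂ x := by
      funext x; ext v <;> simp [hT]
    rw [h1]
    exact (continuousAt_const.clm_comp hrC.continuousAt).add
      (continuousAt_const.clm_comp hr₂C.continuousAt)
  have hinj : ∀ v, T (κ₀, 0) v = 0 → g (κ₀, 0) v = 0 → v = 0 := by
    intro v h1 h2
    have h3 : ρ v = 0 := by rw [← hr0]; exact congrArg Prod.fst h1
    have h4 : ρ (N (κ₀, 0) v) = 0 := by rw [← hr0]; exact congrArg Prod.snd h1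
    rw [hg0] at h2
    obtain ⟨z, hz⟩ := h.kernel _ h2
    rw [hz, map_smul, hρe] at h4
    have hz0 : z = 0 := by simpa using h4
    rw [hz0, zero_smul] at hz
    obtain ⟨z', rfl⟩ := h.kernel _ hz
    rw [map_smul, hρe] at h3
    have : z' = 0 := by simpa using h3
    rw [this, zero_smul]
  have hTg : ContinuousAt (fun x => (T x).prod (g x)) (κ₀, 0) := by
    have h1 : (fun x => (T x).prod (g x)) = fun x =>
        ContinuousLinearMap.inl ℂ (ℂ × ℂ) E ∘L T x +
          ContinuousLinearMap.inr ℂ (ℂ × ℂ) E ∘L g x := by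
      funext x; ext v <;> simp
    rw [h1]
    exact (continuousAt_const.clm_comp hTC).add (continuousAt_const.clm_comp hgC.continuousAt)
  obtain ⟨c₁, hc₁, hlow⟩ := eventually_lower_bound hTg
    (fun v hv => hinj v (congrArg Prod.fst hv) (congrArg Prod.snd hv))
  have hκ0 : Tendsto (fun κ : P => (κ, (0 : ℂ))) (𝓝 κ₀) (𝓝 (κ₀, 0)) := by
    have : ContinuousAt (fun κ : P => (κ, (0 : ℂ))) κ₀ := by fun_prop
    exact this
  have hfst : Tendsto (fun x : P × ℂ => x.1) (𝓝 (κ₀, 0)) (𝓝 κ₀) :=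
    (continuousAt_fst (p := (κ₀, (0 : ℂ)))).tendsto
  -- As `N (κ, 0)` is singular with null vector `v`, `α r v = 0`. If `α ≠ 0`, then `r v` and `r N v`
  -- vanish and `g v = -α v` is small, which contradicts the lower bound of `(T, g)`.
  have hαz : ∀ᶠ κ in 𝓝 κ₀, κ ∈ Q → α (κ, 0) = 0 := by
    have hsm : ∀ᶠ x in 𝓝 (κ₀, (0 : ℂ)), ‖α x‖ < c₁ :=
      hαC.continuousAt.norm.eventually_lt continuousAt_const (by simpa [hα0] using hc₁)
    filter_upwards [h.singular, hκ0.eventually hlow, hκ0.eventually hsm, hκ0.eventually hrN]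
      with κ h1 h2 h3 h4 hκ
    obtain ⟨v, hv0, hv⟩ := h1 hκ
    by_contra h5
    have h6 : r (κ, 0) v = 0 := by
      have := h4 v
      rw [hv, map_zero, map_zero, mul_zero, add_zero] at this
      exact (mul_eq_zero.mp this.symm).resolve_left h5
    have h7 := h2 v
    have h8 : ((T (κ, 0)).prod (g (κ, 0))) v = ((0, 0), -(α (κ, 0) • v)) := by
      simp [hT, hr₂, h6, hgv, hv]
    have hvpos : 0 < ‖v‖ := norm_pos_iff.mpr hv0
    rw [h8] at h7
    simp only [Prod.norm_mk, norm_zero, norm_neg, norm_smul, max_self] at h7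
    rw [max_eq_right (by positivity)] at h7
    nlinarith
  obtain ⟨V, μ, c, hV, hμ, hV0, hμ0, hc, hcurve, hre⟩ := h.exists_dispersion
  have hx0 : Tendsto (fun q : P × ℝ => (q.1, μ q)) (𝓝 (κ₀, 0)) (𝓝 (κ₀, 0)) := by
    have : ContinuousAt (fun q : P × ℝ => (q.1, μ q)) (κ₀, 0) :=
      continuousAt_fst.prodMk hμ.continuousAt
    simpa [ContinuousAt, hμ0] using this
  -- apply the companion equation to the eigenvector `V` on the dispersion curve
  have hαcurve : ∀ᶠ q in 𝓝 (κ₀, (0 : ℝ)),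
      α (q.1, μ q) + (q.2 : ℂ) * Complex.I * β (q.1, μ q) = -(q.2 : ℂ) ^ 2 := by
    have h1 : ∀ᶠ q in 𝓝 (κ₀, (0 : ℝ)), r (q.1, μ q) (V q) ≠ 0 := by
      have h2 : ContinuousAt (fun q : P × ℝ => r (q.1, μ q)) (κ₀, 0) := by
        have := hrC.continuousAt.tendsto.comp hx0
        simpa [ContinuousAt, Function.comp_def, hμ0] using this
      have h3 : ContinuousAt (fun q : P × ℝ => r (q.1, μ q) (V q)) (κ₀, 0) :=
        h2.clm_apply hV.continuousAt
      refine h3.eventually_ne ?_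
      simp [hμ0, hV0, hr0, hρe]
    filter_upwards [h1, hx0.eventually hrN, hcurve] with q h1 h2 h3
    have h4 := h2 (V q)
    rw [h3, map_smul, h3, map_smul, map_smul, smul_eq_mul, smul_eq_mul] at h4
    refine mul_right_cancel₀ h1 ?_
    linear_combination -h4 + (q.2 : ℂ) ^ 2 * r (q.1, μ q) (V q) * Complex.I_sq
  -- by the normalization `α = r N² e - β r N e`, where `e` is a null vector at the base point
  have hdα : ∀ δ : ℂ, HasDerivAt (fun t : ℝ => α (κ₀, t • δ)) (δ * a) 0 := by
    intro δ
    obtain ⟨N', hN'⟩ := h.hasDerivAt_line δ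
    have hl : HasDerivAt (fun t : ℝ => (κ₀, t • δ)) ((0 : P), δ) 0 := by
      refine (hasDerivAt_const _ _).prodMk ?_
      simpa using ((hasDerivAt_id (0 : ℝ)).smul_const δ)
    have hline : ∀ {F : Type} [NormedAddCommGroup F] [NormedSpace ℝ F] {f : P × ℂ → F},
        ContDiffAt ℝ 2 f (κ₀, 0) →
        HasDerivAt (fun t : ℝ => f (κ₀, t • δ)) (fderiv ℝ f (κ₀, 0) (0, δ)) 0 := by
      intro F _ _ f hf
      have h1 : HasFDerivAt f (fderiv ℝ f (κ₀, 0)) (κ₀, (0 : ℝ) • δ) := by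
        simpa using (hf.differentiableAt (by norm_num)).hasFDerivAt
      exact h1.comp_hasDerivAt (0 : ℝ) hl
    have hNe := hN'.clmApply (hasDerivAt_const (0 : ℝ) e)
    have h3 := (hline hrC).clmApply (hN'.clmApply hNe)
    have h4 : ρ (N (κ₀, 0) (N' e)) = δ * a := by
      have := (hasDerivAt_const (0 : ℝ) ρ).clmApply
        ((hasDerivAt_const (0 : ℝ) (N (κ₀, 0))).clmApply hNe)
      simpa using this.unique (hda δ)
    have h5 := (hline hβC).mul ((hline hrC).clmApply hNe)
    have h6 := h3.sub h5
    have h7 : HasDerivAt (fun t : ℝ => r (κ₀, t • δ) (N (κ₀, t • δ) (N (κ₀, t • δ) e)) -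
        β (κ₀, t • δ) * r (κ₀, t • δ) (N (κ₀, t • δ) e)) (δ * a) 0 := by
      refine h6.congr_deriv ?_
      simp [hr0, h.null, h4, hβ0]
    refine h7.congr_of_eventuallyEq ?_
    have h8 : Tendsto (fun t : ℝ => (κ₀, t • δ)) (𝓝 0) (𝓝 (κ₀, 0)) := by
      have := hl.continuousAt.tendsto
      simpa using this
    filter_upwards [h8.eventually hrN, h8.eventually hre1] with t h9 h10
    rw [h9, h10]; ring
  have hdrift := eventually_real_drift ha hαC hβC hμ hμ0 hdα hαz hc hre hαcurve
  -- the coefficients of the form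
  have hproj : ContDiffAt ℝ 2 (fun x : P × ℂ => (x.1, (0 : ℂ))) (κ₀, 0) := by fun_prop
  set A : ℂ → P × ℂ → ℂ := fun δ x => fderiv ℝ α (x.1, 0) (0, δ) with hA
  have hAC : ∀ δ, ContDiffAt ℝ 1 (A δ) (κ₀, 0) := fun δ => by
    have h1 : ContDiffAt ℝ 1 (fun y => fderiv ℝ α y (0, δ)) (κ₀, 0) :=
      (hαC.fderiv_right (m := 1) (by norm_num)).clm_apply contDiffAt_const
    exact ContDiffAt.comp (g := fun y => fderiv ℝ α y (0, δ)) _ h1 (hproj.of_le (by norm_num))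
  have hA0 : ∀ δ, A δ (κ₀, 0) = δ * a := fun δ =>
    fderiv_inr_eq (hαC.differentiableAt (by norm_num)) (by simpa using hdα δ)
  have hAI0 : A Complex.I (κ₀, 0) ≠ 0 := by rw [hA0]; simp [ha]
  set b : P × ℂ → ℂ := fun x => Complex.I / A Complex.I x with hb
  have hbC : ContDiffAt ℝ 1 b (κ₀, 0) := by
    have h1 : b = fun x => Complex.I * (A Complex.I x)⁻¹ := by
      funext x; rw [hb]; simp only; rw [div_eq_mul_inv]
    rw [h1]
    exact contDiffAt_const.mul ((hAC _).inv hAI0)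
  have hb0 : b (κ₀, 0) = 1 / a := by
    rw [hb]; simp only [hA0]; field_simp
  set ϑ : P × ℂ → ℝ := fun x => -(b x * β (x.1, 0)).re with hϑ
  have hϑC : ContDiffAt ℝ 1 (fun x => (ϑ x : ℂ)) (κ₀, 0) := by
    have h1 : ContDiffAt ℝ 1 (fun x : P × ℂ => β (x.1, 0)) (κ₀, 0) :=
      (ContDiffAt.comp (g := β) (f := fun x : P × ℂ => (x.1, (0 : ℂ))) (κ₀, 0) hβC
        hproj).of_le (by norm_num)
    have h2 : ContDiffAt ℝ 1 (fun x => (b x * β (x.1, 0)).re) (κ₀, 0) :=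
      Complex.reCLM.contDiff.contDiffAt.comp _ (hbC.mul h1)
    exact Complex.ofRealCLM.contDiff.contDiffAt.comp _ h2.neg
  set M := ‖b (κ₀, 0)‖ + 1 with hM
  set m := (b (κ₀, 0)).re / 2 with hm
  have hmpos : 0 < m := by rw [hm, hb0]; linarith
  obtain ⟨Cα, hCα, htaylor⟩ := eventually_taylor hαC
  obtain ⟨Cβ, hCβ, hlip⟩ := eventually_lipschitz (hβC.of_le (m := 1) (by norm_num))
  set C₁ := M * Cα with hC₁
  set C₂ := M * Cβ with hC₂
  have hMpos : 0 < M := by positivity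
  -- `K` is the constant of `block_coercive`, and `bt` the off-diagonal coefficient of the form
  set K := C₁ + 2 * (C₂ + 1) ^ 2 / m + 2 with hK
  set bt : P × ℂ → ℂ := fun x => b x * (1 - K * (x.2.im : ℂ) * Complex.I) with hbt
  have hbtC : ContDiffAt ℝ 1 bt (κ₀, 0) := by
    have h1 : ContDiffAt ℝ 1 (fun x : P × ℂ => (x.2.im : ℂ)) (κ₀, 0) :=
      (Complex.ofRealCLM.contDiff.comp (Complex.imCLM.contDiff.comp contDiff_snd)).contDiffAt
    exact hbC.mul (contDiffAt_const.sub ((contDiffAt_const.mul h1).mul contDiffAt_const))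
  have hbcont := hbC.continuousAt
  have cre : ContinuousAt (fun x : P × ℂ => x.2.re) (κ₀, 0) := by fun_prop
  have cim : ContinuousAt (fun x : P × ℂ => |x.2.im|) (κ₀, 0) := by fun_prop
  have hsmall : ∀ {u : P × ℂ → ℝ} {w : ℝ}, ContinuousAt u (κ₀, 0) → u (κ₀, 0) < w →
      ∀ᶠ x in 𝓝 (κ₀, (0 : ℂ)), u x ≤ w := fun hu hw =>
    (hu.eventually_lt continuousAt_const hw).mono fun x hx => hx.le
  have s0 : ∀ᶠ x in 𝓝 (κ₀, (0 : ℂ)), ‖b x‖ ≤ M := hsmall hbcont.norm (by rw [hM]; linarith)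
  have s1 : ∀ᶠ x in 𝓝 (κ₀, (0 : ℂ)), C₁ * x.2.re ≤ 1 / 16 :=
    hsmall (continuousAt_const.mul cre) (by norm_num)
  have s2 : ∀ᶠ x in 𝓝 (κ₀, (0 : ℂ)), 2 * K * |x.2.im| ≤ 1 / 16 :=
    hsmall (continuousAt_const.mul cim) (by norm_num)
  have s3 : ∀ᶠ x in 𝓝 (κ₀, (0 : ℂ)), K * |x.2.im| * C₁ * x.2.re ≤ 1 / 16 :=
    hsmall (((continuousAt_const.mul cim).mul continuousAt_const).mul cre) (by norm_num)
  have s4 : ∀ᶠ x in 𝓝 (κ₀, (0 : ℂ)), K * |x.2.im| * C₁ ≤ 1 / 2 :=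
    hsmall ((continuousAt_const.mul cim).mul continuousAt_const) (by norm_num)
  have s5 : ∀ᶠ x in 𝓝 (κ₀, (0 : ℂ)), 2 * C₂ ^ 2 * x.2.re / m ≤ 1 / 16 :=
    hsmall ((continuousAt_const.mul cre).div_const m) (by norm_num)
  have s6 : ∀ᶠ x in 𝓝 (κ₀, (0 : ℂ)), K * ‖b x * β x‖ ≤ 1 :=
    hsmall (continuousAt_const.mul (hbcont.mul hβC.continuousAt).norm) (by simp [hβ0])
  have s7 : ∀ᶠ x in 𝓝 (κ₀, (0 : ℂ)), m < (b x).re - K * |x.2.im| * ‖b x‖ := by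
    have h1 : ContinuousAt (fun x => (b x).re - K * |x.2.im| * ‖b x‖) (κ₀, 0) :=
      (Complex.continuous_re.continuousAt.comp hbcont).sub
        ((continuousAt_const.mul cim).mul hbcont.norm)
    refine continuousAt_const.eventually_lt h1 ?_
    simp only [Complex.zero_im, abs_zero, mul_zero, zero_mul, sub_zero]
    rw [hm] at hmpos ⊢; linarith
  have s8 : ∀ᶠ x in 𝓝 (κ₀, (0 : ℂ)), 3 / 4 < (b x * A 1 x).re := by
    have h1 : ContinuousAt (fun x => (b x * A 1 x).re) (κ₀, 0) :=
      Complex.continuous_re.continuousAt.comp (hbcont.mul (hAC 1).continuousAt)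
    refine continuousAt_const.eventually_lt h1 ?_
    rw [hb0, hA0, one_mul, one_div_mul_cancel ha]
    norm_num
  have s9 : ∀ᶠ x in 𝓝 (κ₀, (0 : ℂ)), ‖b x * A 1 x‖ ≤ 2 := by
    refine hsmall (hbcont.mul (hAC 1).continuousAt).norm ?_
    rw [hb0, hA0, one_mul, one_div_mul_cancel ha]
    norm_num
  have s10 : ∀ᶠ x in 𝓝 (κ₀, (0 : ℂ)), A Complex.I x ≠ 0 :=
    (hAC Complex.I).continuousAt.eventually_ne hAI0
  -- `N + e ⊗ r + e₂ ⊗ r N` is hyperbolic: it has the block with the eigenvalue `1` in place of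
  -- the critical one
  refine hasLocalSymmetrizer_of_center
    (C := fun x => outer (r x) (bt x • r₂ x) + outer (bt x • r₂ x) (r x) +
      (ϑ x : ℂ) • outer (r x) (r x)) (g := g)
    (A := fun x => N x + (r x).smulRight e + (r₂ x).smulRight e₂) (T := T) ?_ ?_
    (hgC.of_le (by norm_num)) ?_ ?_ ?_ ?_ hTC hinj (c := min (1 / 2) (m / 2)) (by positivity) ?_
  · have h1 := hbtC.complexSMul (hr₂C.of_le (m := 1) (by norm_num))
    have h2 := hrC.of_le (m := 1) (by norm_num)
    exact ((h2.outer h1).add (h1.outer h2)).add (hϑC.complexSMul (h2.outer h2))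
  · intro x
    refine IsSelfAdjoint.add ?_ (IsSelfAdjoint.smul (by simp [IsSelfAdjoint]) ?_)
    · rw [IsSelfAdjoint, star_add, star_outer, star_outer, add_comm]
    · rw [IsSelfAdjoint, star_outer]
  · intro x v
    simp [hgv]
  · have h1 : ∀ (s : P × ℂ → E →L[ℂ] ℂ) (w : E), ContinuousAt s (κ₀, 0) →
        ContinuousAt (fun x => (s x).smulRight w) (κ₀, 0) := by
      intro s w hs
      have h2 : (fun x => (s x).smulRight w) = fun x =>
          (ContinuousLinearMap.toSpanSingleton ℂ w) ∘L s x := by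
        funext x; ext v; simp
      rw [h2]
      exact continuousAt_const.clm_comp hs
    exact (h.smooth.continuousAt.add (h1 r e hrC.continuousAt)).add (h1 r₂ e₂ hr₂C.continuousAt)
  · intro t v hv
    have hv' : N (κ₀, 0) v + ρ v • e + ρ (N (κ₀, 0) v) • e₂ = ((t : ℂ) * Complex.I) • v := by
      simpa [hr₂, hr0] using hv
    have hne : (1 - (t : ℂ) * Complex.I) ≠ 0 := by
      intro h3
      have := congrArg Complex.re h3
      simp at this
    have h1 : ρ (N (κ₀, 0) v) = 0 := by
      have := congrArg (fun w => ρ (N (κ₀, 0) w)) hv'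
      simp only [map_add, map_smul, hρN, h.null, h₂, hρe, smul_eq_mul, map_zero] at this
      have h2 : (1 - (t : ℂ) * Complex.I) * ρ (N (κ₀, 0) v) = 0 := by linear_combination this
      exact (mul_eq_zero.mp h2).resolve_left hne
    have h2 : ρ v = 0 := by
      have := congrArg ρ hv'
      simp only [map_add, map_smul, h1, hρe, hρe₂, smul_eq_mul] at this
      have h3 : (1 - (t : ℂ) * Complex.I) * ρ v = 0 := by linear_combination this
      exact (mul_eq_zero.mp h3).resolve_left hne
    rw [h1, h2, zero_smul, zero_smul, add_zero, add_zero] at hv'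
    rcases h.no_other t v hv' with rfl | h3
    · obtain ⟨z, rfl⟩ := h.kernel v (by rw [hv']; simp)
      rw [map_smul, hρe] at h2
      have : z = 0 := by simpa using h2
      rw [this, zero_smul]
    · exact h3
  · filter_upwards [hrN] with x hx v
    have h1 : ∀ w, r x (g x w) = 0 := fun w => by
      rw [hgv, map_sub, hx, map_add, map_smul, map_smul, smul_eq_mul, smul_eq_mul, sub_self]
    have h2 : r x (N x (g x v)) = 0 := by
      have : N x (g x v) = g x (N x v) := by simp [hgv]
      rw [this, h1]
    simp [hr₂, h1, h2]
  · have hw : ∀ᶠ x in 𝓝 (κ₀, (0 : ℂ)), x.2.re + x.2.im ^ 2 ≤ 1 := by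
      refine hsmall (by fun_prop) (by simp)
    filter_upwards [hrN, htaylor, hlip, hfst.eventually hαz, hfst.eventually hdrift, s0, s1, s2,
      s3, s4, s5, s6, s7, s8, s9, s10, hw] with x h1 h2 h3 h4 h5 t0 t1 t2 t3 t4 t5 t6 t7 t8 t9
      t10 hw hxQ hx v
    have hnsq : ‖x.2‖ ^ 2 = x.2.re ^ 2 + x.2.im ^ 2 := by
      rw [Complex.sq_norm, Complex.normSq_apply]; ring
    have hnle : ‖x.2‖ ≤ x.2.re + |x.2.im| := by
      have := Complex.norm_le_abs_re_add_abs_im x.2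
      rwa [abs_of_nonneg hx] at this
    have hbA : b x * A Complex.I x = Complex.I := div_mul_cancel₀ _ t10
    have hα' : ‖b x * α x - ((x.2.re : ℂ) * (b x * A 1 x) + x.2.im * Complex.I)‖ ≤
        C₁ * (x.2.re ^ 2 + x.2.im ^ 2) := by
      have e1 : fderiv ℝ α (x.1, 0) (0, x.2) = x.2.re * A 1 x + x.2.im * A Complex.I x := by
        have : ((0 : P), x.2) = x.2.re • ((0 : P), (1 : ℂ)) + x.2.im • ((0 : P), Complex.I) := by
          ext
          · simp
          · simp
        rw [this, map_add, map_smul, map_smul, Complex.real_smul, Complex.real_smul]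
      have e2 : b x * α x - ((x.2.re : ℂ) * (b x * A 1 x) + x.2.im * Complex.I) =
          b x * (α x - α (x.1, 0) - fderiv ℝ α (x.1, 0) (0, x.2)) := by
        rw [e1, h4 hxQ]
        linear_combination -(x.2.im : ℂ) * (-hbA)
      rw [e2, norm_mul, ← hnsq, hC₁, mul_assoc]
      gcongr
    have hβ' : ‖b x * β x + ϑ x‖ ≤ C₂ * (x.2.re + |x.2.im|) := by
      have e1 : (ϑ x : ℂ) = -(b x * β (x.1, 0)) := by
        apply Complex.ext
        · simp [hϑ]
        · have : (b x * β (x.1, 0)).im = 0 := h5 hxQ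
          rw [Complex.neg_im, this]; simp
      have e2 : b x * β x + ϑ x = b x * (β x - β (x.1, 0)) := by rw [e1]; ring
      rw [e2, norm_mul, hC₂, mul_assoc]
      gcongr
      exact h3.trans (by gcongr)
    have hmain := block_coercive (X := r x v) (Y := r₂ x v) hx hmpos (by positivity)
      (by positivity) hK hα' t8.le t9 hβ' t6 t7.le t1 t2 t3 t4 t5
    have e3 : ⟪v, (outer (r x) (bt x • r₂ x) + outer (bt x • r₂ x) (r x) +
        (ϑ x : ℂ) • outer (r x) (r x)) (N x v)⟫_ℂ =
        starRingEnd ℂ (r x v) * (b x * (1 - K * (x.2.im : ℂ) * Complex.I) *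
          (α x * r x v + β x * r₂ x v)) +
        starRingEnd ℂ (b x * (1 - K * (x.2.im : ℂ) * Complex.I) * r₂ x v) * r₂ x v +
        ϑ x * (starRingEnd ℂ (r x v) * r₂ x v) := by
      rw [add_apply, add_apply, inner_add_right, inner_add_right, _root_.smul_apply,
        inner_smul_right, inner_outer, inner_outer, inner_outer, _root_.smul_apply,
        _root_.smul_apply]
      have e4 : r₂ x (N x v) = α x * r x v + β x * r₂ x v := h1 v
      have e5 : r x (N x v) = r₂ x v := rfl
      rw [e4, e5, smul_eq_mul, smul_eq_mul, hbt]
    rw [e3]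
    refine le_trans ?_ hmain
    have e6 : ‖T x v‖ ^ 2 ≤ ‖r x v‖ ^ 2 + ‖r₂ x v‖ ^ 2 := by
      have : ‖T x v‖ = max ‖r x v‖ ‖r₂ x v‖ := rfl
      rw [this]
      rcases max_choice ‖r x v‖ ‖r₂ x v‖ with h | h <;> rw [h]
      · linarith [sq_nonneg ‖r₂ x v‖]
      · linarith [sq_nonneg ‖r x v‖]
    have hw0 : 0 ≤ x.2.re + x.2.im ^ 2 := by positivity
    calc min (1 / 2) (m / 2) * (x.2.re + x.2.im ^ 2) * ‖T x v‖ ^ 2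
        ≤ min (1 / 2) (m / 2) * (x.2.re + x.2.im ^ 2) * (‖r x v‖ ^ 2 + ‖r₂ x v‖ ^ 2) := by
          gcongr
      _ = min (1 / 2) (m / 2) * (x.2.re + x.2.im ^ 2) * ‖r x v‖ ^ 2 +
          min (1 / 2) (m / 2) * (x.2.re + x.2.im ^ 2) * ‖r₂ x v‖ ^ 2 := by ring
      _ ≤ 1 / 2 * (x.2.re + x.2.im ^ 2) * ‖r x v‖ ^ 2 + m / 2 * 1 * ‖r₂ x v‖ ^ 2 := by
          gcongr
          · exact min_le_left _ _
          · exact min_le_right _ _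
      _ = _ := by ring

/-- Every critical point has a local symmetrizer. -/
theorem IsCritical.hasLocalSymmetrizer (h : IsCritical N Q κ₀ e) : HasLocalSymmetrizer N Q κ₀ := by
  by_cases he : ∃ u, N (κ₀, 0) u = e
  · obtain ⟨e₂, h₂⟩ := he
    exact h.hasLocalSymmetrizer_of_jordan h₂
  · exact h.hasLocalSymmetrizer_of_simple he

end Center

/-! ### The first-order system as an operator equation -/

section System

variable {m n : ℕ}

/-- The phase space `ℂⁿ ⊕ ℂⁿ` of the first-order system, with its Hermitian norm. -/
abbrev Sys (n : ℕ) := EuclideanSpace ℂ (Fin n ⊕ Fin n)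

/-- The operator on `Sys n` given by a block matrix. -/
noncomputable def matOp (A : Mat2 n) : Sys n →L[ℂ] Sys n := Matrix.toEuclideanCLM (𝕜 := ℂ) A

/-- `matOp` as a continuous real-linear map. -/
noncomputable def matOpL (n : ℕ) : Mat2 n →L[ℝ] (Sys n →L[ℂ] Sys n) :=
  LinearMap.toContinuousLinearMap
    { toFun := matOp
      map_add' := fun A B => map_add (Matrix.toEuclideanCLM (n := Fin n ⊕ Fin n) (𝕜 := ℂ)) A B
      map_smul' := fun t A => by
        have h := map_smul (Matrix.toEuclideanCLM (n := Fin n ⊕ Fin n) (𝕜 := ℂ)) (t : ℂ) A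
        simpa [matOp] using h }

@[simp] theorem matOpL_apply (A : Mat2 n) : matOpL n A = matOp A := rfl

theorem matOp_mul (A B : Mat2 n) : matOp (A * B) = matOp A ∘L matOp B :=
  map_mul (Matrix.toEuclideanCLM (n := Fin n ⊕ Fin n) (𝕜 := ℂ)) A B

theorem matOp_sub (A B : Mat2 n) : matOp (A - B) = matOp A - matOp B :=
  map_sub (Matrix.toEuclideanCLM (n := Fin n ⊕ Fin n) (𝕜 := ℂ)) A B

theorem matOp_one : matOp (1 : Mat2 n) = ContinuousLinearMap.id ℂ (Sys n) :=
  map_one (Matrix.toEuclideanCLM (n := Fin n ⊕ Fin n) (𝕜 := ℂ))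

/-- The matrix of an operator on `Sys n`, as a continuous real-linear map. -/
noncomputable def opMatL (n : ℕ) : (Sys n →L[ℂ] Sys n) →L[ℝ] Mat2 n :=
  LinearMap.toContinuousLinearMap
    { toFun := (Matrix.toEuclideanCLM (n := Fin n ⊕ Fin n) (𝕜 := ℂ)).symm
      map_add' := fun A B => map_add (Matrix.toEuclideanCLM (n := Fin n ⊕ Fin n) (𝕜 := ℂ)).symm A B
      map_smul' := fun t A => by
        have h := map_smul (Matrix.toEuclideanCLM (n := Fin n ⊕ Fin n) (𝕜 := ℂ)).symm (t : ℂ) A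
        have h2 : (t : ℂ) • A = t • A := by
          ext1 v
          exact Complex.coe_smul t (A v)
        rw [h2, Complex.coe_smul] at h
        exact h }

@[simp] theorem matOp_opMatL (A : Sys n →L[ℂ] Sys n) : matOp (opMatL n A) = A :=
  (Matrix.toEuclideanCLM (n := Fin n ⊕ Fin n) (𝕜 := ℂ)).apply_symm_apply A

theorem matOp_injective : Function.Injective (matOp (n := n)) :=
  (Matrix.toEuclideanCLM (n := Fin n ⊕ Fin n) (𝕜 := ℂ)).injective

theorem matOp_conjTranspose (A : Mat2 n) : matOp Aᴴ = star (matOp A) :=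
  map_star (Matrix.toEuclideanCLM (n := Fin n ⊕ Fin n) (𝕜 := ℂ)) A

/-- The upper component of a phase vector. -/
noncomputable def upper (n : ℕ) : Sys n →L[ℂ] CVec n :=
  LinearMap.toContinuousLinearMap
    { toFun := fun v => WithLp.toLp 2 fun i => v (Sum.inl i)
      map_add' := fun v w => by ext i; simp
      map_smul' := fun z v => by ext i; simp }

/-- The lower component of a phase vector. -/
noncomputable def lower (n : ℕ) : Sys n →L[ℂ] CVec n :=
  LinearMap.toContinuousLinearMap
    { toFun := fun v => WithLp.toLp 2 fun i => v (Sum.inr i)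
      map_add' := fun v w => by ext i; simp
      map_smul' := fun z v => by ext i; simp }

/-- The phase vector with given components. -/
noncomputable def stack (n : ℕ) (a b : CVec n) : Sys n := WithLp.toLp 2 (Sum.elim a b)

@[simp] theorem upper_apply (v : Sys n) (i : Fin n) : upper n v i = v (Sum.inl i) := rfl
@[simp] theorem lower_apply (v : Sys n) (i : Fin n) : lower n v i = v (Sum.inr i) := rfl
@[simp] theorem stack_inl (a b : CVec n) (i : Fin n) : stack n a b (Sum.inl i) = a i := rfl
@[simp] theorem stack_inr (a b : CVec n) (i : Fin n) : stack n a b (Sum.inr i) = b i := rfl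
@[simp] theorem upper_stack (a b : CVec n) : upper n (stack n a b) = a := rfl
@[simp] theorem lower_stack (a b : CVec n) : lower n (stack n a b) = b := rfl

theorem Sys.ext_parts {v w : Sys n} (h1 : upper n v = upper n w) (h2 : lower n v = lower n w) :
    v = w := by
  ext i
  rcases i with i | i
  · exact congrArg (fun u : CVec n => u i) h1
  · exact congrArg (fun u : CVec n => u i) h2

theorem stack_parts (v : Sys n) : stack n (upper n v) (lower n v) = v := Sys.ext_parts rfl rfl

/-- `stack` as a continuous real-linear map. -/
noncomputable def stackL (n : ℕ) : CVec n × CVec n →L[ℝ] Sys n :=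
  LinearMap.toContinuousLinearMap
    { toFun := fun q => stack n q.1 q.2
      map_add' := fun v w => Sys.ext_parts (by simp) (by simp)
      map_smul' := fun z v => by
        ext i
        rcases i with i | i <;> simp }

@[simp] theorem stackL_apply (q : CVec n × CVec n) : stackL n q = stack n q.1 q.2 := rfl

/-- The spectral shift `λ + i ∑_j c_j η_j + |η|²` at a frequency point. -/
noncomputable def shift (c : RVec m) (x : Freq m) : ℂ :=
  x.2.1 + Complex.I * (drift c x.2.2 : ℂ) + ((‖x.2.2‖ ^ 2 : ℝ) : ℂ)

/-- The action of the Jacobian `f'(p(k, θ))`. -/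
noncomputable def jacOp (f : RVec n → RVec n) (p : RVec (m + 1) → ℝ → RVec n) (k : RVec (m + 1))
    (θ : ℝ) : CVec n →ₗ[ℂ] CVec n := Matrix.toEuclideanLin (jacobianAlong f p k θ)

variable (f : RVec n → RVec n) (p : RVec (m + 1) → ℝ → RVec n) (ω : RVec (m + 1) → ℝ)
  (c : RVec m)

theorem upper_symbol (x : Freq m) (θ : ℝ) (v : Sys n) :
    upper n (matOp (symbolMatrix f p ω c x θ) v) = ((‖x.1‖⁻¹ : ℝ) : ℂ) • lower n v := by
  ext i
  have h : matOp (symbolMatrix f p ω c x θ) v = WithLp.toLp 2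
      ((symbolMatrix f p ω c x θ) *ᵥ (Sum.elim (upper n v).ofLp (lower n v).ofLp)) := by
    conv_lhs => rw [← stack_parts v]
    rfl
  rw [h]
  simp [symbolMatrix, Matrix.smul_mulVec, Matrix.fromBlocks_mulVec]

theorem lower_symbol (x : Freq m) (θ : ℝ) (v : Sys n) :
    lower n (matOp (symbolMatrix f p ω c x θ) v) = ((‖x.1‖⁻¹ : ℝ) : ℂ) •
      (shift c x • upper n v + jacOp f p x.1 θ (upper n v) +
        ((‖x.1‖⁻¹ * ω x.1 : ℝ) : ℂ) • lower n v) := by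
  ext i
  have h : matOp (symbolMatrix f p ω c x θ) v = WithLp.toLp 2
      ((symbolMatrix f p ω c x θ) *ᵥ (Sum.elim (upper n v).ofLp (lower n v).ofLp)) := by
    conv_lhs => rw [← stack_parts v]
    rfl
  rw [h]
  simp [symbolMatrix, Matrix.smul_mulVec, Matrix.fromBlocks_mulVec, Matrix.add_mulVec, jacOp,
    shift, Matrix.toEuclideanLin]
  ring

end System

/-! ### Classical solutions and the Bloch operators -/

section Classical

variable {m n : ℕ} {r : ℕ∞} {f : RVec n → RVec n} {p : RVec (m + 1) → ℝ → RVec n}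
  {ω : RVec (m + 1) → ℝ} {Ω K : Set (RVec (m + 1))}

theorem hasWeakDeriv_of_hasDerivAt {v w : ℝ → CVec n} (hv : ∀ θ, HasDerivAt v (w θ) θ)
    (hw : Continuous w) (hper : v (2 * Real.pi) = v 0) : HasWeakDeriv v w := by
  intro φ hφ hφper
  have hφd : ∀ θ, HasDerivAt φ (deriv φ θ) θ := fun θ =>
    (hφ.differentiable (by simp) θ).hasDerivAt
  have hφc : Continuous (deriv φ) := hφ.continuous_deriv (by simp)
  have hvc : Continuous v := continuous_iff_continuousAt.mpr fun θ => (hv θ).continuousAt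
  have h1 : ∫ θ in (0 : ℝ)..(2 * Real.pi), (φ θ • w θ + deriv φ θ • v θ) = 0 := by
    rw [intervalIntegral.integral_eq_sub_of_hasDerivAt (f := fun θ => φ θ • v θ)
      (fun θ _ => (hφd θ).smul (hv θ)) ((by fun_prop : Continuous _).intervalIntegrable _ _)]
    have := hφper 0
    rw [zero_add] at this
    rw [hper, this, sub_self]
  rw [intervalIntegral.integral_add ((by fun_prop : Continuous _).intervalIntegrable _ _)
    ((by fun_prop : Continuous _).intervalIntegrable _ _),
    intervalIntegral.integral_of_le Real.two_pi_pos.le,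
    intervalIntegral.integral_of_le Real.two_pi_pos.le] at h1
  exact eq_neg_of_add_eq_zero_right h1

theorem memLp_of_continuous {v : ℝ → CVec n} (hv : Continuous v) : MemLp v 2 periodMeasure := by
  have hfin : IsFiniteMeasure periodMeasure := by
    unfold periodMeasure; infer_instance
  obtain ⟨C, hC⟩ := (isCompact_Icc (a := (0 : ℝ)) (b := 2 * Real.pi)).exists_bound_of_continuousOn
    hv.continuousOn
  refine MemLp.of_bound hv.aestronglyMeasurable C ?_
  refine (ae_restrict_iff' measurableSet_Ioc).mpr (Eventually.of_forall fun θ hθ => ?_)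
  exact hC θ ⟨hθ.1.le, hθ.2⟩

/-- A twice continuously differentiable solution of the resolvent equation of the unshifted
operator, multiplied by `e^{-iξθ}`, solves the resolvent equation of `L_{ξ,0}`. -/
theorem blochGraph_of_classical {k : RVec (m + 1)} {ξ : ℝ} {μ : ℂ} {y y₁ y₂ g : ℝ → CVec n}
    (hy : ∀ θ, HasDerivAt y (y₁ θ) θ) (hy₁ : ∀ θ, HasDerivAt y₁ (y₂ θ) θ) (hy₂ : Continuous y₂)
    (hper : y (2 * Real.pi) = Complex.exp (2 * Real.pi * ξ * Complex.I) • y 0)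
    (hper₁ : y₁ (2 * Real.pi) = Complex.exp (2 * Real.pi * ξ * Complex.I) • y₁ 0)
    (heq : ∀ θ, ((‖k‖ ^ 2 : ℝ) : ℂ) • y₂ θ =
      (ω k : ℂ) • y₁ θ + jacOp f p k θ (y θ) + μ • y θ + g θ) :
    BlochGraph f p ω k ξ (0 : RVec m) (fun θ => Complex.exp (-(ξ * Complex.I) * θ) • y θ)
      (fun θ => μ • Complex.exp (-(ξ * Complex.I) * θ) • y θ +
        Complex.exp (-(ξ * Complex.I) * θ) • g θ) := by
  set s : ℂ := -(ξ * Complex.I) with hs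
  have hE : ∀ θ : ℝ, HasDerivAt (fun θ : ℝ => Complex.exp (s * θ)) (s * Complex.exp (s * θ)) θ := by
    intro θ
    have h1 : HasDerivAt (fun θ : ℝ => s * (θ : ℂ)) s θ := by
      simpa using (Complex.ofRealCLM.hasDerivAt (x := θ)).const_mul s
    exact h1.cexp.congr_deriv (by ring)
  have hEp :
      Complex.exp (s * (2 * Real.pi : ℝ)) * Complex.exp (2 * Real.pi * ξ * Complex.I) = 1 := by
    rw [← Complex.exp_add, hs]
    push_cast
    ring_nf
    simp
  have hyc : Continuous y := continuous_iff_continuousAt.mpr fun θ => (hy θ).continuousAt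
  have hy₁c : Continuous y₁ := continuous_iff_continuousAt.mpr fun θ => (hy₁ θ).continuousAt
  -- with `s = -iξ`, the operator `∂_θ + iξ` acts on `u = e^{sθ} y` as `∂_θ` acts on `y`
  set u : ℝ → CVec n := fun θ => Complex.exp (s * θ) • y θ with hu
  set u₁ : ℝ → CVec n := fun θ => Complex.exp (s * θ) • (y₁ θ + s • y θ) with hu₁
  set u₂ : ℝ → CVec n := fun θ => Complex.exp (s * θ) • (y₂ θ + (2 * s) • y₁ θ + s ^ 2 • y θ)
    with hu₂
  have hd : ∀ θ, HasDerivAt u (u₁ θ) θ := fun θ =>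
    ((hE θ).complexSMul (hy θ)).congr_deriv (by simp only [hu₁]; module)
  have hd₁ : ∀ θ, HasDerivAt u₁ (u₂ θ) θ := fun θ =>
    ((hE θ).complexSMul ((hy₁ θ).add ((hy θ).const_smul s))).congr_deriv (by
      simp only [hu₂, Pi.add_apply, Pi.smul_apply]; module)
  refine ⟨u₁, u₂, memLp_of_continuous (by fun_prop), memLp_of_continuous (by fun_prop),
    memLp_of_continuous (by fun_prop), hasWeakDeriv_of_hasDerivAt hd (by fun_prop) ?_,
    hasWeakDeriv_of_hasDerivAt hd₁ (by fun_prop) ?_, Eventually.of_forall fun θ => ?_⟩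
  · simp only [hu, hper, smul_smul, hEp]
    simp
  · simp only [hu₁, hper, hper₁]
    rw [show Complex.exp (2 * Real.pi * ξ * Complex.I) • y₁ 0 +
      s • Complex.exp (2 * Real.pi * ξ * Complex.I) • y 0 =
      Complex.exp (2 * Real.pi * ξ * Complex.I) • (y₁ 0 + s • y 0) by module, smul_smul, hEp]
    simp
  · have h0 : ((‖(0 : RVec m)‖ ^ 2 : ℝ) : ℂ) = 0 := by simp
    have hJ : Matrix.toEuclideanLin (jacobianAlong f p k θ) (Complex.exp (s * θ) • y θ) =
        Complex.exp (s * θ) • jacOp f p k θ (y θ) := map_smul _ _ _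
    have hIξ : Complex.I * ξ = -s := by rw [hs]; ring
    have hg : g θ = ((‖k‖ ^ 2 : ℝ) : ℂ) • y₂ θ -
        ((ω k : ℂ) • y₁ θ + jacOp f p k θ (y θ) + μ • y θ) := by rw [heq]; abel
    simp only [hu, hu₁, hu₂, hJ, h0, hg, mul_assoc, hIξ]
    module

end Classical

/-! ### Floquet exponents and the spectra of the Bloch operators -/

section Spectrum

variable {m n : ℕ} {r : ℕ∞} {f : RVec n → RVec n} {p : RVec (m + 1) → ℝ → RVec n}
  {ω : RVec (m + 1) → ℝ} {Ω K : Set (RVec (m + 1))} {c : RVec m} {U : Set (Freq m)}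
  {W : Freq m → ℝ → Mat2 n} {M₁ : Freq m → Mat2 n} {x : Freq m} {k : RVec (m + 1)}

theorem IsWaveFamily.norm_ne_zero (hw : IsWaveFamily r f p ω Ω K) (hk : k ∈ Ω) : ‖k‖ ≠ 0 :=
  norm_ne_zero_iff.mpr fun h => hw.zero_notMem (h ▸ hk)

theorem IsWaveFamily.contDiff_profile (hw : IsWaveFamily r f p ω Ω K) (hk : k ∈ Ω) :
    ContDiff ℝ (r : WithTop ℕ∞) (p k) := by
  refine contDiff_iff_contDiffAt.mpr fun θ => ?_
  have h1 : ContDiffAt ℝ (r : WithTop ℕ∞) (fun q : RVec (m + 1) × ℝ => p q.1 q.2) (k, θ) :=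
    hw.profile_smooth.contDiffAt ((hw.isOpen_dom.prod isOpen_univ).mem_nhds ⟨hk, trivial⟩)
  exact h1.comp (f := fun θ : ℝ => (k, θ)) θ (contDiffAt_const.prodMk contDiffAt_id)

theorem jacOp_apply (k : RVec (m + 1)) (θ : ℝ) (v : CVec n) (i : Fin n) :
    jacOp f p k θ v i =
      ∑ j, ((fderiv ℝ f (p k θ) (EuclideanSpace.single j 1) i : ℝ) : ℂ) * v j := rfl

theorem IsWaveFamily.continuous_jacOp (hw : IsWaveFamily r f p ω Ω K) (hk : k ∈ Ω)
    {y : ℝ → CVec n} (hy : Continuous y) : Continuous fun θ => jacOp f p k θ (y θ) := by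
  refine (PiLp.continuous_toLp 2 (fun _ : Fin n => ℂ)).comp (continuous_pi fun i => ?_)
  have h1 : Continuous fun θ => fderiv ℝ f (p k θ) :=
    (hw.reaction_smooth.continuous_fderiv (by simp)).comp (hw.contDiff_profile hk).continuous
  change Continuous fun θ =>
    ∑ j, ((fderiv ℝ f (p k θ) (EuclideanSpace.single j 1) i : ℝ) : ℂ) * y θ j
  refine continuous_finsetSum (M := ℂ) _ fun j _ => ?_
  have h2 : Continuous fun θ => fderiv ℝ f (p k θ) (EuclideanSpace.single j 1) i :=
    (EuclideanSpace.proj i : RVec n →L[ℝ] ℝ).continuous.comp (h1.clm_apply continuous_const)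
  have h3 : Continuous fun θ => y θ j :=
    (EuclideanSpace.proj j : CVec n →L[ℂ] ℂ).continuous.comp hy
  exact (Complex.continuous_ofReal.comp h2).mul h3

/-- A solution of the inhomogeneous first-order system with Floquet exponent `iξ` gives a solution
of the resolvent equation of `L_{ξ,0}` at the shift. -/
theorem IsWaveFamily.blochGraph (hw : IsWaveFamily r f p ω Ω K) (hx : x.1 ∈ Ω) {V : ℝ → Sys n}
    {g : ℝ → CVec n} {ξ : ℝ} (hg : Continuous g)
    (hV : ∀ θ, HasDerivAt V (matOp (symbolMatrix f p ω c x θ) (V θ) +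
      stack n 0 (((‖x.1‖⁻¹ : ℝ) : ℂ) • g θ)) θ)
    (hper : V (2 * Real.pi) = Complex.exp (2 * Real.pi * ξ * Complex.I) • V 0) :
    BlochGraph f p ω x.1 ξ (0 : RVec m)
      (fun θ => Complex.exp (-(ξ * Complex.I) * θ) • upper n (V θ))
      (fun θ => shift c x • Complex.exp (-(ξ * Complex.I) * θ) • upper n (V θ) +
        Complex.exp (-(ξ * Complex.I) * θ) • g θ) := by
  have hVc : Continuous V := continuous_iff_continuousAt.mpr fun θ => (hV θ).continuousAt
  have hk0 : (‖x.1‖ : ℂ) ≠ 0 := by exact_mod_cast hw.norm_ne_zero hx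
  have hu : ∀ θ, HasDerivAt (fun θ => upper n (V θ)) (((‖x.1‖⁻¹ : ℝ) : ℂ) • lower n (V θ)) θ := by
    intro θ
    have h1 := ((upper n).restrictScalars ℝ).hasFDerivAt.comp_hasDerivAt θ (hV θ)
    refine h1.congr_deriv ?_
    simp only [ContinuousLinearMap.coe_restrictScalars', map_add, upper_symbol, upper_stack,
      add_zero]
  have hl : ∀ θ, HasDerivAt (fun θ => lower n (V θ)) (((‖x.1‖⁻¹ : ℝ) : ℂ) •
      (shift c x • upper n (V θ) + jacOp f p x.1 θ (upper n (V θ)) +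
        ((‖x.1‖⁻¹ * ω x.1 : ℝ) : ℂ) • lower n (V θ) + g θ)) θ := by
    intro θ
    have h1 := ((lower n).restrictScalars ℝ).hasFDerivAt.comp_hasDerivAt θ (hV θ)
    refine h1.congr_deriv ?_
    simp only [ContinuousLinearMap.coe_restrictScalars', map_add, lower_symbol, lower_stack]
    module
  have hJ := hw.continuous_jacOp hx ((upper n).continuous.comp hVc)
  simp only [Function.comp_def] at hJ
  refine blochGraph_of_classical hu (fun θ => (hl θ).const_smul ((‖x.1‖⁻¹ : ℝ) : ℂ)) (by fun_prop)
    (by rw [hper, map_smul]) (by rw [hper, map_smul, smul_comm]) fun θ => ?_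
  push_cast
  simp only [smul_smul, smul_add]
  have h1 : (‖x.1‖ : ℂ) ^ 2 * ((‖x.1‖ : ℂ)⁻¹ * (‖x.1‖ : ℂ)⁻¹) = 1 := by field_simp
  simp only [← mul_assoc] at h1 ⊢
  simp only [h1, one_mul, one_smul]
  rw [mul_comm (‖x.1‖ : ℂ)⁻¹ (ω x.1 : ℂ)]
  abel

/-- A solution of the first-order system whose upper component vanishes is zero. -/
theorem IsWaveFamily.eq_zero_of_upper (hw : IsWaveFamily r f p ω Ω K) (hx : x.1 ∈ Ω)
    {V : ℝ → Sys n} (hV : ∀ θ, HasDerivAt V (matOp (symbolMatrix f p ω c x θ) (V θ)) θ)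
    (h0 : (fun θ => upper n (V θ)) =ᵐ[periodMeasure] 0) : V Real.pi = 0 := by
  have hVc : Continuous V := continuous_iff_continuousAt.mpr fun θ => (hV θ).continuousAt
  have hpi := Real.pi_pos
  have h1 : Set.EqOn (fun θ => upper n (V θ)) 0 (Set.Ioc 0 (2 * Real.pi)) :=
    Measure.eqOn_Ioc_of_ae_eq (μ := volume) h0
      ((upper n).continuous.comp hVc).continuousOn continuousOn_const
  have h2 : (fun θ => upper n (V θ)) =ᶠ[𝓝 Real.pi] fun _ => 0 := by
    filter_upwards [Ioc_mem_nhds hpi (by linarith : Real.pi < 2 * Real.pi)] with θ hθ using h1 hθ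
  have h3 := ((upper n).restrictScalars ℝ).hasFDerivAt.comp_hasDerivAt Real.pi (hV Real.pi)
  have h4 : ((‖x.1‖⁻¹ : ℝ) : ℂ) • lower n (V Real.pi) = 0 := by
    rw [← upper_symbol f p ω c x Real.pi]
    exact (h3.congr_of_eventuallyEq h2.symm).unique (hasDerivAt_const _ _)
  have hk0 : ((‖x.1‖⁻¹ : ℝ) : ℂ) ≠ 0 := by
    exact_mod_cast inv_ne_zero (hw.norm_ne_zero hx)
  have h5 : lower n (V Real.pi) = 0 := (smul_eq_zero.mp h4).resolve_left hk0
  exact Sys.ext_parts (by rw [map_zero]; exact h2.self_of_nhds) (by rw [map_zero, h5])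

theorem not_isResolventPoint {η : RVec m} {ξ : ℝ} {z : ℂ}
    (h : IsEigenvalue (BlochGraph f p ω k ξ η) z) :
    ¬ IsResolventPoint (BlochGraph f p ω k ξ η) z := by
  obtain ⟨u, hu0, hu⟩ := h
  rintro ⟨C, hC⟩
  obtain ⟨v, ⟨_, _, hvm, -⟩, hv, huniq⟩ := hC (fun _ => 0) MemLp.zero'
  have h1 : eLpNorm (fun _ : ℝ => (0 : CVec n)) 2 periodMeasure = 0 := eLpNorm_zero'
  rw [h1, mul_zero, nonpos_iff_eq_zero] at hv
  have h2 := huniq u (by simpa using hu)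
  exact hu0 (h2.trans ((eLpNorm_eq_zero_iff hvm.1 (by norm_num)).mp hv))

theorem hasDerivAt_exponential {F : Type} [NormedAddCommGroup F] [NormedSpace ℂ F] (s : ℂ) (e : F)
    (θ : ℝ) :
    HasDerivAt (fun θ : ℝ => Complex.exp (s * θ) • e) (s • Complex.exp (s * θ) • e) θ := by
  have h1 : HasDerivAt (fun θ : ℝ => s * (θ : ℂ)) s θ := by
    simpa using (Complex.ofRealCLM.hasDerivAt (x := θ)).const_mul s
  exact (h1.cexp.smul_const e).congr_deriv (by rw [smul_smul, mul_comm])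

/-- The inverse of the conjugator `W`, as an operator. -/
noncomputable def conjInv (W : Freq m → ℝ → Mat2 n) (x : Freq m) (θ : ℝ) : Sys n →L[ℂ] Sys n :=
  Ring.inverse (matOp (W x θ))

namespace IsFloquetReduction

variable (hr : IsFloquetReduction r f p ω Ω c U W M₁)
include hr

theorem isUnit_op (hx : x ∈ U) (θ : ℝ) : IsUnit (matOp (W x θ)) :=
  (hr.invertible x hx θ).map (Matrix.toEuclideanCLM (n := Fin n ⊕ Fin n) (𝕜 := ℂ))

theorem op_conjInv (hx : x ∈ U) (θ : ℝ) (v : Sys n) : matOp (W x θ) (conjInv W x θ v) = v :=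
  DFunLike.congr_fun (Ring.mul_inverse_cancel _ (hr.isUnit_op hx θ)) v

theorem conjInv_op (hx : x ∈ U) (θ : ℝ) (v : Sys n) : conjInv W x θ (matOp (W x θ) v) = v :=
  DFunLike.congr_fun (Ring.inverse_mul_cancel _ (hr.isUnit_op hx θ)) v

theorem hasDerivAt_op (hx : x ∈ U) (θ : ℝ) : HasDerivAt (fun θ => matOp (W x θ))
    (matOp (M₁ x) ∘L matOp (W x θ) - matOp (W x θ) ∘L matOp (symbolMatrix f p ω c x θ)) θ := by
  have h := (matOpL n).hasFDerivAt.comp_hasDerivAt θ (hr.conj_eq x hx θ)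
  refine h.congr_deriv ?_
  rw [matOpL_apply, matOp_sub, matOp_mul, matOp_mul]

theorem hasDerivAt_conjInv (hx : x ∈ U) (θ : ℝ) : HasDerivAt (conjInv W x)
    (matOp (symbolMatrix f p ω c x θ) ∘L conjInv W x θ - conjInv W x θ ∘L matOp (M₁ x)) θ := by
  obtain ⟨u, hu⟩ := hr.isUnit_op hx θ
  have h1 : HasFDerivAt Ring.inverse _ (matOp (W x θ)) :=
    hu ▸ hasFDerivAt_ringInverse (𝕜 := ℝ) u
  have h2 := h1.comp_hasDerivAt θ (hr.hasDerivAt_op hx θ)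
  refine h2.congr_deriv ?_
  have h3 : (↑u⁻¹ : Sys n →L[ℂ] Sys n) = conjInv W x θ := by
    rw [conjInv, ← hu, Ring.inverse_unit]
  ext1 v
  simp only [neg_apply, ContinuousLinearMap.mulLeftRight_apply, h3]
  simp [hr.conjInv_op hx, hr.op_conjInv hx]

theorem conjInv_periodic (hx : x ∈ U) : Function.Periodic (conjInv W x) (2 * Real.pi) := by
  intro θ
  simp only [conjInv, hr.periodic x hx θ]

/-- The change of unknown `V = W⁻¹ z`. -/
theorem hasDerivAt_conjInv_apply (hx : x ∈ U) {z : ℝ → Sys n} {z' : Sys n} {θ : ℝ}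
    (hz : HasDerivAt z z' θ) : HasDerivAt (fun θ => conjInv W x θ (z θ))
      (matOp (symbolMatrix f p ω c x θ) (conjInv W x θ (z θ)) +
        conjInv W x θ (z' - matOp (M₁ x) (z θ))) θ := by
  refine ((hr.hasDerivAt_conjInv hx θ).clmApply hz).congr_deriv ?_
  simp only [_root_.sub_apply, ContinuousLinearMap.comp_apply, map_sub]
  abel

/-- The Floquet solution belonging to an eigenvector of the averaged matrix. -/
theorem hasDerivAt_solution (hx : x ∈ U) {s : ℂ} {e : Sys n} (he : matOp (M₁ x) e = s • e)
    (θ : ℝ) : HasDerivAt (fun θ : ℝ => conjInv W x θ (Complex.exp (s * θ) • e))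
      (matOp (symbolMatrix f p ω c x θ) (conjInv W x θ (Complex.exp (s * θ) • e))) θ := by
  refine (hr.hasDerivAt_conjInv_apply hx (hasDerivAt_exponential s e θ)).congr_deriv ?_
  have h1 : matOp (M₁ x) (Complex.exp (s * θ) • e) = s • Complex.exp (s * θ) • e := by
    rw [map_smul, he, smul_comm]
  rw [h1, sub_self, map_zero, add_zero]

theorem solution_period (hx : x ∈ U) {ℓ : ℤ} {ξ : ℝ} (e : Sys n) :
    conjInv W x (2 * Real.pi)
      (Complex.exp ((((ℓ + ξ : ℝ) : ℂ) * Complex.I) * (2 * Real.pi : ℝ)) • e) =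
    Complex.exp (2 * Real.pi * ξ * Complex.I) • conjInv W x 0
      (Complex.exp ((((ℓ + ξ : ℝ) : ℂ) * Complex.I) * (0 : ℝ)) • e) := by
  have h1 := hr.conjInv_periodic hx 0
  rw [zero_add] at h1
  have h2 : Complex.exp ((((ℓ + ξ : ℝ) : ℂ) * Complex.I) * (2 * Real.pi : ℝ)) =
      Complex.exp (2 * Real.pi * ξ * Complex.I) := by
    rw [show (((ℓ + ξ : ℝ) : ℂ) * Complex.I) * (2 * Real.pi : ℝ) =
      2 * Real.pi * ξ * Complex.I + ℓ * (2 * Real.pi * Complex.I) by push_cast; ring,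
      Complex.exp_add, Complex.exp_int_mul_two_pi_mul_I, mul_one]
  rw [h1, h2]
  simp

/-- An imaginary eigenvalue `i(ℓ + ξ)` of the averaged matrix makes the shift an eigenvalue of
`L_{ξ,0}`. -/
theorem isEigenvalue (hw : IsWaveFamily r f p ω Ω K) (hx : x ∈ U) {ℓ : ℤ} {ξ : ℝ} {e : Sys n}
    (he0 : e ≠ 0) (he : matOp (M₁ x) e = (((ℓ + ξ : ℝ) : ℂ) * Complex.I) • e) :
    IsEigenvalue (BlochGraph f p ω x.1 ξ (0 : RVec m)) (shift c x) := by
  set V : ℝ → Sys n := fun θ : ℝ =>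
    conjInv W x θ (Complex.exp ((((ℓ + ξ : ℝ) : ℂ) * Complex.I) * θ) • e) with hVdef
  have hV : ∀ θ, HasDerivAt V (matOp (symbolMatrix f p ω c x θ) (V θ)) θ :=
    hr.hasDerivAt_solution hx he
  refine ⟨fun θ => Complex.exp (-(ξ * Complex.I) * θ) • upper n (V θ), fun h => ?_, ?_⟩
  · have h1 : (fun θ => upper n (V θ)) =ᵐ[periodMeasure] 0 := by
      filter_upwards [h] with θ hθ
      exact (smul_eq_zero.mp hθ).resolve_left (Complex.exp_ne_zero _)
    have h2 := hw.eq_zero_of_upper (hr.dom x hx) hV h1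
    have h3 := hr.op_conjInv hx Real.pi
      (Complex.exp ((((ℓ + ξ : ℝ) : ℂ) * Complex.I) * Real.pi) • e)
    rw [show conjInv W x Real.pi
      (Complex.exp ((((ℓ + ξ : ℝ) : ℂ) * Complex.I) * Real.pi) • e) = 0 from h2, map_zero] at h3
    exact (smul_ne_zero (Complex.exp_ne_zero _) he0) h3.symm
  · have h1 := hw.blochGraph (c := c) (x := x) (g := fun _ => 0) (hr.dom x hx) continuous_const
      (fun θ => (hV θ).congr_deriv (by
        rw [smul_zero, show stack n 0 0 = 0 from Sys.ext_parts (by simp) (by simp), add_zero]))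
      (hr.solution_period hx e)
    simpa using h1

theorem re_shift_le (hw : IsWaveFamily r f p ω Ω K) (hx : x ∈ U) {c₀ : ℝ}
    (hdec : ∀ ξ ∈ Set.Icc (-1 / 2 : ℝ) (1 / 2), ∀ η : RVec m,
      ∀ z ∈ operatorSpectrum (BlochGraph f p ω x.1 ξ η), z.re ≤ -c₀ * (ξ ^ 2 + ‖η‖ ^ 2))
    {ℓ : ℤ} {ξ : ℝ} (hξ : |ξ| ≤ 1 / 2) {e : Sys n} (he0 : e ≠ 0)
    (he : matOp (M₁ x) e = (((ℓ + ξ : ℝ) : ℂ) * Complex.I) • e) :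
    (shift c x).re ≤ -c₀ * ξ ^ 2 := by
  have h1 := hdec ξ ⟨by linarith [(abs_le.mp hξ).1], (abs_le.mp hξ).2⟩ 0 (shift c x)
    (not_isResolventPoint (hr.isEigenvalue hw hx he0 he))
  simpa using h1

/-- For a shift in the closed right half plane, only the shift zero allows imaginary eigenvalues of
the averaged matrix, and these are integer multiples of `i`. -/
theorem shift_eq_zero (hw : IsWaveFamily r f p ω Ω K) (hs : DiffusivelyStable f p ω x.1)
    (hx : x ∈ U) (hre : 0 ≤ (shift c x).re) {σ : ℝ} {e : Sys n} (he0 : e ≠ 0)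
    (he : matOp (M₁ x) e = ((σ : ℂ) * Complex.I) • e) :
    shift c x = 0 ∧ ∃ ℓ : ℤ, σ = ℓ := by
  obtain ⟨c₀, hc₀, hdec⟩ := hs.decay
  have hσ : σ = ((round σ : ℤ) : ℝ) + (σ - round σ) := by ring
  have hle := hr.re_shift_le hw hx hdec (ℓ := round σ) (abs_sub_round σ) he0 (by rw [← hσ, he])
  have hsq : (σ - round σ) ^ 2 = 0 := by
    have h1 : 0 ≤ (σ - round σ) ^ 2 := sq_nonneg _
    by_contra hne
    have h2 : 0 < (σ - round σ) ^ 2 := lt_of_le_of_ne h1 (Ne.symm hne)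
    have := mul_pos hc₀ h2
    linarith
  have hint : σ = round σ := by linarith [pow_eq_zero_iff (two_ne_zero) |>.mp hsq]
  have hre0 : (shift c x).re = 0 := by
    rw [hsq, mul_zero] at hle
    exact le_antisymm hle hre
  refine ⟨?_, round σ, hint⟩
  by_contra hne
  have him : (shift c x).im ≠ 0 := fun h => hne (Complex.ext hre0 h)
  refine hs.no_other_imaginary _ him ?_
  have h1 := hr.isEigenvalue hw hx (ℓ := round σ) (ξ := 0) he0 (by rw [add_zero, ← hint, he])
  rwa [show ((shift c x).im : ℂ) * Complex.I = shift c x by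
    apply Complex.ext <;> simp [hre0]]

end IsFloquetReduction

end Spectrum

/-! ### The averaged matrix at zero shift -/

section PeriodicSolutions

variable {E : Type} [NormedAddCommGroup E] [NormedSpace ℂ E] [FiniteDimensional ℂ E]

/-- A linear autonomous system with a nontrivial `2π`-periodic solution has an eigenvalue in `iℤ`:
the initial values of periodic solutions form an invariant subspace. -/
theorem exists_int_eigenvalue {M : E →L[ℂ] E} {z : ℝ → E} (hz : ∀ θ, HasDerivAt z (M (z θ)) θ)
    (hper : z (2 * Real.pi) = z 0) (hz0 : ∃ θ, z θ ≠ 0) :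
    ∃ (ℓ : ℤ) (e : E), e ≠ 0 ∧ M e = ((ℓ : ℂ) * Complex.I) • e := by
  have huniq : ∀ {y w : ℝ → E}, (∀ θ, HasDerivAt y (M (y θ)) θ) →
      (∀ θ, HasDerivAt w (M (w θ)) θ) → y 0 = w 0 → y = w := fun hy hw h0 =>
    ODE_solution_unique_univ (v := fun _ => M) (s := fun _ => Set.univ) (t₀ := 0) (K := ‖M‖₊)
      (fun _ => M.lipschitz.lipschitzOnWith) (fun θ => ⟨hy θ, trivial⟩)
      (fun θ => ⟨hw θ, trivial⟩) h0
  -- the initial values of the periodic solutions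
  let Z : Submodule ℂ E :=
    { carrier := {v | ∃ y : ℝ → E,
        (∀ θ, HasDerivAt y (M (y θ)) θ) ∧ y (2 * Real.pi) = y 0 ∧ y 0 = v}
      add_mem' := by
        rintro _ _ ⟨y, hy, hp, rfl⟩ ⟨w, hw, hq, rfl⟩
        exact ⟨y + w, fun θ => ((hy θ).add (hw θ)).congr_deriv (by simp), by simp [hp, hq], rfl⟩
      zero_mem' := ⟨0, fun θ => (hasDerivAt_const θ (0 : E)).congr_deriv (by simp), rfl, rfl⟩
      smul_mem' := by
        rintro a _ ⟨y, hy, hp, rfl⟩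
        exact ⟨fun θ => a • y θ, fun θ => ((hy θ).const_smul a).congr_deriv (by simp),
          by simp [hp], rfl⟩ }
  have hinv : ∀ v ∈ Z, (M : E →ₗ[ℂ] E) v ∈ Z := by
    rintro _ ⟨y, hy, hp, rfl⟩
    exact ⟨fun θ => M (y θ), fun θ =>
      (M.restrictScalars ℝ).hasFDerivAt.comp_hasDerivAt θ (hy θ), by simp [hp], rfl⟩
  have hzZ : z 0 ∈ Z := ⟨z, hz, hper, rfl⟩
  have hz00 : z 0 ≠ 0 := by
    intro h
    have h1 : z = fun _ => 0 := huniq hz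
      (fun θ => (hasDerivAt_const θ (0 : E)).congr_deriv (by simp)) h
    obtain ⟨θ, hθ⟩ := hz0
    exact hθ (congrFun h1 θ)
  have : Nontrivial Z := ⟨⟨⟨z 0, hzZ⟩, 0, fun h => hz00 (congrArg Subtype.val h)⟩⟩
  obtain ⟨s, hs⟩ := Module.End.exists_eigenvalue ((M : E →ₗ[ℂ] E).restrict hinv)
  obtain ⟨e, he⟩ := hs.exists_hasEigenvector
  have heM : M (e : E) = s • (e : E) := congrArg Subtype.val he.apply_eq_smul
  have he0 : (e : E) ≠ 0 := fun h => he.2 (Subtype.ext h)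
  obtain ⟨y, hy, hp, hy0⟩ := e.2
  have h1 : y = fun θ : ℝ => Complex.exp (s * θ) • (e : E) := by
    refine huniq hy (fun θ => ?_) (by simp [hy0])
    have h1 : HasDerivAt (fun θ : ℝ => s * (θ : ℂ)) s θ := by
      simpa using (Complex.ofRealCLM.hasDerivAt (x := θ)).const_mul s
    exact (h1.cexp.smul_const (e : E)).congr_deriv (by rw [map_smul, heM, smul_smul])
  rw [h1] at hp
  simp only [Complex.ofReal_zero, mul_zero, Complex.exp_zero, one_smul] at hp
  have h2 : Complex.exp (s * (2 * Real.pi : ℝ)) = 1 := by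
    have h3 : (Complex.exp (s * (2 * Real.pi : ℝ)) - 1) • (e : E) = 0 := by
      rw [sub_smul, one_smul, hp, sub_self]
    exact sub_eq_zero.mp ((smul_eq_zero.mp h3).resolve_right he0)
  obtain ⟨ℓ, hℓ⟩ := Complex.exp_eq_one_iff.mp h2
  refine ⟨ℓ, e, he0, ?_⟩
  have hpi : (Real.pi : ℂ) ≠ 0 := by exact_mod_cast Real.pi_ne_zero
  rw [heM]
  congr 1
  push_cast at hℓ
  have h4 : (2 * Real.pi : ℂ) * (s - ℓ * Complex.I) = 0 := by linear_combination hℓ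
  exact sub_eq_zero.mp ((mul_eq_zero.mp h4).resolve_left (mul_ne_zero two_ne_zero hpi))

/-- Mixed partial derivatives commute, in the form needed to differentiate a linear system with
respect to a parameter. -/
theorem hasDerivAt_fderiv_fst {G : Type} [NormedAddCommGroup G] [NormedSpace ℝ G] {F H : ℝ × ℝ → G}
    {θ₀ : ℝ} {h' : G} (hF : ContDiffAt ℝ 2 F (0, θ₀))
    (hH : ∀ᶠ q in 𝓝 ((0 : ℝ), θ₀), HasDerivAt (fun s => F (q.1, s)) (H q) q.2)
    (h : HasDerivAt (fun t => H (t, θ₀)) h' 0) :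
    HasDerivAt (fun θ => fderiv ℝ F (0, θ) (1, 0)) h' θ₀ := by
  have hF' : DifferentiableAt ℝ (fderiv ℝ F) (0, θ₀) :=
    (hF.fderiv_right (m := 1) (by norm_num)).differentiableAt (by norm_num)
  have h1 : HasDerivAt (fun θ => fderiv ℝ F (0, θ) (1, 0))
      (fderiv ℝ (fderiv ℝ F) (0, θ₀) (0, 1) (1, 0)) θ₀ := by
    have hl : HasDerivAt (fun θ : ℝ => ((0 : ℝ), θ)) (0, 1) θ₀ :=
      (hasDerivAt_const _ _).prodMk (hasDerivAt_id θ₀)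
    have h2 := hF'.hasFDerivAt.comp_hasDerivAt θ₀ hl
    exact h2.clm_apply (hasDerivAt_const θ₀ ((1 : ℝ), (0 : ℝ))) |>.congr_deriv (by simp)
  have h2 : HasDerivAt (fun t => fderiv ℝ F (t, θ₀) (0, 1))
      (fderiv ℝ (fderiv ℝ F) (0, θ₀) (1, 0) (0, 1)) 0 := by
    have hl : HasDerivAt (fun t : ℝ => (t, θ₀)) (1, 0) 0 :=
      (hasDerivAt_id (0 : ℝ)).prodMk (hasDerivAt_const _ _)
    have h2 := hF'.hasFDerivAt.comp_hasDerivAt (0 : ℝ) hl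
    exact h2.clm_apply (hasDerivAt_const (0 : ℝ) ((0 : ℝ), (1 : ℝ))) |>.congr_deriv (by simp)
  have hsymm : fderiv ℝ (fderiv ℝ F) (0, θ₀) (0, 1) (1, 0) =
      fderiv ℝ (fderiv ℝ F) (0, θ₀) (1, 0) (0, 1) :=
    (hF.isSymmSndFDerivAt (by simp)).eq _ _
  have hev : ∀ᶠ q in 𝓝 ((0 : ℝ), θ₀), H q = fderiv ℝ F q (0, 1) := by
    filter_upwards [hH, hF.eventually (by simp)] with q hq hFq
    have hl : HasDerivAt (fun θ : ℝ => (q.1, θ)) (0, 1) q.2 :=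
      (hasDerivAt_const _ _).prodMk (hasDerivAt_id _)
    have h3 : HasFDerivAt F (fderiv ℝ F q) (q.1, q.2) :=
      (hFq.differentiableAt (by norm_num)).hasFDerivAt
    exact hq.unique (h3.comp_hasDerivAt q.2 hl)
  have hcont : Tendsto (fun t : ℝ => (t, θ₀)) (𝓝 0) (𝓝 ((0 : ℝ), θ₀)) :=
    (Continuous.prodMk_left θ₀).tendsto' _ _ rfl
  have h3 : h' = fderiv ℝ (fderiv ℝ F) (0, θ₀) (1, 0) (0, 1) :=
    h.unique (h2.congr_of_eventuallyEq (hcont.eventually hev))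
  rw [h3, ← hsymm]
  exact h1

end PeriodicSolutions

section ZeroShift

variable {m n : ℕ} {r : ℕ∞} {f : RVec n → RVec n} {p : RVec (m + 1) → ℝ → RVec n}
  {ω : RVec (m + 1) → ℝ} {Ω K : Set (RVec (m + 1))} {c : RVec m} {U : Set (Freq m)}
  {W : Freq m → ℝ → Mat2 n} {M₁ : Freq m → Mat2 n} {x : Freq m} {k : RVec (m + 1)}

/-- Complexification of real vectors. -/
noncomputable def complexify (n : ℕ) : RVec n →L[ℝ] CVec n :=
  LinearMap.toContinuousLinearMap
    { toFun := fun v => WithLp.toLp 2 fun i => ((v i : ℝ) : ℂ)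
      map_add' := fun v w => by ext i; simp
      map_smul' := fun z v => by ext i; simp }

@[simp] theorem complexify_apply (v : RVec n) (i : Fin n) : complexify n v i = (v i : ℂ) := rfl

theorem jacOp_complexify (k : RVec (m + 1)) (θ : ℝ) (v : RVec n) :
    jacOp f p k θ (complexify n v) = complexify n (fderiv ℝ f (p k θ) v) := by
  ext i
  rw [jacOp_apply, complexify_apply]
  have h1 : v = ∑ j, v j • EuclideanSpace.single j (1 : ℝ) := by
    have h2 := (EuclideanSpace.basisFun (Fin n) ℝ).sum_repr v
    simpa using h2.symm
  conv_rhs => rw [h1]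
  simp [map_sum, mul_comm]

/-- The `θ`-derivative of the profile solves the linearized system at zero shift. -/
theorem IsWaveFamily.exists_periodic_solution (hw : IsWaveFamily r f p ω Ω K) (hr2 : 2 ≤ r)
    (hk : x.1 ∈ K) (hx0 : shift c x = 0) : ∃ V : ℝ → Sys n,
      (∀ θ, HasDerivAt V (matOp (symbolMatrix f p ω c x θ) (V θ)) θ) ∧
      V (2 * Real.pi) = V 0 ∧ ∃ θ, V θ ≠ 0 := by
  have hkΩ := hw.subset_dom hk
  have hk0 : ‖x.1‖ ≠ 0 := hw.norm_ne_zero hkΩ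
  have hr2' : (2 : WithTop ℕ∞) ≤ (r : WithTop ℕ∞) := WithTop.coe_le_coe.mpr hr2
  have hp2 : ContDiff ℝ 2 (p x.1) := (hw.contDiff_profile hkΩ).of_le hr2'
  have hp1 : ∀ θ, HasDerivAt (p x.1) (deriv (p x.1) θ) θ := fun θ =>
    (hp2.differentiable (by norm_num) θ).hasDerivAt
  have hp' : ContDiff ℝ 1 (deriv (p x.1)) :=
    ((contDiff_succ_iff_deriv (n := 1)).mp (by simpa [one_add_one_eq_two] using hp2)).2.2
  have hpd : ∀ θ, HasDerivAt (deriv (p x.1)) (deriv (deriv (p x.1)) θ) θ := fun θ =>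
    (hp'.differentiable (by norm_num) θ).hasDerivAt
  -- the profile equation determines the second derivative, which is therefore differentiable
  -- although the profile is only assumed to be `C²`
  have hpp : deriv (deriv (p x.1)) = fun θ =>
      (‖x.1‖⁻¹ ^ 2) • (ω x.1 • deriv (p x.1) θ + f (p x.1 θ)) := by
    funext θ
    rw [hw.profile_eq x.1 hk θ, smul_smul, ← mul_pow, inv_mul_cancel₀ hk0, one_pow, one_smul]
  have hfd : ∀ q, HasFDerivAt f (fderiv ℝ f q) q := fun q =>
    (hw.reaction_smooth.differentiable (by simp) q).hasFDerivAt
  have hppd : ∀ θ, HasDerivAt (deriv (deriv (p x.1))) ((‖x.1‖⁻¹ ^ 2) •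
      (ω x.1 • deriv (deriv (p x.1)) θ + fderiv ℝ f (p x.1 θ) (deriv (p x.1) θ))) θ := by
    intro θ
    rw [hpp]
    have h1 := (((hpd θ).const_smul (ω x.1)).add ((hfd _).comp_hasDerivAt θ (hp1 θ))).const_smul
      (‖x.1‖⁻¹ ^ 2)
    rw [hpp] at h1
    exact h1
  have hper1 : Function.Periodic (deriv (p x.1)) (2 * Real.pi) := by
    intro θ
    rw [← deriv_comp_add_const, show (fun y => p x.1 (y + 2 * Real.pi)) = p x.1 from
      funext (hw.periodic x.1 hkΩ)]
  have hper2 : Function.Periodic (deriv (deriv (p x.1))) (2 * Real.pi) := by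
    intro θ
    simp only [hpp, hper1 θ, hw.periodic x.1 hkΩ θ]
  refine ⟨fun θ => stackL n (complexify n (deriv (p x.1) θ),
    ‖x.1‖ • complexify n (deriv (deriv (p x.1)) θ)), fun θ => ?_, ?_, ?_⟩
  · have h1 := (stackL n).hasFDerivAt.comp_hasDerivAt θ
      (((complexify n).hasFDerivAt.comp_hasDerivAt θ (hpd θ)).prodMk
        (((complexify n).hasFDerivAt.comp_hasDerivAt θ (hppd θ)).const_smul ‖x.1‖))
    refine h1.congr_deriv (Sys.ext_parts ?_ ?_)
    · rw [upper_symbol]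
      simp only [stackL_apply, upper_stack, lower_stack]
      rw [Complex.coe_smul, smul_smul, inv_mul_cancel₀ hk0, one_smul]
    · rw [lower_symbol]
      simp only [stackL_apply, upper_stack, lower_stack, hx0, jacOp_complexify, zero_smul,
        zero_add, Complex.coe_smul, map_smul, map_add, smul_add, smul_smul]
      rw [add_comm]
      congr 2 <;> field_simp
  · have h1 := hper1 0
    have h2 := hper2 0
    rw [zero_add] at h1 h2
    simp only [h1, h2]
  · obtain ⟨θ, hθ⟩ := hw.nontrivial x.1 hk
    refine ⟨θ, fun h => hθ ?_⟩
    have h1 : complexify n (deriv (p x.1) θ) = 0 := by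
      have := congrArg (upper n) h
      simpa using this
    ext i
    have := congrArg (fun u : CVec n => u i) h1
    simpa using this

/-- At zero shift, periodic solutions of the inhomogeneous system give pairs in the graph of
`L_{0,0}`. -/
theorem IsWaveFamily.blochGraph_periodic (hw : IsWaveFamily r f p ω Ω K) (hx : x.1 ∈ Ω)
    (hx0 : shift c x = 0) {V : ℝ → Sys n} {g : ℝ → CVec n} (hg : Continuous g)
    (hV : ∀ θ, HasDerivAt V (matOp (symbolMatrix f p ω c x θ) (V θ) +
      stack n 0 (((‖x.1‖⁻¹ : ℝ) : ℂ) • g θ)) θ)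
    (hper : V (2 * Real.pi) = V 0) :
    BlochGraph f p ω x.1 0 (0 : RVec m) (fun θ => upper n (V θ))
      (fun θ => (0 : ℂ) • upper n (V θ) + g θ) := by
  have h := hw.blochGraph hx hg hV (ξ := 0) (by simpa using hper)
  simpa [hx0] using h

theorem IsWaveFamily.inGenEigenspace_one (hw : IsWaveFamily r f p ω Ω K) (hx : x.1 ∈ Ω)
    (hx0 : shift c x = 0) {V : ℝ → Sys n}
    (hV : ∀ θ, HasDerivAt V (matOp (symbolMatrix f p ω c x θ) (V θ)) θ)
    (hper : V (2 * Real.pi) = V 0) :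
    InGenEigenspace (BlochGraph f p ω x.1 0 (0 : RVec m)) 0 1 (fun θ => upper n (V θ)) := by
  refine ⟨fun _ => 0, hw.blochGraph_periodic hx hx0 continuous_const (fun θ => ?_) hper,
    EventuallyEq.rfl⟩
  rw [smul_zero, show stack n 0 0 = 0 from Sys.ext_parts (by simp) (by simp), add_zero]
  exact hV θ

/-- At zero shift, the periodic solutions of the first-order system form a line. -/
theorem IsWaveFamily.exists_smul_eq (hw : IsWaveFamily r f p ω Ω K) (hx : x.1 ∈ Ω)
    (hs : DiffusivelyStable f p ω x.1) (hx0 : shift c x = 0) {V V' : ℝ → Sys n}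
    (hV : ∀ θ, HasDerivAt V (matOp (symbolMatrix f p ω c x θ) (V θ)) θ)
    (hper : V (2 * Real.pi) = V 0) (hV0 : V Real.pi ≠ 0)
    (hV' : ∀ θ, HasDerivAt V' (matOp (symbolMatrix f p ω c x θ) (V' θ)) θ)
    (hper' : V' (2 * Real.pi) = V' 0) : ∃ z : ℂ, V' Real.pi = z • V Real.pi := by
  obtain ⟨v₀, -, -, hspan⟩ := hs.simple_zero
  obtain ⟨a, ha⟩ := hspan 1 _ (hw.inGenEigenspace_one hx hx0 hV hper)
  obtain ⟨b, hb⟩ := hspan 1 _ (hw.inGenEigenspace_one hx hx0 hV' hper')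
  have ha0 : a ≠ 0 := by
    rintro rfl
    refine hV0 (hw.eq_zero_of_upper hx hV ?_)
    filter_upwards [ha] with θ hθ
    simpa using hθ
  have h1 := hw.eq_zero_of_upper hx (c := c) (V := fun θ => a • V' θ - b • V θ)
    (fun θ => (((hV' θ).const_smul a).sub ((hV θ).const_smul b)).congr_deriv (by simp)) (by
      filter_upwards [ha, hb] with θ h1 h2
      simp only [map_sub, map_smul, h1, h2, Pi.zero_apply]
      module)
  refine ⟨a⁻¹ * b, ?_⟩
  rw [mul_smul, ← sub_eq_zero.mp h1, smul_smul, inv_mul_cancel₀ ha0, one_smul]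

/-- At zero shift, there is no Jordan chain of length two of periodic functions: `0` is an
algebraically simple eigenvalue of `L_{0,0}`. -/
theorem IsWaveFamily.no_jordan_chain (hw : IsWaveFamily r f p ω Ω K) (hx : x.1 ∈ Ω)
    (hs : DiffusivelyStable f p ω x.1) (hx0 : shift c x = 0) {V V' : ℝ → Sys n}
    (hV : ∀ θ, HasDerivAt V (matOp (symbolMatrix f p ω c x θ) (V θ)) θ)
    (hper : V (2 * Real.pi) = V 0) (hV0 : V Real.pi ≠ 0)
    (hV' : ∀ θ, HasDerivAt V' (matOp (symbolMatrix f p ω c x θ) (V' θ) +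
      stack n 0 (((‖x.1‖⁻¹ : ℝ) : ℂ) • upper n (V θ))) θ)
    (hper' : V' (2 * Real.pi) = V' 0) : False := by
  have hVc : Continuous V := continuous_iff_continuousAt.mpr fun θ => (hV θ).continuousAt
  obtain ⟨v₀, -, -, hspan⟩ := hs.simple_zero
  have hg1 := hw.inGenEigenspace_one hx hx0 hV hper
  obtain ⟨a, ha⟩ := hspan 1 _ hg1
  obtain ⟨b, hb⟩ := hspan 2 _ ⟨_, hw.blochGraph_periodic hx hx0 (g := fun θ => upper n (V θ))
    ((upper n).continuous.comp hVc) hV' hper', hg1⟩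
  have ha0 : a ≠ 0 := by
    rintro rfl
    refine hV0 (hw.eq_zero_of_upper hx hV ?_)
    filter_upwards [ha] with θ hθ
    simpa using hθ
  -- Simplicity makes `a V' - b V` have vanishing upper component. Its equation then forces the
  -- lower component to vanish too, and leaves the inhomogeneity `a V`, so `V = 0`.
  set D : ℝ → Sys n := fun θ => a • V' θ - b • V θ with hD
  have hDd : ∀ θ, HasDerivAt D (matOp (symbolMatrix f p ω c x θ) (D θ) +
      stack n 0 (((‖x.1‖⁻¹ : ℝ) : ℂ) • a • upper n (V θ))) θ := fun θ =>
    (((hV' θ).const_smul a).sub ((hV θ).const_smul b)).congr_deriv (by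
      have h1 : a • stack n 0 (((‖x.1‖⁻¹ : ℝ) : ℂ) • upper n (V θ)) =
          stack n 0 (((‖x.1‖⁻¹ : ℝ) : ℂ) • a • upper n (V θ)) :=
        Sys.ext_parts (by simp) (by simp only [map_smul, lower_stack]; rw [smul_comm])
      rw [smul_add, h1, hD, map_sub, map_smul, map_smul]
      abel)
  have hDc : Continuous D := continuous_iff_continuousAt.mpr fun θ => (hDd θ).continuousAt
  have hpi := Real.pi_pos
  have h1 : Set.EqOn (fun θ => upper n (D θ)) (fun _ => 0) (Set.Ioc 0 (2 * Real.pi)) := by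
    refine Measure.eqOn_Ioc_of_ae_eq (μ := volume) ?_
      ((upper n).continuous.comp hDc).continuousOn continuousOn_const
    have h2 : (fun θ => upper n (D θ)) =ᵐ[periodMeasure] fun _ => 0 := by
      filter_upwards [ha, hb] with θ h1 h2
      simp only [hD, map_sub, map_smul, h1, h2]
      module
    exact h2
  have hk0 : ((‖x.1‖⁻¹ : ℝ) : ℂ) ≠ 0 := by
    exact_mod_cast inv_ne_zero (hw.norm_ne_zero hx)
  -- The spanning property holds almost everywhere on one period, so that derivatives are
  -- compared on its interior.
  have hD0 : ∀ θ ∈ Set.Ioo 0 (2 * Real.pi), D θ = 0 := by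
    intro θ hθ
    have h2 : (fun θ => upper n (D θ)) =ᶠ[𝓝 θ] fun _ => 0 := by
      filter_upwards [Ioo_mem_nhds hθ.1 hθ.2] with τ hτ using h1 ⟨hτ.1, hτ.2.le⟩
    have h3 := ((upper n).restrictScalars ℝ).hasFDerivAt.comp_hasDerivAt θ (hDd θ)
    have h4 := (h3.congr_of_eventuallyEq h2.symm).unique (hasDerivAt_const _ _)
    rw [ContinuousLinearMap.coe_restrictScalars', map_add, upper_symbol, upper_stack,
      add_zero] at h4
    exact Sys.ext_parts (by rw [map_zero]; exact h2.self_of_nhds)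
      (by rw [map_zero, (smul_eq_zero.mp h4).resolve_left hk0])
  refine hV0 (hw.eq_zero_of_upper hx hV ?_)
  have h5 : ∀ θ ∈ Set.Ioo 0 (2 * Real.pi), upper n (V θ) = 0 := by
    intro θ hθ
    have h2 : D =ᶠ[𝓝 θ] fun _ => 0 := by
      filter_upwards [Ioo_mem_nhds hθ.1 hθ.2] with τ hτ using hD0 τ hτ
    have h4 := ((hDd θ).congr_of_eventuallyEq h2.symm).unique (hasDerivAt_const _ _)
    rw [hD0 θ hθ, map_zero, zero_add] at h4
    have h5 := congrArg (lower n) h4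
    rw [lower_stack, map_zero] at h5
    exact (smul_eq_zero.mp ((smul_eq_zero.mp h5).resolve_left hk0)).resolve_left ha0
  have h6 : Set.EqOn (fun θ => upper n (V θ)) (fun _ => 0) (Set.Icc 0 (2 * Real.pi)) := by
    rw [← closure_Ioo (by positivity)]
    exact (show Set.EqOn (fun θ => upper n (V θ)) (fun _ => 0) _ from h5).closure
      ((upper n).continuous.comp hVc) continuous_const
  exact (ae_restrict_iff' measurableSet_Ioc).mpr
    (Eventually.of_forall fun θ hθ => h6 ⟨hθ.1.le, hθ.2⟩)

end ZeroShift

section Exponents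

variable {m n : ℕ} {r : ℕ∞} {f : RVec n → RVec n} {p : RVec (m + 1) → ℝ → RVec n}
  {ω : RVec (m + 1) → ℝ} {Ω K : Set (RVec (m + 1))} {c : RVec m} {U : Set (Freq m)}
  {W : Freq m → ℝ → Mat2 n} {M₁ : Freq m → Mat2 n} {x : Freq m}

namespace IsFloquetReduction

variable (hr : IsFloquetReduction r f p ω Ω c U W M₁)
include hr

theorem solution_periodic (hx : x ∈ U) (ℓ : ℤ) (e : Sys n) :
    conjInv W x (2 * Real.pi) (Complex.exp ((ℓ * Complex.I) * (2 * Real.pi : ℝ)) • e) =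
      conjInv W x 0 (Complex.exp ((ℓ * Complex.I) * (0 : ℝ)) • e) := by
  have h := hr.solution_period hx (ℓ := ℓ) (ξ := 0) e
  simpa using h

theorem solution_ne_zero (hx : x ∈ U) {s : ℂ} {e : Sys n} (he : e ≠ 0) (θ : ℝ) :
    conjInv W x θ (Complex.exp (s * θ) • e) ≠ 0 := by
  intro h
  have h3 := hr.op_conjInv hx θ (Complex.exp (s * θ) • e)
  rw [h, map_zero] at h3
  exact smul_ne_zero (Complex.exp_ne_zero _) he h3.symm

/-- At zero shift the averaged matrix has an eigenvalue in `iℤ`, coming from the `θ`-derivative of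
the profile. -/
theorem exists_exponent (hw : IsWaveFamily r f p ω Ω K) (hr2 : 2 ≤ r) (hx : x ∈ U) (hk : x.1 ∈ K)
    (hx0 : shift c x = 0) :
    ∃ (ℓ : ℤ) (e : Sys n), e ≠ 0 ∧ matOp (M₁ x) e = ((ℓ : ℂ) * Complex.I) • e := by
  obtain ⟨V, hV, hper, θ₀, hθ₀⟩ := hw.exists_periodic_solution (c := c) hr2 hk hx0
  refine exists_int_eigenvalue (z := fun θ => matOp (W x θ) (V θ)) (fun θ => ?_) ?_
    ⟨θ₀, fun h => ?_⟩
  · refine ((hr.hasDerivAt_op hx θ).clmApply (hV θ)).congr_deriv ?_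
    simp
  · have h1 := hr.periodic x hx 0
    rw [zero_add] at h1
    simp only [hper, h1]
  · refine hθ₀ ?_
    rw [← hr.conjInv_op hx θ₀ (V θ₀), h, map_zero]

/-- At zero shift the averaged matrix has only one eigenvalue in `iℤ`, with one eigenvector. -/
theorem exponent_unique (hw : IsWaveFamily r f p ω Ω K) (hs : DiffusivelyStable f p ω x.1)
    (hx : x ∈ U) (hx0 : shift c x = 0) {ℓ ℓ' : ℤ} {e e' : Sys n} (he0 : e ≠ 0)
    (he : matOp (M₁ x) e = ((ℓ : ℂ) * Complex.I) • e)
    (he' : matOp (M₁ x) e' = ((ℓ' : ℂ) * Complex.I) • e') : ∃ z : ℂ, e' = z • e := by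
  obtain ⟨z, hz⟩ := hw.exists_smul_eq (hr.dom x hx) hs hx0 (hr.hasDerivAt_solution hx he)
    (hr.solution_periodic hx ℓ e) (hr.solution_ne_zero hx he0 _) (hr.hasDerivAt_solution hx he')
    (hr.solution_periodic hx ℓ' e')
  have h1 := congrArg (matOp (W x Real.pi)) hz
  rw [hr.op_conjInv hx, map_smul (matOp (W x Real.pi)) z, hr.op_conjInv hx, smul_smul] at h1
  refine ⟨(Complex.exp ((ℓ' * Complex.I) * Real.pi))⁻¹ *
    (z * Complex.exp ((ℓ * Complex.I) * Real.pi)), ?_⟩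
  rw [mul_smul, ← h1, smul_smul, inv_mul_cancel₀ (Complex.exp_ne_zero _), one_smul]

end IsFloquetReduction

/-- The derivative of the symbol with respect to `λ`. -/
noncomputable def symbolDeriv (k : RVec (m + 1)) (n : ℕ) : Sys n →L[ℂ] Sys n :=
  LinearMap.toContinuousLinearMap
    { toFun := fun v => stack n 0 (((‖k‖⁻¹ : ℝ) : ℂ) • upper n v)
      map_add' := fun v w => Sys.ext_parts (by simp) (by simp)
      map_smul' := fun z v => Sys.ext_parts (by simp) (by
        simp only [map_smul, lower_stack, RingHom.id_apply]; rw [smul_comm]) }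

theorem symbolDeriv_apply (k : RVec (m + 1)) (v : Sys n) :
    symbolDeriv k n v = stack n 0 (((‖k‖⁻¹ : ℝ) : ℂ) • upper n v) := rfl

/-- The line of frequency points through `x` in the direction `δ` of the variable `λ`. -/
noncomputable def lamLine (x : Freq m) (δ : ℂ) (t : ℝ) : Freq m := (x.1, x.2.1 + t • δ, x.2.2)

theorem lamLine_zero (x : Freq m) (δ : ℂ) : lamLine x δ 0 = x := by simp [lamLine]

theorem contDiff_lamLine (x : Freq m) (δ : ℂ) {N : WithTop ℕ∞} : ContDiff ℝ N (lamLine x δ) := by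
  unfold lamLine
  fun_prop

theorem symbol_lamLine (x : Freq m) (δ : ℂ) (t θ : ℝ) :
    matOp (symbolMatrix f p ω c (lamLine x δ t) θ) =
      matOp (symbolMatrix f p ω c x θ) + t • (δ • symbolDeriv x.1 n) := by
  ext1 v
  have hsh : shift c (lamLine x δ t) = shift c x + t • δ := by
    simp only [shift, lamLine]; ring
  refine Sys.ext_parts ?_ ?_
  · rw [_root_.add_apply, map_add, upper_symbol, upper_symbol]
    simp only [lamLine, _root_.smul_apply, symbolDeriv_apply]
    have h1 : upper n (t • δ • stack n 0 (((‖x.1‖⁻¹ : ℝ) : ℂ) • upper n v)) = 0 := by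
      rw [← Complex.coe_smul, map_smul, map_smul, upper_stack, smul_zero, smul_zero]
    rw [h1, add_zero]
  · rw [_root_.add_apply, map_add, lower_symbol, lower_symbol, hsh]
    simp only [lamLine, _root_.smul_apply, symbolDeriv_apply]
    have h1 : lower n (t • δ • stack n 0 (((‖x.1‖⁻¹ : ℝ) : ℂ) • upper n v)) =
        (t : ℂ) • δ • ((‖x.1‖⁻¹ : ℝ) : ℂ) • upper n v := by
      rw [← Complex.coe_smul, map_smul, map_smul, lower_stack]
    rw [h1, ← Complex.coe_smul (x := t) (y := δ), smul_eq_mul]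
    module

namespace IsFloquetReduction

variable (hr : IsFloquetReduction r f p ω Ω c U W M₁)
include hr

/-- The `λ`-derivative of the averaged matrix, and the equation satisfied by `R = (∂_λ W) W⁻¹`. -/
theorem exists_conj_deriv (hr2 : 2 ≤ r) (hx : x ∈ U) (δ : ℂ) :
    ∃ (D : Sys n →L[ℂ] Sys n) (R : ℝ → Sys n →L[ℂ] Sys n),
      HasDerivAt (fun t => matOp (M₁ (lamLine x δ t))) D 0 ∧ R (2 * Real.pi) = R 0 ∧
      ∀ θ, HasDerivAt R (D + matOp (M₁ x) ∘L R θ - R θ ∘L matOp (M₁ x) -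
        δ • (matOp (W x θ) ∘L symbolDeriv x.1 n ∘L conjInv W x θ)) θ := by
  have hr2' : (2 : WithTop ℕ∞) ≤ (r : WithTop ℕ∞) := WithTop.coe_le_coe.mpr hr2
  set F : ℝ × ℝ → Sys n →L[ℂ] Sys n := fun q => matOp (W (lamLine x δ q.1) q.2) with hF
  have hlU : ∀ᶠ t in 𝓝 (0 : ℝ), lamLine x δ t ∈ U :=
    (contDiff_lamLine x δ (N := 0)).continuous.continuousAt.eventually_mem
      (hr.isOpen.mem_nhds (by rwa [lamLine_zero]))
  have hFs : ∀ θ, ContDiffAt ℝ 2 F (0, θ) := by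
    intro θ
    have h1 : ContDiffAt ℝ 2 (fun q : Freq m × ℝ => W q.1 q.2) (lamLine x δ 0, θ) :=
      (hr.smooth_conj.contDiffAt ((hr.isOpen.prod isOpen_univ).mem_nhds
        ⟨by rwa [lamLine_zero], trivial⟩)).of_le hr2'
    have h2 : ContDiffAt ℝ 2 (fun q : ℝ × ℝ => (lamLine x δ q.1, q.2)) (0, θ) :=
      (((contDiff_lamLine x δ).comp contDiff_fst).prodMk contDiff_snd).contDiffAt
    exact (matOpL n).contDiff.contDiffAt.comp ((0 : ℝ), θ)
      (ContDiffAt.comp (g := fun q : Freq m × ℝ => W q.1 q.2) ((0 : ℝ), θ) h1 h2)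
  have hM : ContDiffAt ℝ 2 (fun t => matOp (M₁ (lamLine x δ t))) 0 := by
    have h1 : ContDiffAt ℝ 2 M₁ (lamLine x δ 0) :=
      (hr.smooth_avg.contDiffAt (hr.isOpen.mem_nhds (by rwa [lamLine_zero]))).of_le hr2'
    exact (matOpL n).contDiff.contDiffAt.comp (0 : ℝ)
      (ContDiffAt.comp (0 : ℝ) h1 (contDiff_lamLine x δ).contDiffAt)
  set D := deriv (fun t => matOp (M₁ (lamLine x δ t))) 0 with hD
  have hMd : HasDerivAt (fun t => matOp (M₁ (lamLine x δ t))) D 0 :=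
    (hM.differentiableAt (by norm_num)).hasDerivAt
  have hFt : ∀ θ, HasDerivAt (fun t => F (t, θ)) (fderiv ℝ F (0, θ) (1, 0)) 0 := by
    intro θ
    have hl : HasDerivAt (fun t : ℝ => (t, θ)) (1, 0) 0 :=
      (hasDerivAt_id (0 : ℝ)).prodMk (hasDerivAt_const _ _)
    exact ((hFs θ).differentiableAt (by norm_num)).hasFDerivAt.comp_hasDerivAt (0 : ℝ) hl
  -- differentiate the conjugation equation in `λ` along the line, and exchange derivatives
  have hQ : ∀ θ, HasDerivAt (fun θ => fderiv ℝ F (0, θ) (1, 0))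
      (D ∘L matOp (W x θ) + matOp (M₁ x) ∘L fderiv ℝ F (0, θ) (1, 0) -
        fderiv ℝ F (0, θ) (1, 0) ∘L matOp (symbolMatrix f p ω c x θ) -
        matOp (W x θ) ∘L (δ • symbolDeriv x.1 n)) θ := by
    intro θ
    refine hasDerivAt_fderiv_fst (hFs θ)
      (H := fun q => matOp (M₁ (lamLine x δ q.1)) ∘L F q -
        F q ∘L (matOp (symbolMatrix f p ω c x q.2) + q.1 • (δ • symbolDeriv x.1 n))) ?_ ?_
    · have h1 : ∀ᶠ q : ℝ × ℝ in 𝓝 (0, θ), lamLine x δ q.1 ∈ U :=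
        (continuous_fst.tendsto' ((0 : ℝ), θ) 0 rfl).eventually hlU
      filter_upwards [h1] with q hq
      rw [← symbol_lamLine]
      exact hr.hasDerivAt_op hq q.2
    · have h1 : HasDerivAt (fun t : ℝ => matOp (symbolMatrix f p ω c x θ) +
          t • (δ • symbolDeriv x.1 n)) (δ • symbolDeriv x.1 n) 0 := by
        simpa using ((hasDerivAt_id (0 : ℝ)).smul_const (δ • symbolDeriv x.1 n)).const_add
          (matOp (symbolMatrix f p ω c x θ))
      refine ((hMd.clmComp (hFt θ)).sub ((hFt θ).clmComp h1)).congr_deriv ?_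
      have h2 : matOp (symbolMatrix f p ω c x θ) + (0 : ℝ) • (δ • symbolDeriv x.1 n) =
          matOp (symbolMatrix f p ω c x θ) := by ext1 v; simp
      rw [h2]
      simp only [hF, lamLine_zero]
      abel
  refine ⟨D, fun θ => fderiv ℝ F (0, θ) (1, 0) ∘L conjInv W x θ, hMd, ?_, fun θ => ?_⟩
  · have h1 := hr.conjInv_periodic hx 0
    rw [zero_add] at h1
    have h2 : fderiv ℝ F (0, 2 * Real.pi) (1, 0) = fderiv ℝ F (0, 0) (1, 0) := by
      refine (hFt _).unique ((hFt 0).congr_of_eventuallyEq ?_)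
      filter_upwards [hlU] with t ht
      have h3 := hr.periodic _ ht 0
      rw [zero_add] at h3
      simp only [hF, h3]
    simp only [h1, h2]
  · refine ((hQ θ).clmComp (hr.hasDerivAt_conjInv hx θ)).congr_deriv ?_
    ext1 v
    simp only [_root_.add_apply, _root_.sub_apply, ContinuousLinearMap.comp_apply,
      _root_.smul_apply, map_sub, map_smul, hr.op_conjInv hx]
    abel

/-- The eigenvalue `iℓ` of the averaged matrix at zero shift moves with nonzero speed in `λ`. -/
theorem transversal (hw : IsWaveFamily r f p ω Ω K) (hr2 : 2 ≤ r)
    (hs : DiffusivelyStable f p ω x.1) (hx : x ∈ U) (hx0 : shift c x = 0) {ℓ : ℤ} {e : Sys n}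
    (he0 : e ≠ 0) (he : matOp (M₁ x) e = ((ℓ : ℂ) * Complex.I) • e) {ρ : Sys n →L[ℂ] ℂ}
    (hρ0 : ρ ≠ 0) (hρ : ∀ v, ρ (matOp (M₁ x) v) = ((ℓ : ℂ) * Complex.I) * ρ v) :
    ∃ a : ℂ, a ≠ 0 ∧ ∀ δ : ℂ, HasDerivAt (fun t => ρ (matOp (M₁ (lamLine x δ t)) e)) (δ * a) 0 := by
  set s : ℂ := (ℓ : ℂ) * Complex.I with hsdef
  have hpi : (2 * Real.pi : ℂ) ≠ 0 := by exact_mod_cast Real.two_pi_pos.ne'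
  set h : ℝ → ℂ := fun θ => ρ (matOp (W x θ) (symbolDeriv x.1 n (conjInv W x θ e))) with hh
  have hWc : Continuous fun θ => matOp (W x θ) :=
    continuous_iff_continuousAt.mpr fun θ => (hr.hasDerivAt_op hx θ).continuousAt
  have hBc : Continuous (conjInv W x) :=
    continuous_iff_continuousAt.mpr fun θ => (hr.hasDerivAt_conjInv hx θ).continuousAt
  have hhc : Continuous h := ρ.continuous.comp (hWc.clm_apply
    ((symbolDeriv x.1 n).continuous.comp (hBc.clm_apply continuous_const)))
  -- integrate `ρ (R' e)` over a period
  have key : ∀ (δ : ℂ) (D : Sys n →L[ℂ] Sys n) (R : ℝ → Sys n →L[ℂ] Sys n),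
      R (2 * Real.pi) = R 0 →
      (∀ θ, HasDerivAt R (D + matOp (M₁ x) ∘L R θ - R θ ∘L matOp (M₁ x) -
        δ • (matOp (W x θ) ∘L symbolDeriv x.1 n ∘L conjInv W x θ)) θ) →
      ρ (D e) = δ * ((2 * Real.pi : ℂ)⁻¹ * ∫ θ in (0 : ℝ)..(2 * Real.pi), h θ) := by
    intro δ D R hRper hR
    have h1 : ∀ θ, HasDerivAt (fun θ => ρ (R θ e)) (ρ (D e) - δ * h θ) θ := by
      intro θ
      have h2 := (ρ.restrictScalars ℝ).hasFDerivAt.comp_hasDerivAt θ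
        ((hR θ).clmApply (hasDerivAt_const θ e))
      refine h2.congr_deriv ?_
      simp only [ContinuousLinearMap.coe_restrictScalars', map_zero, zero_add, _root_.add_apply,
        _root_.sub_apply, _root_.smul_apply, ContinuousLinearMap.comp_apply, map_add, map_sub,
        map_smul, he, hρ, smul_eq_mul, hh]
      ring
    have h2 := intervalIntegral.integral_eq_sub_of_hasDerivAt (a := 0) (b := 2 * Real.pi)
      (fun θ _ => h1 θ) ((by fun_prop : Continuous _).intervalIntegrable _ _)
    rw [hRper, sub_self, intervalIntegral.integral_sub (by simp)
      ((by fun_prop : Continuous _).intervalIntegrable _ _), intervalIntegral.integral_const,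
      intervalIntegral.integral_const_mul, sub_zero, ← Complex.coe_smul, smul_eq_mul] at h2
    push_cast at h2
    field_simp
    linear_combination h2
  refine ⟨(2 * Real.pi : ℂ)⁻¹ * ∫ θ in (0 : ℝ)..(2 * Real.pi), h θ, fun ha => ?_, fun δ => ?_⟩
  · -- otherwise `∂_λ M₁ e` is in the range of `M₁ - iℓ`, which gives a Jordan chain
    obtain ⟨D, R, -, hRper, hR⟩ := hr.exists_conj_deriv hr2 hx 1
    have hρD := key 1 D R hRper hR
    rw [ha, mul_zero] at hρD
    set N₀ : Sys n →L[ℂ] Sys n := matOp (M₁ x) - s • ContinuousLinearMap.id ℂ (Sys n) with hN₀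
    have hN₀v : ∀ v, N₀ v = matOp (M₁ x) v - s • v := fun v => by simp [hN₀]
    obtain ⟨ρ₁, -, -, hrange, hmult⟩ := exists_left_null (A := N₀) he0
      (by rw [hN₀v, he, sub_self]) (fun v hv => by
        rw [hN₀v] at hv
        exact hr.exponent_unique hw hs hx hx0 he0 he (sub_eq_zero.mp hv))
    obtain ⟨z₀, hz₀⟩ := hmult ρ (fun v => by
      rw [hN₀v, map_sub, hρ, map_smul, smul_eq_mul, sub_self])
    have hz₀0 : z₀ ≠ 0 := by
      rintro rfl
      exact hρ0 (by rw [hz₀]; ext v; simp)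
    have hρ₁D : ρ₁ (D e) = 0 := by
      rw [hz₀, _root_.smul_apply, smul_eq_mul] at hρD
      exact (mul_eq_zero.mp hρD).resolve_left hz₀0
    obtain ⟨z, hz⟩ := hrange _ hρ₁D
    rw [hN₀v] at hz
    have hV := hr.hasDerivAt_solution hx he
    have hy : ∀ θ, HasDerivAt (fun θ : ℝ => Complex.exp (s * θ) • -(R θ e + z)) _ θ := fun θ =>
      (show HasDerivAt (fun θ : ℝ => Complex.exp (s * θ)) (s * Complex.exp (s * θ)) θ by
        simpa [smul_eq_mul] using hasDerivAt_exponential s (1 : ℂ) θ).complexSMul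
        ((((hR θ).clmApply (hasDerivAt_const θ e)).add_const z).neg)
    refine hw.no_jordan_chain (c := c) (hr.dom x hx) hs hx0 hV (hr.solution_periodic hx ℓ e)
      (hr.solution_ne_zero hx he0 _)
      (fun θ => (hr.hasDerivAt_conjInv_apply hx (hy θ)).congr_deriv ?_) ?_
    · congr 1
      rw [← symbolDeriv_apply]
      apply (Function.LeftInverse.injective (hr.conjInv_op hx θ))
      rw [hr.op_conjInv hx]
      simp only [map_zero, zero_add, _root_.add_apply,
        _root_.sub_apply, ContinuousLinearMap.comp_apply, one_smul, map_smul, map_neg, map_add, he,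
        ← hz]
      module
    · have h1 := hr.conjInv_periodic hx 0
      rw [zero_add] at h1
      simp only [hRper, h1]
      rw [show Complex.exp (s * (2 * Real.pi : ℝ)) = 1 by
        rw [hsdef, show (ℓ : ℂ) * Complex.I * (2 * Real.pi : ℝ) = ℓ * (2 * Real.pi * Complex.I) by
          push_cast; ring, Complex.exp_int_mul_two_pi_mul_I]]
      simp
  · obtain ⟨D, R, hD, hRper, hR⟩ := hr.exists_conj_deriv hr2 hx δ
    rw [← key δ D R hRper hR]
    have h2 := (ρ.restrictScalars ℝ).hasFDerivAt.comp_hasDerivAt (0 : ℝ)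
      (hD.clmApply (hasDerivAt_const (0 : ℝ) e))
    exact h2.congr_deriv (by simp)

end IsFloquetReduction

end Exponents

/-! ### Symmetrizers near a frequency point -/

section Local

variable {m n : ℕ} {r : ℕ∞} {f : RVec n → RVec n} {p : RVec (m + 1) → ℝ → RVec n}
  {ω : RVec (m + 1) → ℝ} {Ω K : Set (RVec (m + 1))} {c : RVec m} {U : Set (Freq m)}
  {W : Freq m → ℝ → Mat2 n} {M₁ : Freq m → Mat2 n} {x₀ : Freq m}

theorem weight_eq (c : RVec m) (x : Freq m) :
    weight c x = (shift c x).re + (shift c x).im ^ 2 := by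
  have h1 : (shift c x).re = x.2.1.re + ‖x.2.2‖ ^ 2 := by
    simp only [shift, Complex.add_re, Complex.ofReal_re, Complex.mul_re, Complex.I_re,
      Complex.I_im, Complex.ofReal_im]
    ring
  have h2 : (shift c x).im = x.2.1.im + drift c x.2.2 := by
    simp only [shift, Complex.add_im, Complex.ofReal_re, Complex.mul_im, Complex.I_re,
      Complex.I_im, Complex.ofReal_im]
    ring
  rw [weight, h1, h2, sq_abs]
  ring

theorem re_shift_nonneg {x : Freq m} (hx : 0 ≤ x.2.1.re) : 0 ≤ (shift c x).re := by
  have h1 : (shift c x).re = x.2.1.re + ‖x.2.2‖ ^ 2 := by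
    simp only [shift, Complex.add_re, Complex.ofReal_re, Complex.mul_re, Complex.I_re,
      Complex.I_im, Complex.ofReal_im]
    ring
  rw [h1]
  positivity

theorem contDiff_drift (c : RVec m) {N : WithTop ℕ∞} : ContDiff ℝ N (drift c) := by
  unfold drift
  fun_prop

theorem contDiff_shift (c : RVec m) {N : WithTop ℕ∞} : ContDiff ℝ N (shift c) := by
  unfold shift
  have h1 : ContDiff ℝ N fun x : Freq m => ((drift c x.2.2 : ℝ) : ℂ) :=
    Complex.ofRealCLM.contDiff.comp ((contDiff_drift c).comp (contDiff_snd.comp contDiff_snd))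
  have h2 : ContDiff ℝ N fun x : Freq m => ((‖x.2.2‖ ^ 2 : ℝ) : ℂ) :=
    Complex.ofRealCLM.contDiff.comp ((contDiff_norm_sq ℝ).comp (contDiff_snd.comp contDiff_snd))
  exact ((contDiff_fst.comp contDiff_snd).add (contDiff_const.mul h1)).add h2

/-- The frequency point with given wave vector, transverse frequency and shift. -/
noncomputable def ofShift (c : RVec m) (q : (RVec (m + 1) × RVec m) × ℂ) : Freq m :=
  (q.1.1, q.2 - Complex.I * (drift c q.1.2 : ℂ) - ((‖q.1.2‖ ^ 2 : ℝ) : ℂ), q.1.2)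

theorem shift_ofShift (q : (RVec (m + 1) × RVec m) × ℂ) : shift c (ofShift c q) = q.2 := by
  simp only [shift, ofShift]
  ring

theorem ofShift_shift (x : Freq m) : ofShift c ((x.1, x.2.2), shift c x) = x := by
  ext1
  · rfl
  · ext1
    · simp only [shift, ofShift]
      ring
    · rfl

theorem contDiff_ofShift (c : RVec m) {N : WithTop ℕ∞} : ContDiff ℝ N (ofShift c) := by
  unfold ofShift
  have h0 : ContDiff ℝ N fun q : (RVec (m + 1) × RVec m) × ℂ => q.1.2 :=
    contDiff_snd.comp contDiff_fst
  have h1 : ContDiff ℝ N fun q : (RVec (m + 1) × RVec m) × ℂ => ((drift c q.1.2 : ℝ) : ℂ) :=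
    Complex.ofRealCLM.contDiff.comp ((contDiff_drift c).comp h0)
  have h2 : ContDiff ℝ N fun q : (RVec (m + 1) × RVec m) × ℂ => ((‖q.1.2‖ ^ 2 : ℝ) : ℂ) :=
    Complex.ofRealCLM.contDiff.comp ((contDiff_norm_sq ℝ).comp h0)
  exact (contDiff_fst.comp contDiff_fst).prodMk
    (((contDiff_snd.sub (contDiff_const.mul h1)).sub h2).prodMk h0)

/-- In the coordinates `((k, η), shift)`, the averaged matrix minus its eigenvalue in `iℤ` is
critical at zero shift. -/
theorem IsFloquetReduction.isCritical (hr : IsFloquetReduction r f p ω Ω c U W M₁)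
    (hw : IsWaveFamily r f p ω Ω K) (hr2 : 2 ≤ r) (hstab : ∀ k ∈ K, DiffusivelyStable f p ω k)
    (hx₀ : x₀ ∈ U) (hk₀ : x₀.1 ∈ K) (hs₀ : shift c x₀ = 0) {ℓ : ℤ} {e : Sys n} (he0 : e ≠ 0)
    (he : matOp (M₁ x₀) e = ((ℓ : ℂ) * Complex.I) • e) :
    IsCritical (fun q => matOp (M₁ (ofShift c q)) -
      ((ℓ : ℂ) * Complex.I) • ContinuousLinearMap.id ℂ (Sys n)) {κ | κ.1 ∈ K} (x₀.1, x₀.2.2) e := by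
  have hr2' : (2 : WithTop ℕ∞) ≤ (r : WithTop ℕ∞) := WithTop.coe_le_coe.mpr hr2
  have hst := hstab _ hk₀
  have hof : ofShift c ((x₀.1, x₀.2.2), 0) = x₀ := by
    rw [← hs₀]; exact ofShift_shift x₀
  have hsm : ContDiffAt ℝ 2 (fun q => matOp (M₁ (ofShift c q))) ((x₀.1, x₀.2.2), 0) := by
    have h1 : ContDiffAt ℝ 2 M₁ (ofShift c ((x₀.1, x₀.2.2), 0)) :=
      (hr.smooth_avg.contDiffAt (hr.isOpen.mem_nhds (by rwa [hof]))).of_le hr2'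
    exact (matOpL n).contDiff.contDiffAt.comp _
      (ContDiffAt.comp _ h1 (contDiff_ofShift c).contDiffAt)
  have hU : ∀ᶠ q in 𝓝 ((x₀.1, x₀.2.2), (0 : ℂ)), ofShift c q ∈ U :=
    (contDiff_ofShift c (N := 0)).continuous.continuousAt.eventually_mem
      (hr.isOpen.mem_nhds (by rwa [hof]))
  -- eigenvalues of the shifted matrix and of the averaged matrix
  have happ : ∀ (q : (RVec (m + 1) × RVec m) × ℂ) (z : ℂ) (v : Sys n),
      (matOp (M₁ (ofShift c q)) - ((ℓ : ℂ) * Complex.I) • ContinuousLinearMap.id ℂ (Sys n)) v =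
        z • v ↔ matOp (M₁ (ofShift c q)) v = ((ℓ : ℂ) * Complex.I + z) • v := by
    intro q z v
    rw [_root_.sub_apply, _root_.smul_apply, ContinuousLinearMap.id_apply, sub_eq_iff_eq_add,
      add_smul, add_comm]
  have happ0 : ∀ (q : (RVec (m + 1) × RVec m) × ℂ) (v : Sys n),
      (matOp (M₁ (ofShift c q)) - ((ℓ : ℂ) * Complex.I) • ContinuousLinearMap.id ℂ (Sys n)) v =
        0 ↔ matOp (M₁ (ofShift c q)) v = ((ℓ : ℂ) * Complex.I) • v := by
    intro q v
    rw [← zero_smul ℂ v, happ, add_zero]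
  have hcurve : Tendsto (fun κ : RVec (m + 1) × RVec m => (κ, (0 : ℂ))) (𝓝 (x₀.1, x₀.2.2))
      (𝓝 ((x₀.1, x₀.2.2), 0)) := (Continuous.prodMk_left (0 : ℂ)).tendsto' _ _ rfl
  -- the decay rate depends on the wave vector
  choose! c₀ hc₀ hdec using fun k hk => (hstab k hk).decay
  refine ⟨hk₀, hsm.sub contDiffAt_const, he0, ?_, ?_, ?_, ?_, ?_, ?_⟩
  · exact (happ0 _ _).mpr (by rw [hof, he])
  · intro v hv
    rw [happ0, hof] at hv
    exact hr.exponent_unique hw hst hx₀ hs₀ he0 he hv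
  · intro t v hv
    rw [happ, hof, show (ℓ : ℂ) * Complex.I + t * Complex.I = ((ℓ + t : ℝ) : ℂ) * Complex.I by
      push_cast; ring] at hv
    by_cases hv0 : v = 0
    · exact Or.inr hv0
    left
    -- every imaginary eigenvalue is in `iℤ`, and the one in `iℤ` is unique
    obtain ⟨-, ℓ', hℓ'⟩ := hr.shift_eq_zero hw hst hx₀ (by rw [hs₀]; simp) hv0 hv
    rw [hℓ', Complex.ofReal_intCast] at hv
    obtain ⟨z, rfl⟩ := hr.exponent_unique hw hst hx₀ hs₀ he0 he hv
    rw [map_smul, he, smul_comm z, ← sub_eq_zero, ← sub_smul] at hv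
    have h1 := (smul_eq_zero.mp hv).resolve_right hv0
    rw [← sub_mul] at h1
    have h2 := (mul_eq_zero.mp h1).resolve_right Complex.I_ne_zero
    have h3 : (ℓ : ℝ) = ℓ' := by exact_mod_cast sub_eq_zero.mp h2
    linarith
  · intro ρ hρ0 hρ
    obtain ⟨a, ha, had⟩ := hr.transversal hw hr2 hst hx₀ hs₀ he0 he hρ0 (fun v => by
      have h1 := hρ v
      rw [hof, _root_.sub_apply, map_sub, _root_.smul_apply, map_smul] at h1
      exact sub_eq_zero.mp h1)
    refine ⟨a, ha, fun δ => ?_⟩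
    have h1 := (had δ).sub_const (ρ (((ℓ : ℂ) * Complex.I) • e))
    have h2 : ∀ t : ℝ, ofShift c ((x₀.1, x₀.2.2), t • δ) = lamLine x₀ δ t := by
      intro t
      ext1
      · rfl
      · ext1
        · simp only [shift] at hs₀
          simp only [ofShift, lamLine]
          linear_combination (-1 : ℂ) * hs₀
        · rfl
    simp only [h2, _root_.sub_apply, _root_.smul_apply, map_sub, ContinuousLinearMap.id_apply]
    exact h1
  · -- near `κ₀` no integer other than `ℓ` can be an exponent
    set T : RVec (m + 1) × RVec m → Sys n →L[ℂ] Sys n := fun κ => matOp (M₁ (ofShift c (κ, 0)))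
      with hT
    have hTc : ContinuousAt T (x₀.1, x₀.2.2) := hsm.continuousAt.comp_of_eq
      (f := fun κ : RVec (m + 1) × RVec m => (κ, (0 : ℂ)))
      (Continuous.prodMk_left (0 : ℂ)).continuousAt rfl
    obtain ⟨B, hB⟩ := exists_nat_ge (‖T (x₀.1, x₀.2.2)‖ + 1)
    have hbd : ∀ᶠ κ in 𝓝 (x₀.1, x₀.2.2), ‖T κ‖ < B := by
      refine hTc.norm.eventually_lt continuousAt_const ?_
      linarith
    have hother : ∀ᶠ κ in 𝓝 (x₀.1, x₀.2.2), ∀ j ∈ Finset.Icc (-(B : ℤ)) B, j ≠ ℓ →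
        ∀ v, T κ v = ((j : ℂ) * Complex.I) • v → v = 0 := by
      refine (Finset.Icc (-(B : ℤ)) B).eventually_all.mpr fun j _ => ?_
      by_cases hj : j = ℓ
      · exact Eventually.of_forall fun κ hne => absurd hj hne
      obtain ⟨b, hb, hlow⟩ := eventually_lower_bound
        (T := fun κ => T κ - ((j : ℂ) * Complex.I) • ContinuousLinearMap.id ℂ (Sys n))
        (hTc.sub continuousAt_const) (fun v hv => by
          rw [_root_.sub_apply, _root_.smul_apply, ContinuousLinearMap.id_apply,
            show T (x₀.1, x₀.2.2) = matOp (M₁ x₀) from congrArg (fun y => matOp (M₁ y)) hof] at hv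
          have hv' := sub_eq_zero.mp hv
          by_contra hv0
          obtain ⟨z, rfl⟩ := hr.exponent_unique hw hst hx₀ hs₀ he0 he hv'
          rw [map_smul, he, smul_comm z, ← sub_eq_zero, ← sub_smul] at hv'
          have h1 := (smul_eq_zero.mp hv').resolve_right hv0
          rw [← sub_mul] at h1
          have h2 := (mul_eq_zero.mp h1).resolve_right Complex.I_ne_zero
          exact hj (by exact_mod_cast (sub_eq_zero.mp h2).symm))
      filter_upwards [hlow] with κ hκ _ v hv
      have h1 := hκ v
      rw [_root_.sub_apply, _root_.smul_apply, ContinuousLinearMap.id_apply, hv, sub_self,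
        norm_zero] at h1
      have h2 : ‖v‖ = 0 := by
        by_contra hne
        have := mul_pos hb (lt_of_le_of_ne (norm_nonneg v) (Ne.symm hne))
        linarith
      exact norm_eq_zero.mp h2
    filter_upwards [hbd, hother, hcurve.eventually hU] with κ h1 h2 hκU hκ
    obtain ⟨ℓ', e', he'0, he'⟩ := hr.exists_exponent hw hr2 hκU hκ (shift_ofShift _)
    have hle : |(ℓ' : ℝ)| * ‖e'‖ ≤ B * ‖e'‖ := by
      have h3 : ‖T κ e'‖ = |(ℓ' : ℝ)| * ‖e'‖ := by
        rw [hT, he', norm_smul, norm_mul, Complex.norm_I, mul_one, Complex.norm_intCast]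
      rw [← h3]
      exact (ContinuousLinearMap.le_opNorm _ _).trans
        (mul_le_mul_of_nonneg_right h1.le (norm_nonneg _))
    have hle' : |(ℓ' : ℝ)| ≤ B := le_of_mul_le_mul_right hle (norm_pos_iff.mpr he'0)
    have hmem : ℓ' ∈ Finset.Icc (-(B : ℤ)) B := by
      rw [Finset.mem_Icc]
      obtain ⟨h5, h6⟩ := abs_le.mp hle'
      exact ⟨by exact_mod_cast h5, by exact_mod_cast h6⟩
    have heq : ℓ' = ℓ := by
      by_contra hne
      exact he'0 (h2 ℓ' hmem hne e' he')
    exact ⟨e', he'0, (happ0 _ _).mpr (by rw [← heq]; exact he')⟩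
  · refine ⟨fun κ => c₀ κ.1, fun κ hκ => hc₀ _ hκ, ?_⟩
    filter_upwards [hU] with q hq hqK ξ hξ v hv0 hv
    rw [happ, show (ℓ : ℂ) * Complex.I + ξ * Complex.I = ((ℓ + ξ : ℝ) : ℂ) * Complex.I by
      push_cast; ring] at hv
    have h1 := hr.re_shift_le hw hq (hdec q.1.1 hqK) hξ hv0 hv
    rwa [shift_ofShift] at h1

/-- Every frequency point has a neighbourhood with a symmetrizer. -/
theorem IsFloquetReduction.exists_local_symmetrizer (hr : IsFloquetReduction r f p ω Ω c U W M₁)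
    (hw : IsWaveFamily r f p ω Ω K) (hr2 : 2 ≤ r) (hstab : ∀ k ∈ K, DiffusivelyStable f p ω k)
    (hx₀ : x₀ ∈ U) : ∃ S : Freq m → Sys n →L[ℂ] Sys n, ContDiffAt ℝ 1 S x₀ ∧
      (∀ x, IsSelfAdjoint (S x)) ∧ ∀ᶠ x in 𝓝 x₀, x.1 ∈ K → 0 ≤ x.2.1.re →
        ∀ v, weight c x * ‖v‖ ^ 2 ≤ (⟪v, S x (matOp (M₁ x) v)⟫_ℂ).re := by
  have hr2' : (2 : WithTop ℕ∞) ≤ (r : WithTop ℕ∞) := WithTop.coe_le_coe.mpr hr2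
  by_cases hk₀ : x₀.1 ∈ K
  swap
  -- nothing is required away from `K`
  · refine ⟨fun _ => 0, contDiffAt_const, fun _ => IsSelfAdjoint.zero (Sys n →L[ℂ] Sys n), ?_⟩
    filter_upwards [continuous_fst.continuousAt.eventually_mem
      (hw.isCompact.isClosed.isOpen_compl.mem_nhds hk₀)] with x hx hxK
    exact absurd hxK hx
  by_cases hγ₀ : 0 ≤ x₀.2.1.re
  swap
  -- nothing is required where `Re λ < 0`
  · refine ⟨fun _ => 0, contDiffAt_const, fun _ => IsSelfAdjoint.zero (Sys n →L[ℂ] Sys n), ?_⟩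
    have h1 : ContinuousAt (fun x : Freq m => x.2.1.re) x₀ := by fun_prop
    filter_upwards [h1.eventually_lt continuousAt_const (not_le.mp hγ₀)] with x hx _ hx'
    exact absurd hx' (not_le.mpr hx)
  have hM₁c : ContinuousAt (fun x => matOp (M₁ x)) x₀ :=
    (matOpL n).continuous.continuousAt.comp
      (hr.smooth_avg.continuousOn.continuousAt (hr.isOpen.mem_nhds hx₀))
  have hshc : Continuous (shift c) := (contDiff_shift c (N := 0)).continuous
  by_cases hs₀ : shift c x₀ = 0
  · obtain ⟨ℓ, e, he0, he⟩ := hr.exists_exponent hw hr2 hx₀ hk₀ hs₀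
    obtain ⟨S, hS, hSs, hSe⟩ := (hr.isCritical hw hr2 hstab hx₀ hk₀ hs₀ he0 he).hasLocalSymmetrizer
    set τ : Freq m → (RVec (m + 1) × RVec m) × ℂ := fun x => ((x.1, x.2.2), shift c x) with hτ
    have hτs : ContDiff ℝ 1 τ := (contDiff_fst.prodMk (contDiff_snd.comp contDiff_snd)).prodMk
      (contDiff_shift c)
    have hτ₀ : τ x₀ = ((x₀.1, x₀.2.2), 0) := by rw [← hs₀]
    refine ⟨fun x => S (τ x), (hτ₀ ▸ hS).comp x₀ hτs.contDiffAt, fun x => hSs _, ?_⟩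
    have h1 : Tendsto τ (𝓝 x₀) (𝓝 ((x₀.1, x₀.2.2), 0)) := hτ₀ ▸ hτs.continuous.tendsto x₀
    filter_upwards [h1.eventually hSe] with x hx hxK hxγ v
    have h2 := hx hxK (re_shift_nonneg hxγ) v
    rw [ofShift_shift, _root_.sub_apply, map_sub, inner_sub_right, Complex.sub_re,
      _root_.smul_apply, ContinuousLinearMap.id_apply, map_smul, inner_smul_right] at h2
    have h3 : (⟪v, S (τ x) v⟫_ℂ).im = 0 := (hSs (τ x)).isSymmetric.im_inner_self_apply v
    -- the multiple `iℓ` of the identity does not contribute to the real part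
    have h6 : ((ℓ : ℂ) * Complex.I * ⟪v, S (τ x) v⟫_ℂ).re = 0 := by
      simp [Complex.mul_re, Complex.mul_im, h3]
    rw [h6, sub_zero] at h2
    rw [weight_eq]
    exact h2
  · have hyp : IsHyperbolic (matOp (M₁ x₀)) := by
      intro t v hv
      by_contra hv0
      exact hs₀ (hr.shift_eq_zero hw (hstab _ hk₀) hx₀ (re_shift_nonneg hγ₀) hv0 hv).1
    obtain ⟨S, hS, hSe⟩ := eventually_lyapunov hM₁c hyp
    -- At nonzero shift there is no critical eigenvalue. The Lyapunov function is rescaled by a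
    -- bound of the weight.
    set b : ℝ := |weight c x₀| + 1 with hb
    have hbpos : 0 < b := by positivity
    have hwc : Continuous (weight c) := by
      have h1 : weight c = fun x => (shift c x).re + (shift c x).im ^ 2 := by
        funext x
        rw [weight_eq]
      rw [h1]
      exact (Complex.continuous_re.comp hshc).add ((Complex.continuous_im.comp hshc).pow 2)
    refine ⟨fun _ => ((2 * b : ℝ) : ℂ) • S, contDiffAt_const, fun _ => ?_, ?_⟩
    · exact IsSelfAdjoint.smul (Complex.conj_ofReal _) hS
    · filter_upwards [hSe, hwc.continuousAt.eventually_lt continuousAt_const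
        (show weight c x₀ < b by linarith [le_abs_self (weight c x₀)])] with x hx hxw _ _ v
      rw [_root_.smul_apply, inner_smul_right, Complex.re_ofReal_mul]
      have h1 := mul_le_mul_of_nonneg_left (hx v) (by positivity : 0 ≤ 2 * b)
      have h2 := mul_le_mul_of_nonneg_right hxw.le (sq_nonneg ‖v‖)
      linarith

end Local

/-! ### Gluing of local symmetrizers -/

section Gluing

open scoped Manifold in
/-- Local `C¹` solutions of a convex constraint on an open set can be glued. -/
theorem exists_contDiffOn_mem_convex {X F : Type} [NormedAddCommGroup X] [NormedSpace ℝ X]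
    [FiniteDimensional ℝ X] [NormedAddCommGroup F] [NormedSpace ℝ F] {U : Set X} (hU : IsOpen U)
    {t : X → Set F} (ht : ∀ x, Convex ℝ (t x))
    (hloc : ∀ x ∈ U, ∃ g : X → F, ContDiffAt ℝ 1 g x ∧ ∀ᶠ y in 𝓝 x, g y ∈ t y) :
    ∃ g : X → F, ContDiffOn ℝ 1 g U ∧ ∀ x ∈ U, g x ∈ t x := by
  let O : TopologicalSpace.Opens X := ⟨U, hU⟩
  have : ProperSpace X := FiniteDimensional.proper ℝ X
  have : LocallyCompactSpace O := hU.locallyCompactSpace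
  have : SigmaCompactSpace O := sigmaCompactSpace_of_locallyCompact_secondCountable
  obtain ⟨s, hs⟩ := exists_contMDiffMap_forall_mem_convex_of_local (n := 1) (I := 𝓘(ℝ, X)) (M := O)
    (t := fun x => t x) (fun x => ht x) (fun x => by
      obtain ⟨g, hg, hgt⟩ := hloc x x.2
      have h1 : ∀ᶠ y in 𝓝 (x : X), ContDiffAt ℝ 1 g y ∧ g y ∈ t y :=
        (hg.eventually (by simp)).and hgt
      refine ⟨{y | ContDiffAt ℝ 1 g (y : X) ∧ g y ∈ t y},
        continuous_subtype_val.continuousAt.eventually h1, fun y => g y, fun y hy => ?_,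
        fun y hy => hy.2⟩
      exact (contMDiffAt_subtype_iff.mpr hy.1.contMDiffAt).contMDiffWithinAt)
  classical
  refine ⟨fun x => if h : x ∈ U then s ⟨x, h⟩ else 0, fun x hx => ?_, fun x hx => ?_⟩
  · have h1 : (fun y : O => (fun x => if h : x ∈ U then s ⟨x, h⟩ else 0) (y : X)) = s := by
      funext y
      exact dif_pos y.2
    have h2 : ContMDiffAt 𝓘(ℝ, X) 𝓘(ℝ, F) 1 (fun x => if h : x ∈ U then s ⟨x, h⟩ else 0)
        ((⟨x, hx⟩ : O) : X) := by
      rw [← contMDiffAt_subtype_iff, h1]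
      exact s.contMDiff _
    exact h2.contDiffAt.contDiffWithinAt
  · simp only [dif_pos hx]
    exact hs ⟨x, hx⟩

variable {m n : ℕ} {r : ℕ∞} {f : RVec n → RVec n} {p : RVec (m + 1) → ℝ → RVec n}
  {ω : RVec (m + 1) → ℝ} {Ω K : Set (RVec (m + 1))} {c : RVec m} {U : Set (Freq m)}
  {W : Freq m → ℝ → Mat2 n} {M₁ : Freq m → Mat2 n} {x₀ : Freq m}

theorem posSemidef_of_matOp {A : Mat2 n} (hA : A.IsHermitian)
    (h : ∀ v, 0 ≤ (⟪v, matOp A v⟫_ℂ).re) : A.PosSemidef := by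
  refine Matrix.PosSemidef.of_dotProduct_mulVec_nonneg hA fun v => ?_
  have h1 := h (WithLp.toLp 2 v)
  have h2 : ⟪(WithLp.toLp 2 v : Sys n), matOp A (WithLp.toLp 2 v)⟫_ℂ = star v ⬝ᵥ A *ᵥ v := by
    rw [EuclideanSpace.inner_eq_star_dotProduct, dotProduct_comm]
    rfl
  rw [h2] at h1
  rw [Complex.nonneg_iff]
  refine ⟨h1, ?_⟩
  have h3 := hA.im_star_dotProduct_mulVec_self v
  exact h3.symm

/-- The Hermitian part has the real part of the quadratic form. -/
theorem matOp_rePart (A : Mat2 n) (v : Sys n) :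
    (⟪v, matOp (rePart A) v⟫_ℂ).re = (⟪v, matOp A v⟫_ℂ).re := by
  have h1 : matOp (rePart A) = (1 / 2 : ℂ) • (matOp A + star (matOp A)) := by
    rw [← matOp_conjTranspose]
    unfold matOp rePart
    rw [map_smul, map_add]
  have h2 : (⟪matOp A v, v⟫_ℂ).re = (⟪v, matOp A v⟫_ℂ).re := by
    rw [← inner_conj_symm]
    exact Complex.conj_re _
  rw [h1, _root_.smul_apply, _root_.add_apply, inner_smul_right, inner_add_right,
    ContinuousLinearMap.star_eq_adjoint, ContinuousLinearMap.adjoint_inner_right,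
    show (1 / 2 : ℂ) = ((1 / 2 : ℝ) : ℂ) by push_cast; rfl, Complex.re_ofReal_mul, Complex.add_re,
    h2]
  ring

theorem isHermitian_rePart (A : Mat2 n) : (rePart A).IsHermitian := by
  unfold rePart Matrix.IsHermitian
  rw [Matrix.conjTranspose_smul, Matrix.conjTranspose_add, Matrix.conjTranspose_conjTranspose,
    add_comm]
  simp

theorem weight_nonneg {x : Freq m} (hx : 0 ≤ x.2.1.re) : 0 ≤ weight c x := by
  unfold weight
  positivity

/-- The symmetrizer property in terms of quadratic forms. -/
theorem isSymmetrizer_of_inner {S : Freq m → Sys n →L[ℂ] Sys n} (hS : ContDiffOn ℝ 1 S U)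
    (hSs : ∀ x ∈ U, IsSelfAdjoint (S x))
    (hSe : ∀ x ∈ U, x.1 ∈ K → 0 ≤ x.2.1.re →
      ∀ v, weight c x * ‖v‖ ^ 2 ≤ (⟪v, S x (matOp (M₁ x) v)⟫_ℂ).re) :
    IsSymmetrizer K c U M₁ (fun x => opMatL n (S x)) := by
  have hre : ∀ x v, (⟪v, matOp (rePart (opMatL n (S x) * M₁ x)) v⟫_ℂ).re =
      (⟪v, S x (matOp (M₁ x) v)⟫_ℂ).re := by
    intro x v
    rw [matOp_rePart, matOp_mul, matOp_opMatL]
    rfl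
  refine ⟨(opMatL n).contDiff.comp_contDiffOn hS, fun x hx => ?_, fun x hx hk hγ hne => ?_,
    fun x hx hk hγ h0 => ?_⟩
  · apply matOp_injective
    rw [matOp_conjTranspose, matOp_opMatL]
    exact hSs x hx
  · have hw0 : 0 < weight c x := lt_of_le_of_ne (weight_nonneg hγ) (Ne.symm hne)
    have hwc : (weight c x : ℂ) ≠ 0 := by exact_mod_cast hne
    -- `Γ` is the real part divided by the weight
    refine ⟨(weight c x : ℂ)⁻¹ • rePart (opMatL n (S x) * M₁ x), ?_, ?_⟩
    · rw [smul_smul, mul_inv_cancel₀ hwc, one_smul]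
    · have hherm := isHermitian_rePart (opMatL n (S x) * M₁ x)
      refine posSemidef_of_matOp ?_ fun v => ?_
      · refine Matrix.IsHermitian.sub ?_ Matrix.isHermitian_one
        unfold Matrix.IsHermitian
        rw [Matrix.conjTranspose_smul, hherm.eq]
        simp
      · have h1 : matOp ((weight c x : ℂ)⁻¹ • rePart (opMatL n (S x) * M₁ x) - 1) v =
            (weight c x : ℂ)⁻¹ • matOp (rePart (opMatL n (S x) * M₁ x)) v - v := by
          rw [matOp_sub, matOp_one]
          unfold matOp
          rw [map_smul]
          rfl
        rw [h1, inner_sub_right, inner_smul_right, Complex.sub_re, ← Complex.ofReal_inv,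
          Complex.re_ofReal_mul, hre, inner_self_eq_norm_sq_to_K]
        have h2 := mul_le_mul_of_nonneg_left (hSe x hx hk hγ v) (inv_nonneg.mpr hw0.le)
        rw [← mul_assoc, inv_mul_cancel₀ hne, one_mul] at h2
        have h3 : (((‖v‖ : ℝ) : ℂ) ^ 2).re = ‖v‖ ^ 2 := by
          rw [← Complex.ofReal_pow, Complex.ofReal_re]
        change 0 ≤ _ - (((‖v‖ : ℝ) : ℂ) ^ 2).re
        rw [h3]
        linarith
  · refine posSemidef_of_matOp (isHermitian_rePart _) fun v => ?_
    rw [hre]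
    have h1 := hSe x hx hk hγ v
    rwa [h0, zero_mul] at h1

/-- Every Floquet reduction has a symmetrizer on its domain. -/
theorem IsFloquetReduction.exists_symmetrizer (hr : IsFloquetReduction r f p ω Ω c U W M₁)
    (hw : IsWaveFamily r f p ω Ω K) (hr2 : 2 ≤ r) (hstab : ∀ k ∈ K, DiffusivelyStable f p ω k) :
    ∃ S : Freq m → Mat2 n, IsSymmetrizer K c U M₁ S := by
  obtain ⟨S, hS, hSt⟩ := exists_contDiffOn_mem_convex hr.isOpen
    (t := fun x => {S : Sys n →L[ℂ] Sys n | IsSelfAdjoint S ∧ (x.1 ∈ K → 0 ≤ x.2.1.re →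
      ∀ v, weight c x * ‖v‖ ^ 2 ≤ (⟪v, S (matOp (M₁ x) v)⟫_ℂ).re)})
    -- the constraint is a linear inequality on a real subspace, hence convex
    (fun x S hS T hT a b ha hb hab => by
      refine ⟨?_, fun hk hγ v => ?_⟩
      · have h1 : ∀ (a : ℝ) (S : Sys n →L[ℂ] Sys n), IsSelfAdjoint S → IsSelfAdjoint (a • S) :=
          fun a S hS => by
            have h2 : a • S = (a : ℂ) • S := by
              ext1 v
              exact (Complex.coe_smul a (S v)).symm
            rw [h2]
            exact IsSelfAdjoint.smul (Complex.conj_ofReal _) hS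
        exact IsSelfAdjoint.add (R := Sys n →L[ℂ] Sys n) (h1 a S hS.1) (h1 b T hT.1)
      · have h1 := mul_le_mul_of_nonneg_left (hS.2 hk hγ v) ha
        have h2 := mul_le_mul_of_nonneg_left (hT.2 hk hγ v) hb
        have h3 : (⟪v, (a • S + b • T) (matOp (M₁ x) v)⟫_ℂ).re =
            a * (⟪v, S (matOp (M₁ x) v)⟫_ℂ).re + b * (⟪v, T (matOp (M₁ x) v)⟫_ℂ).re := by
          rw [_root_.add_apply, _root_.smul_apply, _root_.smul_apply, inner_add_right,
            ← Complex.coe_smul, ← Complex.coe_smul, inner_smul_right, inner_smul_right,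
            Complex.add_re, Complex.re_ofReal_mul, Complex.re_ofReal_mul]
        rw [h3]
        have h4 : weight c x * ‖v‖ ^ 2 =
            a * (weight c x * ‖v‖ ^ 2) + b * (weight c x * ‖v‖ ^ 2) := by
          rw [← add_mul, hab, one_mul]
        rw [h4]
        exact add_le_add h1 h2)
    (fun x₀ hx₀ => by
      obtain ⟨S, hS, hSs, hSe⟩ := hr.exists_local_symmetrizer hw hr2 hstab hx₀
      refine ⟨S, hS, ?_⟩
      filter_upwards [hSe] with x hx using ⟨hSs x, hx⟩)
  exact ⟨_, isSymmetrizer_of_inner hS (fun x hx => (hSt x hx).1) (fun x hx => (hSt x hx).2)⟩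

theorem isCompact_boundedFreq (hK : IsCompact K) (c : RVec m) (R : ℝ) :
    IsCompact (boundedFreq K c R) := by
  have hdc : Continuous (drift c) := (contDiff_drift c (N := 0)).continuous
  have hclosed : IsClosed (boundedFreq K c R) := by
    refine (hK.isClosed.preimage continuous_fst).inter (IsClosed.inter ?_ ?_)
    · exact isClosed_le continuous_const (by fun_prop : Continuous fun x : Freq m => x.2.1.re)
    · have h1 : Continuous fun x : Freq m => ((drift c x.2.2 : ℝ) : ℂ) :=
        Complex.continuous_ofReal.comp (hdc.comp (continuous_snd.comp continuous_snd))
      have h2 : Continuous fun x : Freq m =>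
          ‖x.2.1 + Complex.I * (drift c x.2.2 : ℂ)‖ + ‖x.2.2‖ ^ 2 := by fun_prop
      exact isClosed_le h2 continuous_const
  have hball : IsCompact (Metric.closedBall (0 : RVec m) (R + 1)) := isCompact_closedBall _ _
  obtain ⟨b, hb⟩ := hball.exists_bound_of_continuousOn hdc.continuousOn
  have hbox : IsCompact (K ×ˢ (Metric.closedBall (0 : ℂ) (R + b) ×ˢ
      Metric.closedBall (0 : RVec m) (R + 1))) :=
    hK.prod ((isCompact_closedBall _ _).prod hball)
  refine hbox.of_isClosed_subset hclosed fun x hx => ?_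
  obtain ⟨hxK, -, hxR⟩ := hx
  have h1 : ‖x.2.2‖ ≤ R + 1 := by
    nlinarith [norm_nonneg (x.2.1 + Complex.I * (drift c x.2.2 : ℂ)), sq_nonneg (‖x.2.2‖ - 1)]
  have h2 : x.2.2 ∈ Metric.closedBall (0 : RVec m) (R + 1) := by simpa using h1
  refine ⟨hxK, ?_, h2⟩
  have h3 := hb _ h2
  have h4 : ‖x.2.1‖ ≤ ‖x.2.1 + Complex.I * (drift c x.2.2 : ℂ)‖ +
      ‖Complex.I * (drift c x.2.2 : ℂ)‖ := norm_le_add_norm_add _ _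
  rw [norm_mul, Complex.norm_I, one_mul, Complex.norm_real] at h4
  have h5 : ‖x.2.1‖ ≤ R + b := by nlinarith [sq_nonneg ‖x.2.2‖]
  simpa using h5

end Gluing

/-! ### Smooth dependence of linear systems on parameters -/

section Curry

variable {X : Type} [NormedAddCommGroup X] [NormedSpace ℝ X] [FiniteDimensional ℝ X]

/-- Continuous functions on `[0, 1]`, with the supremum norm. -/
abbrev Paths (F : Type) [NormedAddCommGroup F] := BoundedContinuousFunction unitInterval F

/-- The map `x ↦ G (x, ·)` into continuous functions on `[0, 1]`. -/
noncomputable def curryUnit {F : Type} [NormedAddCommGroup F] {G : X × ℝ → F} (hG : Continuous G)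
    (x : X) : Paths F :=
  BoundedContinuousFunction.mkOfCompact
    ⟨fun t => G (x, t), hG.comp ((Continuous.prodMk_right x).comp continuous_subtype_val)⟩

theorem continuous_curryUnit {F : Type} [NormedAddCommGroup F] {G : X × ℝ → F}
    (hG : Continuous G) : Continuous (curryUnit hG) :=
  (ContinuousMap.isometryEquivBoundedOfCompact unitInterval F).continuous.comp
    (ContinuousMap.curry (⟨fun q : X × unitInterval => G (q.1, q.2),
      hG.comp (continuous_fst.prodMk (continuous_subtype_val.comp continuous_snd))⟩ :
      C(X × unitInterval, F))).continuous

/-- Evaluation of a family of linear maps at a vector, as a linear map into families. -/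
noncomputable def evalFamily (X F : Type) [NormedAddCommGroup X] [NormedSpace ℝ X]
    [NormedAddCommGroup F] [NormedSpace ℝ F] :
    Paths (X →L[ℝ] F) →L[ℝ] (X →L[ℝ] Paths F) :=
  LinearMap.mkContinuous
    { toFun := fun A => LinearMap.mkContinuous
        { toFun := fun v => BoundedContinuousFunction.mkOfCompact
            ⟨fun t => A t v, A.continuous.clm_apply continuous_const⟩
          map_add' := fun v w => by ext t; exact map_add (A t) v w
          map_smul' := fun z v => by ext t; exact map_smul (A t) z v } ‖A‖
        (fun v => (BoundedContinuousFunction.norm_le (by positivity)).mpr fun t =>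
          ((A t).le_opNorm v).trans (mul_le_mul_of_nonneg_right (A.norm_coe_le_norm t)
            (norm_nonneg v)))
      map_add' := fun A B => by ext v t; rfl
      map_smul' := fun z A => by ext v t; rfl } 1
    (fun A => by
      rw [one_mul]
      refine ContinuousLinearMap.opNorm_le_bound _ (norm_nonneg A) fun v => ?_
      refine (BoundedContinuousFunction.norm_le (by positivity)).mpr fun t => ?_
      exact ((A t).le_opNorm v).trans
        (mul_le_mul_of_nonneg_right (A.norm_coe_le_norm t) (norm_nonneg v)))

/-- Differentiation under the evaluation: the difference quotients converge uniformly on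
`[0, 1]`. -/
theorem hasFDerivAt_curryUnit {F : Type} [NormedAddCommGroup F] [NormedSpace ℝ F] {G : X × ℝ → F}
    {G' : X × ℝ → X →L[ℝ] F} (hG : Continuous G) (hG' : Continuous G')
    (hd : ∀ x t, HasFDerivAt (fun y => G (y, t)) (G' (x, t)) x) (x : X) :
    HasFDerivAt (curryUnit hG) (evalFamily X F (curryUnit hG' x)) x := by
  rw [hasFDerivAt_iff_isLittleO_nhds_zero, Asymptotics.isLittleO_iff]
  intro ε hε
  have hc : ∀ᶠ y in 𝓝 x, ‖curryUnit hG' y - curryUnit hG' x‖ < ε := by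
    have h := Metric.tendsto_nhds.mp ((continuous_curryUnit hG').tendsto x) ε hε
    filter_upwards [h] with y hy
    rwa [← dist_eq_norm]
  obtain ⟨δ, hδ, hball⟩ := Metric.eventually_nhds_iff_ball.mp hc
  filter_upwards [Metric.ball_mem_nhds (0 : X) hδ] with v hv
  rw [BoundedContinuousFunction.norm_le (by positivity)]
  intro t
  have h1 := (convex_ball x δ).norm_image_sub_le_of_norm_hasFDerivWithin_le'
    (f := fun y => G (y, (t : ℝ))) (f' := fun y => G' (y, t)) (φ := G' (x, t)) (C := ε)
    (fun y _ => (hd y t).hasFDerivWithinAt) (fun y hy =>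
      ((curryUnit hG' y - curryUnit hG' x).norm_coe_le_norm t).trans (hball y hy).le)
    (Metric.mem_ball_self hδ) (show x + v ∈ Metric.ball x δ by simpa using hv)
  rw [add_sub_cancel_left] at h1
  exact h1

theorem contDiff_curryUnit_nat (N : ℕ) : ∀ {F : Type} [NormedAddCommGroup F] [NormedSpace ℝ F]
    {G : X × ℝ → F} (hG : Continuous G), ContDiff ℝ N G → ContDiff ℝ N (curryUnit hG) := by
  induction N with
  | zero =>
    intro F _ _ G hG _
    exact contDiff_zero.mpr (continuous_curryUnit hG)
  | succ N ih =>
    intro F _ _ G hG hGs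
    obtain ⟨G', hG's, hG'd⟩ := contDiff_succ_iff_hasFDerivAt.mp hGs
    have h1 : ContDiff ℝ N fun q => (G' q).comp (ContinuousLinearMap.inl ℝ X ℝ) :=
      hG's.clm_comp contDiff_const
    refine contDiff_succ_iff_hasFDerivAt.mpr
      ⟨fun x => evalFamily X F (curryUnit h1.continuous x),
        (evalFamily X F).contDiff.comp (ih h1.continuous h1),
        hasFDerivAt_curryUnit hG h1.continuous fun x t => ?_⟩
    exact (hG'd (x, t)).comp x (hasFDerivAt_prodMk_left x t)

theorem contDiff_curryUnit {F : Type} [NormedAddCommGroup F] [NormedSpace ℝ F] {G : X × ℝ → F}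
    (hG : Continuous G) {N : ℕ∞} (hGs : ContDiff ℝ (N : WithTop ℕ∞) G) :
    ContDiff ℝ (N : WithTop ℕ∞) (curryUnit hG) := by
  rw [contDiff_iff_forall_nat_le]
  intro j hj
  exact contDiff_curryUnit_nat j hG (hGs.of_le (by exact_mod_cast hj))

end Curry

section Volterra

variable {𝔸 : Type} [NormedRing 𝔸] [NormedAlgebra ℝ 𝔸] [CompleteSpace 𝔸]

theorem continuous_projIcc_comp {F : Type} [NormedAddCommGroup F] (u : Paths F) :
    Continuous fun s : ℝ => u (Set.projIcc 0 1 zero_le_one s) :=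
  u.continuous.comp continuous_projIcc

/-- The primitive on `[0, 1]` vanishing at `0`. -/
noncomputable def primitive (F : Type) [NormedAddCommGroup F] [NormedSpace ℝ F] :
    Paths F →L[ℝ] Paths F :=
  LinearMap.mkContinuous
    { toFun := fun u => BoundedContinuousFunction.mkOfCompact
        ⟨fun t => ∫ s in (0 : ℝ)..t, u (Set.projIcc 0 1 zero_le_one s),
          (intervalIntegral.continuous_primitive
          (fun a b => (continuous_projIcc_comp u).intervalIntegrable a b) 0).comp
          continuous_subtype_val⟩
      map_add' := fun u v => by
        ext t
        exact intervalIntegral.integral_add ((continuous_projIcc_comp u).intervalIntegrable _ _)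
          ((continuous_projIcc_comp v).intervalIntegrable _ _)
      map_smul' := fun z u => by
        ext t
        exact intervalIntegral.integral_smul _ _ } 1
    (fun u => by
      rw [one_mul, BoundedContinuousFunction.norm_le (norm_nonneg _)]
      intro t
      have h1 := intervalIntegral.norm_integral_le_of_norm_le_const (a := 0) (b := (t : ℝ))
        (f := fun s => u (Set.projIcc 0 1 zero_le_one s)) (C := ‖u‖)
        (fun s _ => u.norm_coe_le_norm _)
      refine h1.trans ?_
      rw [sub_zero, abs_of_nonneg t.2.1]
      exact mul_le_of_le_one_right (norm_nonneg _) t.2.2)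

/-- The Volterra operator `u ↦ ∫₀ᵗ b u`. -/
noncomputable def volterra : Paths 𝔸 →L[ℝ] Paths 𝔸 →L[ℝ] Paths 𝔸 :=
  (ContinuousLinearMap.compL ℝ _ _ _ (primitive 𝔸)) ∘L ContinuousLinearMap.mul ℝ (Paths 𝔸)

theorem volterra_apply (b u : Paths 𝔸) (t : unitInterval) : volterra b u t =
    ∫ s in (0 : ℝ)..t, b (Set.projIcc 0 1 zero_le_one s) * u (Set.projIcc 0 1 zero_le_one s) := rfl

theorem norm_volterra_pow_le (b u : Paths 𝔸) (N : ℕ) (t : unitInterval) :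
    ‖(volterra b ^ N) u t‖ ≤ ‖b‖ ^ N * ‖u‖ * ((t : ℝ) ^ N / N.factorial) := by
  induction N generalizing t with
  | zero => simpa using u.norm_coe_le_norm t
  | succ N ih =>
    rw [pow_succ']
    have h0 : (volterra b * volterra b ^ N) u t = ∫ s in (0 : ℝ)..t,
      b (Set.projIcc 0 1 zero_le_one s) * (volterra b ^ N) u (Set.projIcc 0 1 zero_le_one s) := rfl
    have h1 : ‖∫ s in (0 : ℝ)..t, b (Set.projIcc 0 1 zero_le_one s) *
        (volterra b ^ N) u (Set.projIcc 0 1 zero_le_one s)‖ ≤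
        ∫ s in (0 : ℝ)..t, ‖b‖ ^ (N + 1) * ‖u‖ / N.factorial * s ^ N := by
      refine intervalIntegral.norm_integral_le_of_norm_le t.2.1
        (Eventually.of_forall fun s hs => ?_)
        ((by fun_prop : Continuous _).intervalIntegrable _ _)
      have hs' : s ∈ Set.Icc (0 : ℝ) 1 := ⟨hs.1.le, hs.2.trans t.2.2⟩
      -- the bound for the power `N`, integrated over `[0, t]`
      have h2 := ih (Set.projIcc 0 1 zero_le_one s)
      have h3 : ((Set.projIcc 0 1 zero_le_one s : Set.Icc (0 : ℝ) 1) : ℝ) = s := by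
        rw [Set.projIcc_of_mem zero_le_one hs']
      rw [h3] at h2
      calc _ ≤ ‖b (Set.projIcc 0 1 zero_le_one s)‖ *
            ‖(volterra b ^ N) u (Set.projIcc 0 1 zero_le_one s)‖ := norm_mul_le _ _
        _ ≤ ‖b‖ * (‖b‖ ^ N * ‖u‖ * (s ^ N / N.factorial)) :=
            mul_le_mul (b.norm_coe_le_norm _) h2 (norm_nonneg _) (norm_nonneg _)
        _ = _ := by ring
    rw [h0]
    refine h1.trans (le_of_eq ?_)
    rw [intervalIntegral.integral_const_mul, integral_pow, Nat.factorial_succ]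
    push_cast
    have : (N.factorial : ℝ) ≠ 0 := by positivity
    field_simp
    ring

theorem isUnit_one_sub_of_norm_pow_lt {Y : Type} [NormedAddCommGroup Y] [NormedSpace ℝ Y]
    [CompleteSpace Y] {T : Y →L[ℝ] Y} {N : ℕ} (h : ‖T ^ N‖ < 1) : IsUnit (1 - T) := by
  have h3 : IsUnit (1 - T ^ N) := isUnit_one_sub_of_norm_lt_one h
  have h4 : Commute (1 - T) (∑ i ∈ Finset.range N, T ^ i) := by
    rw [Commute, SemiconjBy, mul_neg_geom_sum, geom_sum_mul_neg]
  rw [← mul_neg_geom_sum, h4.isUnit_mul_iff] at h3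
  exact h3.1

theorem contDiff_inverse_one_sub {B Y : Type} [NormedAddCommGroup B] [NormedSpace ℝ B]
    [NormedAddCommGroup Y] [NormedSpace ℝ Y] [CompleteSpace Y] (V : B →L[ℝ] Y →L[ℝ] Y)
    (hV : ∀ b, IsUnit (1 - V b)) (y : Y) {N : WithTop ℕ∞} :
    ContDiff ℝ N fun b => Ring.inverse (1 - V b) y := by
  refine contDiff_iff_contDiffAt.mpr fun b => ?_
  obtain ⟨u, hu⟩ := hV b
  have h1 : ContDiffAt ℝ N (Ring.inverse : (Y →L[ℝ] Y) → _) (1 - V b) := by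
    rw [← hu]
    exact contDiffAt_ringInverse ℝ u
  have h2 : ContDiffAt ℝ N (fun b => Ring.inverse (1 - V b)) b :=
    h1.comp b (contDiffAt_const.sub V.contDiff.contDiffAt)
  exact h2.clm_apply contDiffAt_const

/-- Volterra operators are quasinilpotent. -/
theorem isUnit_one_sub_volterra (b : Paths 𝔸) :
    IsUnit (1 - volterra b : Paths 𝔸 →L[ℝ] Paths 𝔸) := by
  have h1 : Tendsto (fun N : ℕ => ‖b‖ ^ N / N.factorial) atTop (𝓝 0) :=
    FloorSemiring.tendsto_pow_div_factorial_atTop ‖b‖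
  obtain ⟨N, hN⟩ := (h1.eventually (gt_mem_nhds (show (0 : ℝ) < 1 / 2 by norm_num))).exists
  have h2 : ‖volterra b ^ N‖ ≤ 1 / 2 := by
    refine ContinuousLinearMap.opNorm_le_bound _ (by norm_num) fun u => ?_
    rw [BoundedContinuousFunction.norm_le (by positivity)]
    intro t
    refine (norm_volterra_pow_le b u N t).trans ?_
    have h3 : (t : ℝ) ^ N ≤ 1 := pow_le_one₀ t.2.1 t.2.2
    have h4 : ‖b‖ ^ N * ‖u‖ * ((t : ℝ) ^ N / N.factorial) =
        ‖b‖ ^ N / N.factorial * ‖u‖ * (t : ℝ) ^ N := by ring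
    rw [h4]
    calc _ ≤ ‖b‖ ^ N / N.factorial * ‖u‖ * 1 := by gcongr
      _ ≤ 1 / 2 * ‖u‖ := by rw [mul_one]; gcongr
  exact isUnit_one_sub_of_norm_pow_lt (h2.trans_lt (by norm_num))

/-- The solution on `[0, 1]` of `u' = b u`, `u(0) = 1`. -/
noncomputable def linSol (b : Paths 𝔸) : Paths 𝔸 :=
  Ring.inverse (1 - volterra b) 1

theorem linSol_eq (b : Paths 𝔸) : linSol b = 1 + volterra b (linSol b) := by
  have h := DFunLike.congr_fun (Ring.mul_inverse_cancel _ (isUnit_one_sub_volterra b))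
    (1 : Paths 𝔸)
  have h1 : linSol b - volterra b (linSol b) = 1 := h
  rw [← h1, sub_add_cancel]

theorem eq_linSol {b u : Paths 𝔸} (h : u = 1 + volterra b u) : u = linSol b := by
  have h1 := DFunLike.congr_fun (Ring.inverse_mul_cancel _ (isUnit_one_sub_volterra b)) u
  have h2 : Ring.inverse (1 - volterra b) (u - volterra b u) = u := h1
  have h3 : u - volterra b u = 1 := by
    nth_rewrite 1 [h]
    exact add_sub_cancel_right _ _
  rw [h3] at h2
  exact h2.symm

theorem contDiff_linSol {N : WithTop ℕ∞} : ContDiff ℝ N (linSol (𝔸 := 𝔸)) := by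
  have h : ContDiff ℝ N fun b : Paths 𝔸 => Ring.inverse (1 - volterra b) (1 : Paths 𝔸) :=
    contDiff_inverse_one_sub (B := Paths 𝔸) (Y := Paths 𝔸) volterra isUnit_one_sub_volterra 1
  exact h

end Volterra

section Fundamental

variable {X : Type} [NormedAddCommGroup X] [NormedSpace ℝ X] [FiniteDimensional ℝ X]
  {𝔸 : Type} [NormedRing 𝔸] [NormedAlgebra ℝ 𝔸] [CompleteSpace 𝔸] {A : X × ℝ → 𝔸} {N : ℕ∞}

/-- The coefficient of the linear system on `[0, θ]`, rescaled to `[0, 1]`. -/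
theorem contDiff_rescaled (hA : ContDiff ℝ (N : WithTop ℕ∞) A) :
    ContDiff ℝ (N : WithTop ℕ∞) fun q : (X × ℝ) × ℝ => q.1.2 • A (q.1.1, q.1.2 * q.2) := by
  have h1 : ContDiff ℝ (N : WithTop ℕ∞) fun q : (X × ℝ) × ℝ => (q.1.1, q.1.2 * q.2) := by fun_prop
  have h2 : ContDiff ℝ (N : WithTop ℕ∞) fun q : (X × ℝ) × ℝ => q.1.2 := by fun_prop
  exact h2.smul (hA.comp h1)

/-- The path `t ↦ Φ (x, tθ)` on `[0, 1]`, where `Φ (x, ·)` is the solution of `Φ' = A Φ` with value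
`1` at `0`. Rescaling makes the dependence on `θ` a dependence on a parameter. -/
noncomputable def fundPath (hA : ContDiff ℝ (N : WithTop ℕ∞) A) (q : X × ℝ) : Paths 𝔸 :=
  linSol (curryUnit (contDiff_rescaled hA).continuous q)

/-- The fundamental solution of `Φ' = A(x, ·) Φ`, `Φ (x, 0) = 1`. -/
noncomputable def fundSol (hA : ContDiff ℝ (N : WithTop ℕ∞) A) (q : X × ℝ) : 𝔸 := fundPath hA q 1

theorem contDiff_fundSol (hA : ContDiff ℝ (N : WithTop ℕ∞) A) :
    ContDiff ℝ (N : WithTop ℕ∞) (fundSol hA) :=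
  (BoundedContinuousFunction.evalCLM (β := 𝔸) ℝ (1 : unitInterval)).contDiff.comp
    (contDiff_linSol.comp (contDiff_curryUnit (contDiff_rescaled hA).continuous
      (contDiff_rescaled hA)))

theorem fundPath_apply (hA : ContDiff ℝ (N : WithTop ℕ∞) A) (x : X) (θ : ℝ) (t : unitInterval) :
    fundPath hA (x, θ) t = 1 + ∫ s in (0 : ℝ)..t,
      (θ • A (x, θ * s)) * fundPath hA (x, θ) (Set.projIcc 0 1 zero_le_one s) := by
  have h := DFunLike.congr_fun (linSol_eq (curryUnit (contDiff_rescaled hA).continuous (x, θ))) t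
  rw [BoundedContinuousFunction.add_apply, volterra_apply] at h
  refine h.trans ?_
  change (1 : 𝔸) + _ = _
  congr 1
  refine intervalIntegral.integral_congr fun s hs => ?_
  rw [Set.uIcc_of_le t.2.1] at hs
  have h3 : ((Set.projIcc 0 1 zero_le_one s : Set.Icc (0 : ℝ) 1) : ℝ) = s := by
    rw [Set.projIcc_of_mem zero_le_one ⟨hs.1, hs.2.trans t.2.2⟩]
  change (θ • A (x, θ * ((Set.projIcc 0 1 zero_le_one s : Set.Icc (0 : ℝ) 1) : ℝ))) * _ = _
  rw [h3]
  rfl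

/-- The path `fundPath (x, θ)` runs through the values of the fundamental solution. -/
theorem fundSol_mul (hA : ContDiff ℝ (N : WithTop ℕ∞) A) (x : X) (θ : ℝ) (τ : unitInterval) :
    fundSol hA (x, τ * θ) = fundPath hA (x, θ) τ := by
  set w : Paths 𝔸 := BoundedContinuousFunction.mkOfCompact
    ⟨fun t => fundPath hA (x, θ) (τ * t), by fun_prop⟩ with hw
  have h1 : w = linSol (curryUnit (contDiff_rescaled hA).continuous (x, τ * θ)) := by
    refine eq_linSol ?_
    ext t
    rw [BoundedContinuousFunction.add_apply, volterra_apply]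
    change fundPath hA (x, θ) (τ * t) = 1 + _
    rw [fundPath_apply]
    congr 1
    have hsub := intervalIntegral.smul_integral_comp_mul_left (a := 0) (b := (t : ℝ))
      (fun s => (θ • A (x, θ * s)) * fundPath hA (x, θ) (Set.projIcc 0 1 zero_le_one s)) (τ : ℝ)
    rw [mul_zero] at hsub
    rw [show (((τ * t : unitInterval) : ℝ)) = (τ : ℝ) * t from rfl, ← hsub,
      ← intervalIntegral.integral_smul]
    refine intervalIntegral.integral_congr fun s hs => ?_
    rw [Set.uIcc_of_le t.2.1] at hs
    have hs1 : s ∈ Set.Icc (0 : ℝ) 1 := ⟨hs.1, hs.2.trans t.2.2⟩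
    have h3 : Set.projIcc 0 1 zero_le_one s = (⟨s, hs1⟩ : unitInterval) :=
      Set.projIcc_of_mem zero_le_one hs1
    have h4 : Set.projIcc 0 1 zero_le_one ((τ : ℝ) * s) = τ * (⟨s, hs1⟩ : unitInterval) :=
      Set.projIcc_of_mem zero_le_one (τ * (⟨s, hs1⟩ : unitInterval)).2
    change (τ : ℝ) • ((θ • A (x, θ * (τ * s))) * fundPath hA (x, θ) _) =
      (((τ : ℝ) * θ) •
        A (x, ((τ : ℝ) * θ) * ((Set.projIcc 0 1 zero_le_one s : unitInterval) : ℝ))) *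
        fundPath hA (x, θ) (τ * (Set.projIcc 0 1 zero_le_one s))
    rw [h3, h4, mul_smul, smul_mul_assoc (τ : ℝ)]
    rw [show θ * (τ * s) = (τ : ℝ) * θ * s by ring]
  have h2 := DFunLike.congr_fun h1 (1 : unitInterval)
  change fundPath hA (x, θ) (τ * 1) = fundSol hA (x, τ * θ) at h2
  rw [← h2, mul_one]

theorem fundSol_zero (hA : ContDiff ℝ (N : WithTop ℕ∞) A) (x : X) : fundSol hA (x, 0) = 1 := by
  have h := fundPath_apply hA x 0 1
  simpa [fundSol] using h

/-- The differential equation of the fundamental solution. -/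
theorem hasDerivAt_fundSol (hA : ContDiff ℝ (N : WithTop ℕ∞) A) (hN : 1 ≤ N) (x : X) (θ : ℝ) :
    HasDerivAt (fun θ => fundSol hA (x, θ)) (A (x, θ) * fundSol hA (x, θ)) θ := by
  have hAc : Continuous A := hA.continuous
  -- For `θ ≠ 0` the path of length `2θ` is used, on which `θ` is an interior point.
  have hne : ∀ θ : ℝ, θ ≠ 0 →
      HasDerivAt (fun θ => fundSol hA (x, θ)) (A (x, θ) * fundSol hA (x, θ)) θ := by
    intro θ hθ
    set u := fundPath hA (x, 2 * θ) with hu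
    have hc : Continuous fun s : ℝ => ((2 * θ) • A (x, 2 * θ * s)) *
        u (Set.projIcc 0 1 zero_le_one s) := by
      have h1 := continuous_projIcc_comp u
      fun_prop
    have h1 : HasDerivAt (fun σ : ℝ => (1 : 𝔸) + ∫ s in (0 : ℝ)..σ,
        ((2 * θ) • A (x, 2 * θ * s)) * u (Set.projIcc 0 1 zero_le_one s))
        (((2 * θ) • A (x, 2 * θ * (θ / (2 * θ)))) * u (Set.projIcc 0 1 zero_le_one (θ / (2 * θ))))
        (θ / (2 * θ)) :=
      (intervalIntegral.integral_hasDerivAt_right (hc.intervalIntegrable _ _)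
        (hc.stronglyMeasurableAtFilter _ _) hc.continuousAt).const_add 1
    have h2 : HasDerivAt (fun θ' : ℝ => θ' / (2 * θ)) (1 / (2 * θ)) θ :=
      (hasDerivAt_id θ).div_const _
    have h3 := h1.scomp θ h2
    have hhalf : θ / (2 * θ) = 1 / 2 := by field_simp
    have hmem : ∀ σ : ℝ, ∀ h : σ / (2 * θ) ∈ Set.Icc (0 : ℝ) 1,
        u ⟨σ / (2 * θ), h⟩ = fundSol hA (x, σ) := by
      intro σ h
      rw [hu, ← fundSol_mul]
      congr 2
      field_simp
    have hev : (fun θ => fundSol hA (x, θ)) =ᶠ[𝓝 θ] fun θ' =>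
        (1 : 𝔸) + ∫ s in (0 : ℝ)..θ' / (2 * θ),
        ((2 * θ) • A (x, 2 * θ * s)) * u (Set.projIcc 0 1 zero_le_one s) := by
      have hcont : ContinuousAt (fun θ' : ℝ => θ' / (2 * θ)) θ := h2.continuousAt
      filter_upwards [hcont.eventually_mem (show Set.Icc (0 : ℝ) 1 ∈ 𝓝 (θ / (2 * θ)) by
        rw [hhalf]; exact Icc_mem_nhds (by norm_num) (by norm_num))] with σ hσ
      rw [← hmem σ hσ, hu, fundPath_apply]
    refine (h3.congr_of_eventuallyEq hev).congr_deriv ?_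
    have h4 : u (Set.projIcc 0 1 zero_le_one (θ / (2 * θ))) = fundSol hA (x, θ) := by
      rw [← hmem θ (by rw [hhalf]; norm_num)]
      congr 1
      exact Set.projIcc_of_mem zero_le_one _
    rw [h4, ← smul_mul_assoc, smul_smul, one_div, inv_mul_cancel₀ (mul_ne_zero two_ne_zero hθ),
      one_smul, show 2 * θ * (θ / (2 * θ)) = θ by field_simp]
  -- at `θ = 0` both sides agree by continuity
  have hΦ : ContDiff ℝ 1 fun θ => fundSol hA (x, θ) :=
    ((contDiff_fundSol hA).of_le (by exact_mod_cast hN)).comp (contDiff_prodMk_right x)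
  have h1 : deriv (fun θ => fundSol hA (x, θ)) = fun θ => A (x, θ) * fundSol hA (x, θ) := by
    refine Continuous.ext_on (dense_compl_singleton (0 : ℝ)) (hΦ.continuous_deriv le_rfl) ?_
      fun θ hθ => (hne θ hθ).deriv
    exact (hAc.comp (Continuous.prodMk_right x)).mul hΦ.continuous
  have h2 := (hΦ.differentiable (by norm_num) θ).hasDerivAt
  rwa [h1] at h2

end Fundamental

section Monodromy

variable {X : Type} [NormedAddCommGroup X] [NormedSpace ℝ X] [FiniteDimensional ℝ X]
  {E : Type} [NormedAddCommGroup E] [NormedSpace ℂ E] [FiniteDimensional ℂ E]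
  {A : X × ℝ → E →L[ℂ] E} {N : ℕ∞}

theorem linear_ode_unique {L : ℝ → E →L[ℂ] E} {T : ℝ} (hT : T ≠ 0) (hL : Continuous L)
    (hper : Function.Periodic L T) {y z : ℝ → E} (hy : ∀ θ, HasDerivAt y (L θ (y θ)) θ)
    (hz : ∀ θ, HasDerivAt z (L θ (z θ)) θ) {θ₀ : ℝ} (h : y θ₀ = z θ₀) : y = z := by
  obtain ⟨K, hK⟩ := (hper.compact_of_continuous hT hL).isBounded.exists_norm_le
  have hK' : ∀ θ, ‖L θ‖₊ ≤ K.toNNReal := fun θ =>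
    NNReal.le_toNNReal_of_coe_le (hK _ (Set.mem_range_self θ))
  exact ODE_solution_unique_univ (v := fun θ => L θ) (s := fun _ => Set.univ) (t₀ := θ₀)
    (K := K.toNNReal) (fun θ => ((L θ).lipschitz.weaken (hK' θ)).lipschitzOnWith)
    (fun θ => ⟨hy θ, trivial⟩) (fun θ => ⟨hz θ, trivial⟩) h

theorem isUnit_of_injective {M : E →L[ℂ] E} (h : ∀ v, M v = 0 → v = 0) : IsUnit M := by
  have : CompleteSpace E := FiniteDimensional.complete ℂ E
  rw [ContinuousLinearMap.isUnit_iff_bijective]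
  have hinj : Function.Injective (M : E →ₗ[ℂ] E) :=
    (injective_iff_map_eq_zero (M : E →ₗ[ℂ] E)).mpr h
  exact ⟨hinj, LinearMap.injective_iff_surjective.mp hinj⟩

theorem isUnit_fundSol [CompleteSpace E] {T : ℝ} (hT : T ≠ 0)
    (hA : ContDiff ℝ (N : WithTop ℕ∞) A) (hN : 1 ≤ N)
    (hper : ∀ x, Function.Periodic (fun θ => A (x, θ)) T) (x : X) (θ : ℝ) :
    IsUnit (fundSol hA (x, θ)) := by
  refine isUnit_of_injective fun v hv => ?_
  have h1 : (fun θ => fundSol hA (x, θ) v) = fun _ => 0 :=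
    linear_ode_unique hT (hA.continuous.comp (Continuous.prodMk_right x)) (hper x)
      (fun θ => ((hasDerivAt_fundSol hA hN x θ).clmApply (hasDerivAt_const θ v)).congr_deriv
        (by simp)) (fun θ => (hasDerivAt_const θ (0 : E)).congr_deriv (by simp)) hv
  have h2 := congrFun h1 0
  simpa [fundSol_zero] using h2

/-- The monodromy relation. -/
theorem fundSol_add [CompleteSpace E] {T : ℝ} (hT : T ≠ 0)
    (hA : ContDiff ℝ (N : WithTop ℕ∞) A) (hN : 1 ≤ N)
    (hper : ∀ x, Function.Periodic (fun θ => A (x, θ)) T) (x : X) (θ : ℝ) :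
    fundSol hA (x, θ + T) = fundSol hA (x, θ) * fundSol hA (x, T) := by
  ext1 v
  have h1 : (fun θ => fundSol hA (x, θ + T) v) =
      fun θ => fundSol hA (x, θ) (fundSol hA (x, T) v) := by
    refine linear_ode_unique hT (hA.continuous.comp (Continuous.prodMk_right x)) (hper x)
      (θ₀ := 0) (fun θ => ?_) (fun θ => ?_) (by simp [fundSol_zero])
    · have h2 := (hasDerivAt_fundSol hA hN x (θ + T)).comp_add_const θ T
      refine (h2.clmApply (hasDerivAt_const θ v)).congr_deriv ?_
      have h3 : A (x, θ + T) = A (x, θ) := hper x θ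
      simp [h3]
    · exact ((hasDerivAt_fundSol hA hN x θ).clmApply (hasDerivAt_const θ _)).congr_deriv (by simp)
  exact congrFun h1 θ

end Monodromy

/-! ### Smooth logarithms of invertible operators -/

section Logarithm

variable {𝔸 : Type} [NormedRing 𝔸] [NormedAlgebra ℝ 𝔸] [CompleteSpace 𝔸]

theorem contDiffAt_inverse {a : 𝔸} (ha : IsUnit a) {N : WithTop ℕ∞} :
    ContDiffAt ℝ N Ring.inverse a := by
  obtain ⟨u, rfl⟩ := ha
  exact contDiffAt_ringInverse ℝ u

theorem exp_add_commute {a b : 𝔸} (h : Commute a b) :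
    NormedSpace.exp (a + b) = NormedSpace.exp a * NormedSpace.exp b := by
  let : NormedAlgebra ℚ 𝔸 := NormedAlgebra.restrictScalars ℚ ℝ 𝔸
  exact NormedSpace.exp_add_of_commute h

theorem contDiff_exp {N : WithTop ℕ∞} : ContDiff ℝ N (NormedSpace.exp : 𝔸 → 𝔸) :=
  contDiff_iff_contDiffAt.mpr fun x => (NormedSpace.exp_analytic (𝕂 := ℝ) x).contDiffAt

/-- The exponential of a curve of commuting elements. -/
theorem hasDerivAt_exp_of_commute {g : ℝ → 𝔸} {g' : 𝔸} {τ : ℝ} (hg : HasDerivAt g g' τ)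
    (hc : ∀ σ, Commute (g τ) (g σ)) :
    HasDerivAt (fun σ => NormedSpace.exp (g σ)) (NormedSpace.exp (g τ) * g') τ := by
  have h1 : HasDerivAt (fun σ => NormedSpace.exp (g σ - g τ)) g' τ := by
    have h2 : HasFDerivAt (NormedSpace.exp : 𝔸 → 𝔸) (1 : 𝔸 →L[ℝ] 𝔸) (g τ - g τ) := by
      rw [sub_self]
      exact hasFDerivAt_exp_zero
    exact h2.comp_hasDerivAt τ (hg.sub_const (g τ))
  have h3 : (fun σ => NormedSpace.exp (g σ)) =
      fun σ => NormedSpace.exp (g τ) * NormedSpace.exp (g σ - g τ) := by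
    funext σ
    rw [← exp_add_commute ((hc σ).sub_right (Commute.refl _)), add_sub_cancel]
  rw [h3]
  exact h1.const_mul _

/-- The path `t ↦ t a`. -/
noncomputable def ray (𝔸 : Type) [NormedRing 𝔸] [NormedAlgebra ℝ 𝔸] : 𝔸 →L[ℝ] Paths 𝔸 :=
  LinearMap.mkContinuous
    { toFun := fun a => BoundedContinuousFunction.mkOfCompact ⟨fun t => (t : ℝ) • a, by fun_prop⟩
      map_add' := fun a b => by ext t; exact smul_add _ _ _
      map_smul' := fun z a => by ext t; exact smul_comm _ _ _ } 1
    (fun a => by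
      rw [one_mul]
      refine (BoundedContinuousFunction.norm_le (norm_nonneg _)).mpr fun t => ?_
      change ‖(t : ℝ) • a‖ ≤ ‖a‖
      rw [norm_smul, Real.norm_of_nonneg t.2.1]
      exact mul_le_of_le_one_left (norm_nonneg _) t.2.2)

/-- The segment from `1` to `a`. -/
noncomputable def segment (a : 𝔸) : Paths 𝔸 := 1 + ray 𝔸 (a - 1)

theorem segment_apply (a : 𝔸) (t : unitInterval) : segment a t = 1 + (t : ℝ) • (a - 1) := rfl

theorem contDiff_segment {N : WithTop ℕ∞} : ContDiff ℝ N (segment (𝔸 := 𝔸)) :=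
  contDiff_const.add ((ray 𝔸).contDiff.comp (contDiff_id.sub contDiff_const))

theorem isUnit_path {u : Paths 𝔸} (hu : ∀ t, IsUnit (u t)) : IsUnit u := by
  have hc : Continuous fun t => Ring.inverse (u t) := continuous_iff_continuousAt.mpr fun t => by
    obtain ⟨v, hv⟩ := hu t
    have h1 : ContinuousAt (Ring.inverse : 𝔸 → 𝔸) (u t) := hv ▸ NormedRing.inverse_continuousAt v
    exact h1.comp u.continuous.continuousAt
  refine isUnit_iff_exists.mpr ⟨BoundedContinuousFunction.mkOfCompact ⟨_, hc⟩, ?_, ?_⟩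
  · ext t
    exact Ring.mul_inverse_cancel _ (hu t)
  · ext t
    exact Ring.inverse_mul_cancel _ (hu t)

/-- The logarithm `∫₀¹ (a - 1) (1 + s (a - 1))⁻¹ ds`. -/
noncomputable def segmentLog (a : 𝔸) : 𝔸 :=
  (a - 1) * primitive 𝔸 (Ring.inverse (segment a)) 1

theorem contDiffAt_segmentLog {a : 𝔸} (ha : IsUnit (segment a)) {N : WithTop ℕ∞} :
    ContDiffAt ℝ N segmentLog a := by
  have h1 : ContDiffAt ℝ N (fun a : 𝔸 => Ring.inverse (segment a)) a :=
    (contDiffAt_inverse (𝔸 := Paths 𝔸) ha).comp a contDiff_segment.contDiffAt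
  have h2 : ContDiffAt ℝ N (fun a : 𝔸 => primitive 𝔸 (Ring.inverse (segment a)) 1) a :=
    ((BoundedContinuousFunction.evalCLM (β := 𝔸) ℝ (1 : unitInterval)) ∘L
      primitive 𝔸).contDiff.contDiffAt.comp a h1
  exact (contDiffAt_id.sub contDiffAt_const).mul h2

theorem commute_integral {c : 𝔸} {g : ℝ → 𝔸} (hg : Continuous g) (h : ∀ s, Commute c (g s))
    (a b : ℝ) : Commute c (∫ s in a..b, g s) := by
  have h1 := (ContinuousLinearMap.mul ℝ 𝔸 c).intervalIntegral_comp_comm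
    (hg.intervalIntegrable (μ := volume) a b)
  have h2 := ((ContinuousLinearMap.mul ℝ 𝔸).flip c).intervalIntegral_comp_comm
    (hg.intervalIntegrable (μ := volume) a b)
  simp only [ContinuousLinearMap.mul_apply', ContinuousLinearMap.flip_apply] at h1 h2
  rw [Commute, SemiconjBy, ← h1, ← h2]
  exact intervalIntegral.integral_congr fun s _ => h s

/-- `exp (segmentLog a) = a`: the curve `exp (-∫₀^τ ...) (1 + τ (a - 1))` is constant. -/
theorem exp_segmentLog {a : 𝔸} (ha : IsUnit (segment a)) :
    NormedSpace.exp (segmentLog a) = a := by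
  set R : ℝ → 𝔸 := fun s => Ring.inverse (segment a) (Set.projIcc 0 1 zero_le_one s) with hR
  have hRc : Continuous R := continuous_projIcc_comp _
  have hRl : ∀ s, R s * segment a (Set.projIcc 0 1 zero_le_one s) = 1 := fun s =>
    DFunLike.congr_fun (Ring.inverse_mul_cancel _ ha) _
  have hRr : ∀ s, segment a (Set.projIcc 0 1 zero_le_one s) * R s = 1 := fun s =>
    DFunLike.congr_fun (Ring.mul_inverse_cancel _ ha) _
  have hcomm : ∀ c : 𝔸, Commute c (a - 1) → ∀ s, Commute c (R s) := by
    intro c hc s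
    have h1 : Commute c (segment a (Set.projIcc 0 1 zero_le_one s)) := by
      rw [segment_apply]
      exact (Commute.one_right c).add_right (hc.smul_right _)
    calc c * R s = R s * segment a (Set.projIcc 0 1 zero_le_one s) * c * R s := by
          rw [hRl, one_mul]
      _ = R s * c * (segment a (Set.projIcc 0 1 zero_le_one s) * R s) := by
          rw [mul_assoc (R s), ← h1.eq, mul_assoc, mul_assoc, mul_assoc]
      _ = R s * c := by rw [hRr, mul_one]
  set g : ℝ → 𝔸 := fun τ => (a - 1) * ∫ s in (0 : ℝ)..τ, R s with hg
  have hgd : ∀ τ, HasDerivAt g ((a - 1) * R τ) τ := fun τ =>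
    (intervalIntegral.integral_hasDerivAt_right (hRc.intervalIntegrable _ _)
      (hRc.stronglyMeasurableAtFilter _ _) hRc.continuousAt).const_mul _
  have hgc : ∀ c : 𝔸, Commute c (a - 1) → ∀ τ, Commute c (g τ) := fun c hc τ =>
    hc.mul_right (commute_integral hRc (hcomm c hc) _ _)
  have hgg : ∀ τ σ, Commute (g τ) (g σ) := fun τ σ =>
    hgc _ (hgc _ (Commute.refl _) τ).symm σ
  have hd : ∀ τ ∈ Set.Icc (0 : ℝ) 1,
      HasDerivAt (fun τ : ℝ => NormedSpace.exp (-g τ) * (1 + τ • (a - 1))) 0 τ := by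
    intro τ hτ
    have h1 := hasDerivAt_exp_of_commute (hgd τ).neg fun σ => (hgg τ σ).neg_left.neg_right
    have h2 : HasDerivAt (fun τ : ℝ => 1 + τ • (a - 1)) (a - 1) τ := by
      simpa using ((hasDerivAt_id τ).smul_const (a - 1)).const_add 1
    refine (h1.mul h2).congr_deriv ?_
    have h3 := hRl τ
    rw [segment_apply, Set.projIcc_of_mem zero_le_one hτ] at h3
    simp only [Pi.neg_apply]
    rw [mul_assoc, neg_mul, mul_assoc, h3, mul_one, mul_neg, neg_add_cancel]
  have hconst := constant_of_has_deriv_right_zero (a := (0 : ℝ)) (b := 1)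
    (fun τ hτ => (hd τ hτ).continuousAt.continuousWithinAt)
    (fun τ hτ => (hd τ ⟨hτ.1, hτ.2.le⟩).hasDerivWithinAt) 1 ⟨zero_le_one, le_rfl⟩
  have hg0 : g 0 = 0 := by simp [hg]
  have hg1 : g 1 = segmentLog a := rfl
  rw [hg0, hg1, zero_smul, add_zero, mul_one, neg_zero, NormedSpace.exp_zero, one_smul,
    add_sub_cancel] at hconst
  have h4 : NormedSpace.exp (segmentLog a) * NormedSpace.exp (-segmentLog a) = 1 := by
    rw [← exp_add_commute (Commute.refl _).neg_right, add_neg_cancel, NormedSpace.exp_zero]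
  calc _ = NormedSpace.exp (segmentLog a) * (NormedSpace.exp (-segmentLog a) * a) := by
        rw [hconst, mul_one]
    _ = a := by rw [← mul_assoc, h4, one_mul]

variable {E : Type} [NormedAddCommGroup E] [NormedSpace ℂ E] [FiniteDimensional ℂ E]

/-- An invertible operator can be multiplied by a nonzero complex number so that it has no real
eigenvalue. -/
theorem exists_rotation {M : E →L[ℂ] E} (hM : IsUnit M) : ∃ z : ℂ, z ≠ 0 ∧
    ∀ (x : ℝ) (v : E), (z • M) v = (x : ℂ) • v → v = 0 := by
  -- avoid the finitely many arguments of the eigenvalues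
  have hfin := Module.End.finite_hasEigenvalue (M : E →ₗ[ℂ] E)
  obtain ⟨t, ht⟩ := (hfin.image fun μ : ℂ => -μ.im / μ.re).infinite_compl.nonempty
  have hz : (1 + t * Complex.I : ℂ) ≠ 0 := fun h => by
    have := congrArg Complex.re h
    simp at this
  refine ⟨1 + t * Complex.I, hz, fun x v hv => ?_⟩
  by_contra hv0
  set μ : ℂ := (1 + t * Complex.I)⁻¹ * x with hμ
  have hMv : M v = μ • v := by
    rw [_root_.smul_apply] at hv
    rw [hμ, mul_smul, ← hv, smul_smul, inv_mul_cancel₀ hz, one_smul]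
  have hzμ : (1 + t * Complex.I) * μ = x := by rw [hμ, mul_inv_cancel_left₀ hz]
  have him : μ.im + t * μ.re = 0 := by
    have h1 := congrArg Complex.im hzμ
    simp at h1
    linarith
  have hμ0 : μ ≠ 0 := by
    intro h0
    rw [h0, zero_smul] at hMv
    obtain ⟨u, rfl⟩ := hM
    have h1 : (↑u⁻¹ : E →L[ℂ] E) ((u : E →L[ℂ] E) v) = v :=
      DFunLike.congr_fun u.inv_mul v
    rw [hMv, map_zero] at h1
    exact hv0 h1.symm
  have hre : μ.re ≠ 0 := by
    intro h0
    rw [h0, mul_zero, add_zero] at him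
    exact hμ0 (Complex.ext h0 him)
  refine ht ⟨μ, Module.End.hasEigenvalue_of_hasEigenvector (x := v)
    ⟨Module.End.mem_eigenspace_iff.mpr hMv, hv0⟩, ?_⟩
  simp only
  rw [div_eq_iff hre]
  linarith

/-- Near an invertible operator there is a smooth logarithm. -/
theorem exists_log [CompleteSpace E] {M₀ : E →L[ℂ] E} (hM₀ : IsUnit M₀) :
    ∃ Log : (E →L[ℂ] E) → (E →L[ℂ] E), ∀ᶠ M in 𝓝 M₀,
      (∀ N : WithTop ℕ∞, ContDiffAt ℝ N Log M) ∧ NormedSpace.exp (Log M) = M := by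
  obtain ⟨z, hz, hzM⟩ := exists_rotation hM₀
  -- no real eigenvalue, so no point of the segment from `1` to `z M₀` is singular
  have hseg : IsUnit (segment (z • M₀)) := by
    refine isUnit_path fun t => isUnit_of_injective fun v hv => ?_
    rw [segment_apply, _root_.add_apply, _root_.smul_apply, _root_.sub_apply,
      one_apply_eq_self] at hv
    by_cases ht : (t : ℝ) = 0
    · simpa [ht] using hv
    · refine hzM (((t : ℝ) - 1) / t) v ?_
      have ht' : ((t : ℝ) : ℂ) ≠ 0 := by exact_mod_cast ht
      rw [← Complex.coe_smul] at hv
      have h1 : ((t : ℝ) : ℂ) • (z • M₀) v = (((t : ℝ) : ℂ) - 1) • v := by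
        rw [← sub_eq_zero, ← hv]
        module
      calc (z • M₀) v = ((t : ℝ) : ℂ)⁻¹ • ((t : ℝ) : ℂ) • (z • M₀) v := by
            rw [smul_smul, inv_mul_cancel₀ ht', one_smul]
        _ = _ := by
            rw [h1, smul_smul]
            congr 1
            push_cast
            field_simp
  have hmul : ContDiff ℝ ⊤ fun M : E →L[ℂ] E => z • M := contDiff_const_smul z
  have hopen : ∀ᶠ M in 𝓝 M₀, IsUnit (segment (z • M)) := by
    have h1 : ContinuousAt (fun M : E →L[ℂ] E => segment (z • M)) M₀ :=
      ((contDiff_segment (N := 0)).continuous.comp hmul.continuous).continuousAt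
    exact h1.eventually_mem (Units.isOpen.mem_nhds hseg)
  -- the logarithm of `z M`, corrected by the scalar `log z`
  refine ⟨fun M => segmentLog (z • M) - Complex.log z • 1, ?_⟩
  filter_upwards [hopen] with M hM
  refine ⟨fun N => ?_, ?_⟩
  · exact ((contDiffAt_segmentLog hM).comp M
      ((contDiff_const_smul z : ContDiff ℝ N _).contDiffAt)).sub contDiffAt_const
  · have h1 : Commute (segmentLog (z • M)) (-(Complex.log z • (1 : E →L[ℂ] E))) :=
      ((Commute.one_right _).smul_right _).neg_right
    have h2 : NormedSpace.exp (-(Complex.log z • (1 : E →L[ℂ] E))) = z⁻¹ • 1 := by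
      rw [← neg_smul, ← Algebra.algebraMap_eq_smul_one, ← NormedSpace.algebraMap_exp_comm,
        ← Complex.exp_eq_exp_ℂ, Complex.exp_neg, Complex.exp_log hz, Algebra.algebraMap_eq_smul_one]
    rw [sub_eq_add_neg, exp_add_commute h1, exp_segmentLog hM, h2, smul_mul_smul_comm, mul_one,
      mul_inv_cancel₀ hz, one_smul]

end Logarithm

/-! ### Existence of Floquet reductions -/

section Floquet

variable {X : Type} [NormedAddCommGroup X] [NormedSpace ℝ X] [FiniteDimensional ℝ X]
  {E : Type} [NormedAddCommGroup E] [NormedSpace ℂ E] [FiniteDimensional ℂ E] [CompleteSpace E]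
  {A : X × ℝ → E →L[ℂ] E} {N : ℕ∞} {T : ℝ}

theorem hasDerivAt_ringInverse {F : ℝ → E →L[ℂ] E} {F' : E →L[ℂ] E} {θ : ℝ}
    (hF : HasDerivAt F F' θ) (hu : IsUnit (F θ)) :
    HasDerivAt (fun θ => Ring.inverse (F θ))
      (-(Ring.inverse (F θ) * F' * Ring.inverse (F θ))) θ := by
  obtain ⟨u, hu⟩ := hu
  have h1 : HasFDerivAt Ring.inverse _ (F θ) := hu ▸ hasFDerivAt_ringInverse (𝕜 := ℝ) u
  refine (h1.comp_hasDerivAt θ hF).congr_deriv ?_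
  rw [← hu, Ring.inverse_unit]
  ext1 v
  simp [ContinuousLinearMap.mulLeftRight_apply]

/-- Floquet's theorem with parameters: a linear system with periodic coefficients is locally
conjugate to one with constant coefficients, with `W (x, θ) = exp (θ M x) Φ (x, θ)⁻¹` and
`T M x` a logarithm of the monodromy `Φ (x, T)`. -/
theorem exists_periodic_conjugation (hT : T ≠ 0) (hA : ContDiff ℝ (N : WithTop ℕ∞) A) (hN : 1 ≤ N)
    (hper : ∀ x, Function.Periodic (fun θ => A (x, θ)) T) (x₀ : X) :
    ∃ (U : Set X) (W : X × ℝ → E →L[ℂ] E) (M : X → E →L[ℂ] E), IsOpen U ∧ x₀ ∈ U ∧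
      ContDiffOn ℝ (N : WithTop ℕ∞) W (U ×ˢ Set.univ) ∧ ContDiffOn ℝ (N : WithTop ℕ∞) M U ∧
      ∀ x ∈ U, (∀ θ, IsUnit (W (x, θ))) ∧ Function.Periodic (fun θ => W (x, θ)) T ∧
        ∀ θ, HasDerivAt (fun θ => W (x, θ)) (M x * W (x, θ) - W (x, θ) * A (x, θ)) θ := by
  have hΦu := isUnit_fundSol hT hA hN hper
  obtain ⟨Log, hLog⟩ := exists_log (hΦu x₀ T)
  have hmono : ContDiff ℝ (N : WithTop ℕ∞) fun x => fundSol hA (x, T) :=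
    (contDiff_fundSol hA).comp (contDiff_id.prodMk contDiff_const)
  obtain ⟨U, hU, hUo, hxU⟩ := eventually_nhds_iff.mp (hmono.continuous.continuousAt.eventually hLog)
  set M : X → E →L[ℂ] E := fun x => T⁻¹ • Log (fundSol hA (x, T)) with hM
  have hMs : ContDiffOn ℝ (N : WithTop ℕ∞) M U := fun x hx =>
    ((((hU x hx).1 N).comp x hmono.contDiffAt).const_smul T⁻¹).contDiffWithinAt
  have hexpT : ∀ x ∈ U, NormedSpace.exp (T • M x) = fundSol hA (x, T) := fun x hx => by
    rw [hM, smul_smul, mul_inv_cancel₀ hT, one_smul, (hU x hx).2]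
  have hexpu : ∀ B : E →L[ℂ] E, IsUnit (NormedSpace.exp B) := fun B =>
    ⟨⟨NormedSpace.exp B, NormedSpace.exp (-B), by
      rw [← exp_add_commute (Commute.refl B).neg_right, add_neg_cancel, NormedSpace.exp_zero], by
      rw [← exp_add_commute (Commute.refl B).neg_left, neg_add_cancel, NormedSpace.exp_zero]⟩, rfl⟩
  refine ⟨U, fun q => NormedSpace.exp (q.2 • M q.1) * Ring.inverse (fundSol hA q), M, hUo, hxU,
    ?_, hMs, fun x hx => ⟨fun θ => (hexpu _).mul (hΦu x θ).ringInverse, fun θ => ?_, fun θ => ?_⟩⟩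
  · have h1 : ContDiffOn ℝ (N : WithTop ℕ∞) (fun q : X × ℝ => q.2 • M q.1) (U ×ˢ Set.univ) :=
      contDiffOn_snd.smul (hMs.comp contDiffOn_fst fun q hq => hq.1)
    refine (contDiff_exp.comp_contDiffOn h1).mul fun q _ => ?_
    exact ((contDiffAt_inverse (hΦu q.1 q.2)).comp q
      (contDiff_fundSol hA).contDiffAt).contDiffWithinAt
  · obtain ⟨u, hu⟩ := hΦu x θ
    obtain ⟨v, hv⟩ := hΦu x T
    have hadd : NormedSpace.exp ((θ + T) • M x) = NormedSpace.exp (θ • M x) * v := by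
      rw [add_smul, exp_add_commute (((Commute.refl (M x)).smul_left θ).smul_right T),
        hexpT x hx, hv]
    simp only
    rw [fundSol_add hT hA hN hper, hadd, ← hu, ← hv, ← Units.val_mul, Ring.inverse_unit,
      Ring.inverse_unit, mul_inv_rev, Units.val_mul, mul_assoc, Units.mul_inv_cancel_left]
  · have h1 : HasDerivAt (fun θ : ℝ => NormedSpace.exp (θ • M x))
        (M x * NormedSpace.exp (θ • M x)) θ := hasDerivAt_exp_smul_const' (M x) θ
    refine (h1.mul (hasDerivAt_ringInverse (hasDerivAt_fundSol hA hN x θ) (hΦu x θ))).congr_deriv ?_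
    have h2 := Ring.mul_inverse_cancel _ (hΦu x θ)
    simp only [mul_assoc, h2, mul_one, sub_eq_add_neg, mul_neg]

end Floquet

section Reduction

variable {m n : ℕ} {r : ℕ∞} {f : RVec n → RVec n} {p : RVec (m + 1) → ℝ → RVec n}
  {ω : RVec (m + 1) → ℝ} {Ω K : Set (RVec (m + 1))} {c : RVec m}

theorem contDiffOn_matrix {Y : Type} [NormedAddCommGroup Y] [NormedSpace ℝ Y] {B : Y → Mat2 n}
    {s : Set Y} {N : WithTop ℕ∞} (h : ∀ i j, ContDiffOn ℝ N (fun y => B y i j) s) :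
    ContDiffOn ℝ N B s := by
  have h1 : B = fun y => ∑ i, ∑ j, B y i j • Matrix.single i j (1 : ℂ) := by
    funext y
    conv_lhs => rw [Matrix.matrix_eq_sum_single (B y)]
    simp
  rw [h1]
  exact ContDiffOn.sum fun i _ => ContDiffOn.sum fun j _ => (h i j).smul contDiffOn_const

theorem IsWaveFamily.contDiffOn_symbolMatrix (hw : IsWaveFamily r f p ω Ω K) :
    ContDiffOn ℝ (r : WithTop ℕ∞) (fun q : Freq m × ℝ => symbolMatrix f p ω c q.1 q.2)
      ((Prod.fst ⁻¹' Ω) ×ˢ Set.univ) := by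
  have hk : ContDiff ℝ (r : WithTop ℕ∞) fun q : Freq m × ℝ => q.1.1 :=
    contDiff_fst.comp contDiff_fst
  have hmaps : Set.MapsTo (fun q : Freq m × ℝ => q.1.1) ((Prod.fst ⁻¹' Ω) ×ˢ Set.univ) Ω :=
    fun q hq => hq.1
  have hof : ContDiff ℝ (r : WithTop ℕ∞) fun t : ℝ => (t : ℂ) := Complex.ofRealCLM.contDiff
  have hinv : ContDiffOn ℝ (r : WithTop ℕ∞) (fun q : Freq m × ℝ => ‖q.1.1‖⁻¹)
      ((Prod.fst ⁻¹' Ω) ×ˢ Set.univ) := fun q hq =>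
    ((hk.contDiffAt.norm ℝ (norm_ne_zero_iff.mp (hw.norm_ne_zero hq.1))).inv
      (hw.norm_ne_zero hq.1)).contDiffWithinAt
  have hω : ContDiffOn ℝ (r : WithTop ℕ∞) (fun q : Freq m × ℝ => ω q.1.1)
      ((Prod.fst ⁻¹' Ω) ×ˢ Set.univ) := hw.frequency_smooth.comp hk.contDiffOn hmaps
  have hs : ContDiff ℝ (r : WithTop ℕ∞) fun q : Freq m × ℝ => shift c q.1 :=
    (contDiff_shift c).comp contDiff_fst
  have hp : ContDiffOn ℝ (r : WithTop ℕ∞) (fun q : Freq m × ℝ => p q.1.1 q.2)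
      ((Prod.fst ⁻¹' Ω) ×ˢ Set.univ) :=
    hw.profile_smooth.comp (hk.prodMk contDiff_snd).contDiffOn fun q hq => ⟨hq.1, trivial⟩
  have hf : ContDiff ℝ (r : WithTop ℕ∞) (fderiv ℝ f) :=
    hw.reaction_smooth.fderiv_right (by norm_cast)
  have hJ : ∀ i j, ContDiffOn ℝ (r : WithTop ℕ∞)
      (fun q : Freq m × ℝ => jacobianAlong f p q.1.1 q.2 i j)
      ((Prod.fst ⁻¹' Ω) ×ˢ Set.univ) := fun i j =>
    hof.comp_contDiffOn ((EuclideanSpace.proj i : RVec n →L[ℝ] ℝ).contDiff.comp_contDiffOn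
      ((hf.comp_contDiffOn hp).clm_apply contDiffOn_const))
  have hinv' := hof.comp_contDiffOn hinv
  refine contDiffOn_matrix fun i j => ?_
  rcases i with i | i <;> rcases j with j | j
  · exact hinv'.mul (contDiffOn_const (c := 0))
  · exact hinv'.mul (contDiffOn_const (c := (1 : Matrix (Fin n) (Fin n) ℂ) i j))
  · exact hinv'.mul ((hs.contDiffOn.mul contDiffOn_const).add (hJ i j))
  · exact hinv'.mul ((hof.comp_contDiffOn (hinv.mul hω)).mul
      (contDiffOn_const (c := (1 : Matrix (Fin n) (Fin n) ℂ) i j)))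

theorem IsWaveFamily.symbolMatrix_periodic (hw : IsWaveFamily r f p ω Ω K) {x : Freq m}
    (hx : x.1 ∈ Ω) : Function.Periodic (symbolMatrix f p ω c x) (2 * Real.pi) := fun θ => by
  simp only [symbolMatrix, jacobianAlong, hw.periodic _ hx θ]

/-- Near every wave vector of the family there is a Floquet reduction. The parameter-dependent
Floquet theorem applies to the coefficients cut off in the frequency variables. -/
theorem IsWaveFamily.exists_reduction (hw : IsWaveFamily r f p ω Ω K) (hr : 1 ≤ r) (c : RVec m)
    {x₀ : Freq m} (hx₀ : x₀.1 ∈ Ω) :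
    ∃ U W M₁, x₀ ∈ U ∧ IsFloquetReduction r f p ω Ω c U W M₁ := by
  obtain ⟨ε, hε, hball⟩ := Metric.nhds_basis_closedBall.mem_iff.mp (hw.isOpen_dom.mem_nhds hx₀)
  -- The cutoff involves only the wave vector, since the coefficients are smooth in the other
  -- variables on the whole space.
  let χ : ContDiffBump x₀.1 := ⟨ε / 2, ε, half_pos hε, half_lt_self hε⟩
  set A : Freq m × ℝ → Sys n →L[ℂ] Sys n := fun q =>
    χ q.1.1 • matOpL n (symbolMatrix f p ω c q.1 q.2) with hAdef
  have hχ : ContDiff ℝ (r : WithTop ℕ∞) fun q : Freq m × ℝ => χ q.1.1 :=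
    χ.contDiff.comp (contDiff_fst.comp contDiff_fst)
  have hA : ContDiff ℝ (r : WithTop ℕ∞) A := by
    refine contDiff_iff_contDiffAt.mpr fun q => ?_
    by_cases hq : q.1.1 ∈ Ω
    · have h1 := (hw.contDiffOn_symbolMatrix (c := c)).contDiffAt
        (x := q) (((hw.isOpen_dom.preimage continuous_fst).prod isOpen_univ).mem_nhds ⟨hq, trivial⟩)
      exact hχ.contDiffAt.smul ((matOpL n).contDiff.contDiffAt.comp q h1)
    · have h1 : ∀ᶠ k in 𝓝 q.1.1, χ k = 0 := by
        refine notMem_tsupport_iff_eventuallyEq.mp fun h => hq (hball ?_)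
        rwa [χ.tsupport_eq] at h
      have h2 : A =ᶠ[𝓝 q] fun _ => 0 := by
        filter_upwards [(continuous_fst.comp continuous_fst).continuousAt.eventually h1] with y hy
        have hy0 : χ y.1.1 = 0 := hy
        simp only [hAdef, hy0]
        exact zero_smul ℝ (_ : Sys n →L[ℂ] Sys n)
      exact contDiffAt_const.congr_of_eventuallyEq h2
  have hper : ∀ x, Function.Periodic (fun θ => A (x, θ)) (2 * Real.pi) := fun x θ => by
    by_cases hx : x.1 ∈ Ω
    · simp only [hAdef, hw.symbolMatrix_periodic hx θ]
    · have h1 : χ x.1 = 0 := χ.zero_of_le_dist (not_lt.mp fun h => hx (hball h.le))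
      simp only [hAdef, h1]
      exact (zero_smul ℝ (_ : Sys n →L[ℂ] Sys n)).trans (zero_smul ℝ (_ : Sys n →L[ℂ] Sys n)).symm
  obtain ⟨U, W, M, hU, hxU, hW, hM, hUW⟩ :=
    exists_periodic_conjugation Real.two_pi_pos.ne' hA hr hper x₀
  have hA1 : ∀ x : Freq m, x.1 ∈ Metric.ball x₀.1 (ε / 2) → ∀ θ,
      A (x, θ) = matOp (symbolMatrix f p ω c x θ) := fun x hx θ => by
    simp only [hAdef]
    rw [χ.one_of_mem_closedBall (Metric.ball_subset_closedBall hx), one_smul, matOpL_apply]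
  refine ⟨U ∩ Prod.fst ⁻¹' Metric.ball x₀.1 (ε / 2), fun x θ => opMatL n (W (x, θ)),
    fun x => opMatL n (M x), ⟨hxU, Metric.mem_ball_self (half_pos hε)⟩, ?_⟩
  refine ⟨hU.inter (Metric.isOpen_ball.preimage continuous_fst), fun x hx => hball ?_, ?_, ?_,
    fun x hx θ => ?_, fun x hx θ => ?_, fun x hx θ => ?_⟩
  · exact Metric.closedBall_subset_closedBall (half_le_self hε.le)
      (Metric.ball_subset_closedBall hx.2)
  · exact (opMatL n).contDiff.comp_contDiffOn
      (hW.mono (Set.prod_mono Set.inter_subset_left subset_rfl))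
  · exact (opMatL n).contDiff.comp_contDiffOn (hM.mono Set.inter_subset_left)
  · exact ((hUW x hx.1).1 θ).map (Matrix.toEuclideanCLM (n := Fin n ⊕ Fin n) (𝕜 := ℂ)).symm
  · exact congrArg (opMatL n) ((hUW x hx.1).2.1 θ)
  · refine ((opMatL n).hasFDerivAt.comp_hasDerivAt θ ((hUW x hx.1).2.2 θ)).congr_deriv ?_
    apply matOp_injective
    rw [matOp_opMatL, matOp_sub, matOp_mul, matOp_mul, matOp_opMatL, matOp_opMatL, hA1 x hx.2 θ]
    rfl

end Reduction

/-! ### Uniformly bounded symmetrizers -/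

section Bounded

variable {m n : ℕ} {r : ℕ∞} {f : RVec n → RVec n} {p : RVec (m + 1) → ℝ → RVec n}
  {ω : RVec (m + 1) → ℝ} {Ω K : Set (RVec (m + 1))} {c : RVec m} {U V : Set (Freq m)}
  {W : Freq m → ℝ → Mat2 n} {M₁ S : Freq m → Mat2 n}

theorem IsFloquetReduction.mono (h : IsFloquetReduction r f p ω Ω c U W M₁) (hV : IsOpen V)
    (hVU : V ⊆ U) : IsFloquetReduction r f p ω Ω c V W M₁ where
  isOpen := hV
  dom x hx := h.dom x (hVU hx)
  smooth_conj := h.smooth_conj.mono (Set.prod_mono hVU subset_rfl)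
  smooth_avg := h.smooth_avg.mono hVU
  invertible x hx := h.invertible x (hVU hx)
  periodic x hx := h.periodic x (hVU hx)
  conj_eq x hx := h.conj_eq x (hVU hx)

theorem IsSymmetrizer.mono (h : IsSymmetrizer K c U M₁ S) (hVU : V ⊆ U) :
    IsSymmetrizer K c V M₁ S where
  contDiffOn := h.contDiffOn.mono hVU
  isHermitian x hx := h.isHermitian x (hVU hx)
  estimate x hx := h.estimate x (hVU hx)
  nonneg x hx := h.nonneg x (hVU hx)

/-- Every point over `K` has a neighbourhood with a reduction and a bounded symmetrizer. -/
theorem IsWaveFamily.exists_bounded_symmetrizer (hw : IsWaveFamily r f p ω Ω K) (hr : 2 ≤ r)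
    (hstab : ∀ k ∈ K, DiffusivelyStable f p ω k) (c : RVec m) {x₀ : Freq m} (hx₀ : x₀.1 ∈ K) :
    ∃ U W M₁ S, ∃ C : ℝ, x₀ ∈ U ∧ IsFloquetReduction r f p ω Ω c U W M₁ ∧
      IsSymmetrizer K c U M₁ S ∧ ∀ x ∈ U, ‖S x‖ ≤ C := by
  obtain ⟨U, W, M₁, hxU, hred⟩ :=
    hw.exists_reduction (one_le_two.trans hr) c (hw.subset_dom hx₀)
  obtain ⟨S, hS⟩ := hred.exists_symmetrizer hw hr hstab
  have hc : ContinuousAt S x₀ := hS.contDiffOn.continuousOn.continuousAt (hred.isOpen.mem_nhds hxU)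
  obtain ⟨V, hV, hVo, hxV⟩ := eventually_nhds_iff.mp
    ((hc.norm.eventually_lt_const (lt_add_one ‖S x₀‖)).and (hred.isOpen.mem_nhds hxU))
  exact ⟨V, W, M₁, S, ‖S x₀‖ + 1, hxV, hred.mono hVo fun x hx => (hV x hx).2,
    hS.mono fun x hx => (hV x hx).2, fun x hx => (hV x hx).1.le⟩

end Bounded

end FloquetSymmetrizer

theorem proposition3p3 {m n : ℕ} (r : ℕ∞) (hr : 2 ≤ r)
    (f : FloquetSymmetrizer.RVec n → FloquetSymmetrizer.RVec n)
    (p : FloquetSymmetrizer.RVec (m + 1) → ℝ → FloquetSymmetrizer.RVec n)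
    (ω : FloquetSymmetrizer.RVec (m + 1) → ℝ)
    (Ω K : Set (FloquetSymmetrizer.RVec (m + 1)))
    (c : FloquetSymmetrizer.RVec m)
    (hwave : FloquetSymmetrizer.IsWaveFamily r f p ω Ω K)
    (hstab : ∀ k ∈ K, FloquetSymmetrizer.DiffusivelyStable f p ω k) :
    -- around all points of bounded frequency there are reductions and symmetrizers,
    -- with a uniform bound
    (∀ R : ℝ, ∃ C : ℝ, ∀ x₀ ∈ FloquetSymmetrizer.boundedFreq K c R,
      ∃ (U : Set (FloquetSymmetrizer.Freq m))
        (W : FloquetSymmetrizer.Freq m → ℝ → FloquetSymmetrizer.Mat2 n)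
        (M₁ S : FloquetSymmetrizer.Freq m → FloquetSymmetrizer.Mat2 n),
        x₀ ∈ U ∧ FloquetSymmetrizer.IsFloquetReduction r f p ω Ω c U W M₁ ∧
        FloquetSymmetrizer.IsSymmetrizer K c U M₁ S ∧ ∀ x ∈ U, ‖S x‖ ≤ C) ∧
    -- every reduction, on whatever open set it is given, admits a symmetrizer there
    (∀ (U : Set (FloquetSymmetrizer.Freq m))
      (W : FloquetSymmetrizer.Freq m → ℝ → FloquetSymmetrizer.Mat2 n)
      (M₁ : FloquetSymmetrizer.Freq m → FloquetSymmetrizer.Mat2 n),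
      FloquetSymmetrizer.IsFloquetReduction r f p ω Ω c U W M₁ →
      ∃ S : FloquetSymmetrizer.Freq m → FloquetSymmetrizer.Mat2 n,
        FloquetSymmetrizer.IsSymmetrizer K c U M₁ S ∧
        ∀ Q ⊆ U, IsCompact Q → ∃ C : ℝ, ∀ x ∈ Q, ‖S x‖ ≤ C) := by
  constructor
  · intro R
    choose! U W M₁ S C hxU hred hsym hbd using fun x₀ (hx₀ : x₀ ∈
      FloquetSymmetrizer.boundedFreq K c R) =>
      hwave.exists_bounded_symmetrizer hr hstab c hx₀.1
    obtain ⟨t, ht, hcover⟩ := (FloquetSymmetrizer.isCompact_boundedFreq hwave.isCompact c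
      R).elim_nhds_subcover U fun x hx => (hred x hx).isOpen.mem_nhds (hxU x hx)
    obtain ⟨B, hB⟩ := (t.finite_toSet.image C).bddAbove
    refine ⟨B, fun x₀ hx₀ => ?_⟩
    obtain ⟨y, hy, hxy⟩ := Set.mem_iUnion₂.mp (hcover hx₀)
    exact ⟨U y, W y, M₁ y, S y, hxy, hred y (ht y hy), hsym y (ht y hy), fun x hx =>
      (hbd y (ht y hy) x hx).trans (hB ⟨y, hy, rfl⟩)⟩
  · intro U W M₁ hred
    obtain ⟨S, hS⟩ := hred.exists_symmetrizer hwave hr hstab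
    exact ⟨S, hS, fun Q hQ hQc =>
      hQc.exists_bound_of_continuousOn (hS.contDiffOn.continuousOn.mono hQ)⟩
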